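/- Let $0\le k<n$ be integers. A configuration in $\mathbb R^n$ is a finite subset of $\mathbb R^n$, and $\mathcal C^n$ is the set of all configurations with the topology having as a basis the sets $C(B,V)$, where $B$ is a closed ball of positive radius centered at the origin, $V$ is, for some $p\ge 0$, an open set of configurations of $p$ points in the interior of $B$ (for the quotient topology from ordered $p$-tuples of distinct points), and $C(B,V)$ is the set of configurations $c$ with $c\cap\partial B=\varnothing$ and $c\cap B\in V$. Let $\mathcal C^{n,j}\subset\mathcal C^n$ be the subspace of configurations contained in $\mathbb R^{j}\times(0,1)^{n-j}$. Let $\mathcal M^{n,k}\subset\mathcal C^n\times[0,\infty)$ be the subspace of pairs $(C,a)$ with $C\subset\mathbb R^k\times(0,a)\times(0,1)^{n-k-1}$; it is a monoid under juxtaposition in the $(k+1)$st coordinate, $(C,a)(C',a')=(C\cup(C'+a\,e_{k+1}),\,a+a')$, with identity $(\varnothing,0)$. Let $B\mathcal M^{n,k}$ be its classifying space: the quotient, with the quotient topology, of $\coprod_{p\ge0}\Delta^p\times(\mathcal M^{n,k})^p$ (product topologies) in which, for each $(m_1,\dots,m_p)$ with $p\ge 1$, the $i$th face of its simplex ($0\le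 i\le p$) is identified with the simplex of the $(p-1)$-tuple obtained by deleting $m_1$ (if $i=0$), deleting $m_p$ (if $i=p$), or replacing $m_i,m_{i+1}$ by $m_im_{i+1}$ (if $0<i<p$). Fix a homeomorphism $\varphi:\mathbb R\to(-1,1)$. For $m_j=(C_j,c_j)\in\mathcal M^{n,k}$ ($1\le j\le p$) and barycentric coordinates $w=(w_0,\dots,w_p)\in\Delta^p$, let $C$ be the configuration of the product $m_1\cdots m_p$, let $a_i=c_1+\dots+c_i$ for $0\le i\le p$, and put $$b=\sum_i w_ia_i,\qquad b^+=\sum_i w_i\max\{a_i,b\},\qquad b^-=\sum_i w_i\min\{a_i,b\}.$$ Let $L:\mathbb R^n\to\mathbb R^n$ be the map that is the identity in all coordinates except the $(k+1)$st, where it is $t\mapsto \frac{b^-+b^+}{2}+\frac{b^+-b^-}{2}\varphi(t)$. **Proposition 1.3.** There is a well-defined continuous map $\sigma: B\mathcal M^{n,k}\to\mathcal C^{n,k+1}$ that sends the point of $B\mathcal M^{n,k}$ given by $(m_1,\dots,m_p)$ and $w$ to $L^{-1}(C)$, for all $p$, $(m_1,\dots,m_p)$ and $w$, and $\sigma$ is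 a weak homotopy equivalence: it induces a bijection on path components and isomorphisms on all homotopy groups at all base points. In particular $\mathcal C^{n,k+1}$ is weakly homotopy equivalent to $B\mathcal M^{n,k}$. -/

import Mathlib

noncomputable section

/-! ### Configurations of finitely many points -/

/-- A configuration in `ℝⁿ`: a finite set of (distinct, unordered) points. -/
@[ext]
structure PointConfig (n : ℕ) where
  carrier : Set (EuclideanSpace ℝ (Fin n))
  finite : carrier.Finite

namespace PointConfig

variable {n : ℕ}

/-- The empty configuration. -/
def empty (n : ℕ) : PointConfig n := ⟨∅, Set.finite_empty⟩

/-- The part of a configuration lying in a given subset of `ℝⁿ`. -/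
def restrict (c : PointConfig n) (B : Set (EuclideanSpace ℝ (Fin n))) : PointConfig n :=
  ⟨c.carrier ∩ B, c.finite.subset Set.inter_subset_left⟩

/-- The union of two configurations. -/
def union (c d : PointConfig n) : PointConfig n :=
  ⟨c.carrier ∪ d.carrier, c.finite.union d.finite⟩

/-- Translation of a configuration by a vector. -/
def translate (v : EuclideanSpace ℝ (Fin n)) (c : PointConfig n) : PointConfig n :=
  ⟨(fun x => x + v) '' c.carrier, c.finite.image _⟩

/-- Ordered configurations: `p`-tuples of distinct points of a set `U ⊆ ℝⁿ`, with the
subspace topology from `(ℝⁿ)^p`. -/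
abbrev Ordered (n p : ℕ) (U : Set (EuclideanSpace ℝ (Fin n))) : Type :=
  {x : Fin p → EuclideanSpace ℝ (Fin n) // Function.Injective x ∧ ∀ i, x i ∈ U}

/-- The unordered configuration underlying an ordered one. -/
def ofOrdered {p : ℕ} {U : Set (EuclideanSpace ℝ (Fin n))} (x : Ordered n p U) :
    PointConfig n :=
  ⟨Set.range x.1, Set.finite_range x.1⟩

/-- `V` is an open set of configurations of `p` points in `U`, for the usual topology on such
configurations, namely the quotient topology from ordered configurations. -/
def IsOpenOfCard (p : ℕ) (U : Set (EuclideanSpace ℝ (Fin n))) (V : Set (PointConfig n)) : Prop :=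
  (∀ c ∈ V, c.carrier ⊆ U ∧ c.carrier.ncard = p) ∧
    IsOpen {x : Ordered n p U | ofOrdered x ∈ V}

/-- For `B` the closed ball of radius `r` about the origin, the set of all configurations `c`
disjoint from `∂B` such that `c ∩ B` lies in `V`. -/
def basicSet (r : ℝ) (V : Set (PointConfig n)) : Set (PointConfig n) :=
  {c | Disjoint c.carrier (Metric.sphere 0 r) ∧ c.restrict (Metric.closedBall 0 r) ∈ V}

/-- The topology on configurations in which convergence means convergence on larger and larger
compact sets: the basic open sets are the sets `basicSet r V` with `V` an open set of
configurations of `p` points in the interior of the ball of radius `r`. -/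
instance : TopologicalSpace (PointConfig n) :=
  TopologicalSpace.generateFrom
    {S | ∃ r : ℝ, 0 < r ∧ ∃ (p : ℕ) (V : Set (PointConfig n)),
      IsOpenOfCard p (Metric.ball 0 r) V ∧ S = basicSet r V}

end PointConfig

/-- The subspace of configurations in `ℝⁿ` contained in `ℝᵏ × (0,1)ⁿ⁻ᵏ`. -/
abbrev ConfigSpace (n k : ℕ) : Type :=
  {c : PointConfig n // ∀ x ∈ c.carrier, ∀ i : Fin n, k ≤ (i : ℕ) → x i ∈ Set.Ioo (0 : ℝ) 1}

/-! ### The monoid of configurations in slabs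

Coordinates are numbered from `0`, so that `k : Fin n` is the `(k+1)`st coordinate, and `k < n`. -/

/-- Pairs `(C, a)` with `a ∈ [0, ∞)` and `C` a configuration contained in the slab
`ℝᵏ × (0,a) × (0,1)ⁿ⁻ᵏ⁻¹`. -/
def SlabMonoid (n : ℕ) (k : Fin n) : Type :=
  {m : PointConfig n × NNReal // ∀ x ∈ m.1.carrier,
    x k ∈ Set.Ioo (0 : ℝ) m.2 ∧ ∀ i : Fin n, k < i → x i ∈ Set.Ioo (0 : ℝ) 1}

namespace SlabMonoid

variable {n : ℕ} {k : Fin n}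

/-- The subspace topology from the product of configurations with `[0, ∞)`. -/
instance : TopologicalSpace (SlabMonoid n k) := instTopologicalSpaceSubtype

/-- The configuration `C` of a pair `(C, a)`. -/
def config (m : SlabMonoid n k) : PointConfig n := m.1.1

/-- The width `a` of the slab of a pair `(C, a)`. -/
def width (m : SlabMonoid n k) : NNReal := m.1.2

theorem ext' {m m' : SlabMonoid n k} (h : m.config.carrier = m'.config.carrier)
    (h' : m.width = m'.width) : m = m' :=
  Subtype.ext (Prod.ext (PointConfig.ext h) h')

/-- Juxtaposition in the `(k+1)`st coordinate:
`(C, a) * (C', a') = (C ∪ (C' + a e_{k+1}), a + a')`. -/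
instance : Mul (SlabMonoid n k) where
  mul m m' := ⟨(m.config.union (m'.config.translate (EuclideanSpace.single k (m.width : ℝ))),
    m.width + m'.width), by
    rintro x (hx | ⟨y, hy, rfl⟩)
    · obtain ⟨h, h'⟩ := m.2 x hx
      refine ⟨⟨h.1, lt_of_lt_of_le h.2 ?_⟩, h'⟩
      change (m.width : ℝ) ≤ ((m.width + m'.width : NNReal) : ℝ)
      simp
    · obtain ⟨h, h'⟩ := m'.2 y hy
      refine ⟨⟨?_, ?_⟩, fun i hi => ?_⟩
      · have := m.width.2
        simp only [PiLp.add_apply, PiLp.single_apply, if_true]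
        exact add_pos_of_pos_of_nonneg h.1 this
      · have : y k < (m'.width : ℝ) := h.2
        simp only [PiLp.add_apply, PiLp.single_apply, if_true, NNReal.coe_add]
        linarith
      · simpa [hi.ne'] using h' i hi⟩

instance : One (SlabMonoid n k) where
  one := ⟨(PointConfig.empty n, 0), fun _ hx => hx.elim⟩

theorem config_mul (m m' : SlabMonoid n k) : (m * m').config.carrier =
    m.config.carrier ∪
      (fun x => x + EuclideanSpace.single k (m.width : ℝ)) '' m'.config.carrier := rfl

theorem width_mul (m m' : SlabMonoid n k) : (m * m').width = m.width + m'.width := rfl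

theorem config_one : (1 : SlabMonoid n k).config.carrier = ∅ := rfl

theorem width_one : (1 : SlabMonoid n k).width = 0 := rfl

instance : Monoid (SlabMonoid n k) where
  mul_assoc a b c := by
    refine ext' ?_ (add_assoc _ _ _)
    simp only [config_mul, width_mul, Set.image_union, Set.image_image, Set.union_assoc,
      add_assoc, NNReal.coe_add]
    congr 3
    funext x
    ext i
    by_cases h : i = k <;> simp [h, add_comm]
  one_mul a := by
    refine ext' ?_ (zero_add _)
    have h : EuclideanSpace.single k (0 : ℝ) = 0 := by
      ext i
      simp
    simp only [config_mul, config_one, width_one, NNReal.coe_zero, h, add_zero, Set.image_id',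
      Set.empty_union]
  mul_one a := by
    refine ext' ?_ (add_zero _)
    simp [config_mul, config_one]

end SlabMonoid

/-! ### The classifying space of a monoid with a topology -/

section ClassifyingSpace

variable (M : Type*) [Monoid M] [TopologicalSpace M]

/-- The disjoint union of the spaces `Δᵖ × Mᵖ`, each with the product topology. -/
abbrev BarCells : Type _ := Σ p : ℕ, stdSimplex ℝ (Fin (p + 1)) × (Fin p → M)

variable {M}

/-- The `i`th face of a `(p+1)`-tuple `(m₁, …, m_{p+1})`: the first face drops `m₁`, the last
one drops `m_{p+1}`, and the others replace two adjacent entries by their product. -/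
def barFace {p : ℕ} (i : Fin (p + 2)) (m : Fin (p + 1) → M) : Fin p → M := fun j =>
  if (j : ℕ) + 1 < i then m j.castSucc
  else if (j : ℕ) + 1 = i then m j.castSucc * m j.succ
  else m j.succ

variable (M) in
/-- The identifications over `∂Δ^{p+1} × M^{p+1}`: the `i`th face of the cell of `m` (where the
`i`th barycentric coordinate is `0`) is glued to the cell of the `i`th face of `m`. -/
inductive BarGlue : BarCells M → BarCells M → Prop
  | face (p : ℕ) (i : Fin (p + 2)) (w : stdSimplex ℝ (Fin (p + 1))) (m : Fin (p + 1) → M) :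
      BarGlue ⟨p + 1, stdSimplex.map i.succAbove w, m⟩ ⟨p, w, barFace i m⟩

variable (M) in
/-- The classifying space `BM`: the quotient of `∐ₚ Δᵖ × Mᵖ` by the equivalence relation
generated by the face identifications, with the quotient topology. -/
def ClassifyingSpace : Type _ := Quot (BarGlue M)

instance : TopologicalSpace (ClassifyingSpace M) := instTopologicalSpaceQuot

/-- The point of `BM` given by a tuple `(m₁, …, mₚ)` and barycentric coordinates
`(w₀, …, wₚ)`. -/
def ClassifyingSpace.mk {p : ℕ} (w : stdSimplex ℝ (Fin (p + 1))) (m : Fin p → M) :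
    ClassifyingSpace M :=
  Quot.mk _ ⟨p, w, m⟩

end ClassifyingSpace

/-! ### Weak homotopy equivalences -/

section WeakEquivalence

variable {X Y : Type*} [TopologicalSpace X] [TopologicalSpace Y]

/-- The map induced by a continuous map on path components. -/
def zerothHomotopyMap (f : C(X, Y)) : ZerothHomotopy X → ZerothHomotopy Y :=
  Quotient.map f fun _ _ h => h.map f.continuous

/-- The map `π_N(X, x) → π_N(Y, f x)` induced by a continuous map `f`. -/
def homotopyGroupMap (N : Type*) (f : C(X, Y)) (x : X) :
    HomotopyGroup N X x → HomotopyGroup N Y (f x) :=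
  Quotient.map (fun g => ⟨f.comp g.1, fun y hy => congrArg f (g.2 y hy)⟩)
    fun _ _ h => ContinuousMap.HomotopicRel.comp_continuousMap h f

/-- A weak homotopy equivalence: a continuous map inducing a bijection on path components and
on all homotopy groups at all base points. -/
def IsWeakHomotopyEquiv (f : C(X, Y)) : Prop :=
  Function.Bijective (zerothHomotopyMap f) ∧
    ∀ (q : ℕ) (x : X), Function.Bijective (homotopyGroupMap (Fin (q + 1)) f x)

end WeakEquivalence

/-! ### Barycenters of slice positions and the stretching map -/

/-- The positions `0 = a₀ ≤ a₁ ≤ ⋯ ≤ aₚ` of the slices cutting the product `m₁ ⋯ mₚ` into its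
factors: `aᵢ` is the sum of the widths of `m₁, …, mᵢ`. -/
def slicePosition {n : ℕ} {k : Fin n} {p : ℕ} (m : Fin p → SlabMonoid n k) (i : Fin (p + 1)) : ℝ :=
  ∑ j : Fin p, if j.castSucc < i then ((m j).width : ℝ) else 0

section Barycenter

variable {p : ℕ} (w a : Fin (p + 1) → ℝ)

/-- The barycenter `b = ∑ wᵢ aᵢ`. -/
def baryCenter : ℝ := ∑ i, w i * a i

/-- The upper barycenter `b⁺ = ∑ wᵢ max(aᵢ, b)`. -/
def upperBaryCenter : ℝ := ∑ i, w i * max (a i) (baryCenter w a)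

/-- The lower barycenter `b⁻ = ∑ wᵢ min(aᵢ, b)`. -/
def lowerBaryCenter : ℝ := ∑ i, w i * min (a i) (baryCenter w a)

end Barycenter

/-- Given an identification `φ` of `ℝ` with `(-1,1)`, the map `ℝⁿ → ℝⁿ` that is the identity in
all coordinates except the `(k+1)`st, where it is `φ` followed by the affine map taking `[-1,1]`
onto `[lo,hi]`. -/
def squeeze {n : ℕ} (k : Fin n) (φ : ℝ ≃ₜ Set.Ioo (-1 : ℝ) 1) (lo hi : ℝ)
    (x : EuclideanSpace ℝ (Fin n)) : EuclideanSpace ℝ (Fin n) :=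
  WithLp.toLp 2 (Function.update x.ofLp k ((lo + hi) / 2 + (hi - lo) / 2 * (φ (x k) : ℝ)))

/-- For a tuple `(m₁, …, mₚ)` and weights `(w₀, …, wₚ)`, the set `L⁻¹(C)`, where `C` is the
configuration of the product `m₁ ⋯ mₚ` and `L` is the squeezing map onto the slab between the
lower and the upper barycenter of the slice positions. (Translating `C` and all slices together
in the `(k+1)`st coordinate, so as to put the barycenter at `0`, does not change this set.) -/
def stretchedConfig {n : ℕ} {k : Fin n} (φ : ℝ ≃ₜ Set.Ioo (-1 : ℝ) 1) {p : ℕ}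
    (w : stdSimplex ℝ (Fin (p + 1))) (m : Fin p → SlabMonoid n k) :
    Set (EuclideanSpace ℝ (Fin n)) :=
  squeeze k φ (lowerBaryCenter w (slicePosition m)) (upperBaryCenter w (slicePosition m)) ⁻¹'
    (List.ofFn m).prod.config.carrier

end

/-! Call the coordinate `k` the height. A point of the classifying space is a configuration cut by
finitely many weighted slices, that is, hyperplanes of constant height that miss it. Passing to a
face forgets a slice of weight zero (`barFace_segs`). Hence only the slices of positive weight and
the part of the configuration between the outermost of them matter (`mk_segs_eq`). Up to translation
these determine the point: `datum` records them and `slicedPoint` rebuilds the point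
(`slicedPoint_datum`). The map `scan` forgets the slices and stretches the slab between the lower
and the upper barycenter to all heights; the radius is half the width of that slab.

By `BallCompressible.isWeakHomotopyEquiv` it suffices to show the following. If `f` maps a ball to
configurations and `g` lifts it over the boundary sphere, then `f` is homotopic relative to the
sphere to a map with a lift that extends `g`.

To lift over the ball, note that a finite configuration misses all but finitely many heights.
Compactness gives finitely many slices, and a partition of unity weights them
(`exists_subordinate`). Scanning the lift differs from `f` only in the slab that is stretched, and
`interpolate` joins the two by moving center and radius of the slab linearly.

Over the sphere this lift has to be joined to `g`. The weights of the slices of `g` are first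
concentrated on the slices above the upper barycenter, which exist once the radius is positive
(`excess_pos`). They are then transferred linearly to the new slices, which lie between the two
barycenters and so below the old ones that carry weight. The slices therefore never have to be
reordered, and they all stay between the extreme slices of `g`, so the same interpolation fills the
square that compares the two homotopies (`compressible_dilate`, assembled by
`compressible_of_collar`).

Two preliminary homotopies make this work, and `Compressible.of_homotopy` undoes them. First,
missing a slice is not an open condition, because points can come in from infinity in the
coordinates before `k`. Missing a bounded part of a slice is open (`isOpen_clearAt`), and dilation
in those coordinates discards everything outside a bounded region. Dilation acts on both spaces
compatibly with `scan` (`scan_barDilate`). Secondly, the radius may vanish; `barDouble` splits each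
slice into two parallel ones and makes it positive.

Continuity rests on a pointwise criterion for convergence of configurations
(`PointConfig.tendsto_nhds_iff`) and on a check cell by cell
(`ClassifyingSpace.continuousOn_of_cells`). For moving slices the check is organised by
`SliceTendsto`, where slices of weight zero may be placed at any convenient position. -/

noncomputable section

open Filter Topology Set

/-! ### Local description of convergence of configurations -/

/-- Convergence, near the point `y`, of a family of subsets to a discrete set `c₀`. -/
def LocTendsto {ι E : Type*} [TopologicalSpace E] (F : Filter ι) (c : ι → Set E) (c₀ : Set E)
    (y : E) : Prop :=
  (y ∉ c₀ → ∀ᶠ q in F ×ˢ 𝓝 y, q.2 ∉ c q.1) ∧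
  (y ∈ c₀ → (∀ U ∈ 𝓝 y, ∀ᶠ p in F, (c p ∩ U).Nonempty) ∧
    ∃ U ∈ 𝓝 y, ∀ᶠ p in F, (c p ∩ U).Subsingleton)

section LocTendsto

variable {ι E : Type*} [TopologicalSpace E] {F : Filter ι} {c c' : ι → Set E} {c₀ c₀' : Set E}
  {y : E}

theorem LocTendsto.of_notMem (h : ∀ᶠ q in F ×ˢ 𝓝 y, q.2 ∉ c q.1) (h₀ : y ∉ c₀) :
    LocTendsto F c c₀ y :=
  ⟨fun _ => h, fun h' => (h₀ h').elim⟩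

/-- `LocTendsto` only sees the sets near `y`, so replacing them by sets with the same points near
`y` is harmless. -/
theorem LocTendsto.congr (h : LocTendsto F c c₀ y)
    (hc : ∀ᶠ q in F ×ˢ 𝓝 y, (q.2 ∈ c q.1 ↔ q.2 ∈ c' q.1)) (h₀ : y ∈ c₀ ↔ y ∈ c₀') :
    LocTendsto F c' c₀' y := by
  constructor
  · intro hy
    filter_upwards [h.1 (fun hh => hy (h₀.1 hh)), hc] with q h1 h2
    exact fun h3 => h1 (h2.2 h3)
  · intro hy
    obtain ⟨h1, U, hU, h2⟩ := h.2 (h₀.2 hy)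
    obtain ⟨pa, hpa, V, hV, hVc⟩ := (eventually_prod_iff).1 hc
    constructor
    · intro U' hU'
      filter_upwards [h1 (U' ∩ {z | V z}) (inter_mem hU' hV), hpa] with p ⟨z, hz, hz', hz''⟩ hp
      exact ⟨z, (hVc hp hz'').1 hz, hz'⟩
    · refine ⟨U ∩ {z | V z}, inter_mem hU hV, ?_⟩
      filter_upwards [h2, hpa] with p h3 hp
      rintro a ⟨ha, ha1, ha2⟩ b ⟨hb, hb1, hb2⟩
      exact h3 ⟨(hVc hp ha2).2 ha, ha1⟩ ⟨(hVc hp hb2).2 hb, hb1⟩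

theorem LocTendsto.union_left (h : LocTendsto F c c₀ y) (hc : ∀ᶠ q in F ×ˢ 𝓝 y, q.2 ∉ c' q.1)
    (h₀ : y ∉ c₀') : LocTendsto F (fun p => c p ∪ c' p) (c₀ ∪ c₀') y := by
  refine h.congr ?_ ?_
  · filter_upwards [hc] with q hq
    simp [hq]
  · simp [h₀]

/-- Absence of points is uniform on a neighborhood of each point; compactness makes it uniform on
`K`. -/
theorem LocTendsto.eventually_notMem_compact {K : Set E} (hK : IsCompact K)
    (hd : ∀ y ∈ K, y ∉ c₀) (h : ∀ y ∈ K, LocTendsto F c c₀ y) :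
    ∀ᶠ p in F, ∀ y ∈ K, y ∉ c p := by
  refine hK.induction_on (p := fun K => ∀ᶠ p in F, ∀ y ∈ K, y ∉ c p) (by simp) ?_ ?_ ?_
  · intro s t hst ht
    filter_upwards [ht] with p hp y hy using hp y (hst hy)
  · intro s t hs ht
    filter_upwards [hs, ht] with p h1 h2 y hy
    exact hy.elim (h1 y) (h2 y)
  · intro x hx
    obtain ⟨pa, hpa, V, hV, hVc⟩ := (eventually_prod_iff).1 ((h x hx).1 (hd x hx))
    refine ⟨{z | V z}, mem_nhdsWithin_of_mem_nhds hV, ?_⟩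
    filter_upwards [hpa] with p hp y hy using hVc hp hy

end LocTendsto

namespace PointConfig

variable {n : ℕ}

theorem ofOrdered_carrier {p : ℕ} {U : Set (EuclideanSpace ℝ (Fin n))} (x : Ordered n p U) :
    (ofOrdered x).carrier = range x.1 := rfl

theorem exists_ordered (c : PointConfig n) {U : Set (EuclideanSpace ℝ (Fin n))}
    (h : c.carrier ⊆ U) : ∃ x : Ordered n c.carrier.ncard U, ofOrdered x = c := by
  have := c.finite.to_subtype
  have e := Finite.equivFin c.carrier
  rw [Nat.card_coe_set_eq] at e
  refine ⟨⟨fun i => (e.symm i : EuclideanSpace ℝ (Fin n)), ?_, fun i => h (e.symm i).2⟩, ?_⟩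
  · exact Subtype.val_injective.comp e.symm.injective
  · apply PointConfig.ext
    rw [ofOrdered_carrier]
    ext z
    constructor
    · rintro ⟨i, rfl⟩
      exact (e.symm i).2
    · intro hz
      exact ⟨e ⟨z, hz⟩, by simp⟩

/-- Sets of configurations that are open in every stratum give open sets of configurations. -/
theorem isOpen_setOf_restrict {r : ℝ} (hr : 0 < r) (p : ℕ) (Q : PointConfig n → Prop)
    (hQ : IsOpen {x : Ordered n p (Metric.ball 0 r) | Q (ofOrdered x)}) :
    IsOpen {c : PointConfig n | Disjoint c.carrier (Metric.sphere 0 r) ∧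
      (c.restrict (Metric.closedBall 0 r)).carrier.ncard = p ∧
        Q (c.restrict (Metric.closedBall 0 r))} := by
  refine TopologicalSpace.isOpen_generateFrom_of_mem
    ⟨r, hr, p, {d | (d.carrier ⊆ Metric.ball 0 r ∧ d.carrier.ncard = p) ∧ Q d}, ⟨?_, ?_⟩, ?_⟩
  · exact fun c hc => hc.1
  · convert hQ using 1
    ext x
    have h1 : (ofOrdered x).carrier ⊆ Metric.ball 0 r := by
      rintro _ ⟨i, rfl⟩
      exact x.2.2 i
    have h2 : (ofOrdered x).carrier.ncard = p := by
      rw [ofOrdered_carrier, ← image_univ, ncard_image_of_injective _ x.2.1]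
      simp
    simp [h1, h2]
  · ext c
    simp only [basicSet, mem_ofPred_eq]
    constructor
    · rintro ⟨h1, h2, h3⟩
      refine ⟨h1, ⟨?_, h2⟩, h3⟩
      rintro z ⟨hz, hz'⟩
      have := disjoint_left.1 h1 hz
      simp only [mem_sphere_iff_norm, Metric.mem_closedBall, Metric.mem_ball, dist_zero_right,
        sub_zero] at *
      exact lt_of_le_of_ne hz' this
    · rintro ⟨h1, ⟨_, h2⟩, h3⟩
      exact ⟨h1, h2, h3⟩

theorem exists_radius (c : PointConfig n) (R : ℝ) :
    ∃ r, R < r ∧ 0 < r ∧ Disjoint c.carrier (Metric.sphere 0 r) := by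
  obtain ⟨r, hr, hr'⟩ := (Ioi_infinite (max R 0)).exists_notMem_finite (c.finite.image norm)
  refine ⟨r, lt_of_le_of_lt (le_max_left _ _) hr, lt_of_le_of_lt (le_max_right _ _) hr, ?_⟩
  rw [disjoint_left]
  intro z hz hz'
  exact hr' ⟨z, hz, by simpa using hz'⟩

/-- Restrict to a ball around the origin that contains `y` and whose boundary misses `c₀`. Each of
the three local conditions is open on ordered tuples of points in this ball, so it holds on a basic
neighborhood of `c₀`. -/
theorem locTendsto_nhds (c₀ : PointConfig n) (y : EuclideanSpace ℝ (Fin n)) :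
    LocTendsto (𝓝 c₀) carrier c₀.carrier y := by
  obtain ⟨r, hyr, hr, hdisj⟩ := exists_radius c₀ ‖y‖
  have key : ∀ Q : PointConfig n → Prop,
      IsOpen {x : Ordered n (c₀.restrict (Metric.closedBall 0 r)).carrier.ncard
        (Metric.ball 0 r) | Q (ofOrdered x)} →
      Q (c₀.restrict (Metric.closedBall 0 r)) →
      ∀ᶠ c in 𝓝 c₀, Q (c.restrict (Metric.closedBall 0 r)) := by
    intro Q hQ h0
    filter_upwards [(isOpen_setOf_restrict hr _ Q hQ).mem_nhds ⟨hdisj, rfl, h0⟩] with c hc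
    exact hc.2.2
  have hcont : ∀ i, Continuous fun x : Ordered n
      (c₀.restrict (Metric.closedBall 0 r)).carrier.ncard (Metric.ball 0 r) => x.1 i := fun i =>
    (continuous_apply i).comp continuous_subtype_val
  have hball : Metric.ball (0 : EuclideanSpace ℝ (Fin n)) r ∈ 𝓝 y :=
    Metric.isOpen_ball.mem_nhds (by simpa using hyr)
  have hyc : y ∈ Metric.closedBall (0 : EuclideanSpace ℝ (Fin n)) r := by simpa using hyr.le
  have hfin : ∀ s : Set (EuclideanSpace ℝ (Fin n)), s.Finite → y ∉ s →
      ∃ ε > 0, ∀ z ∈ s, z ∉ Metric.closedBall y ε := by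
    intro s hs hy
    obtain ⟨ε, hε, h⟩ := Metric.nhds_basis_closedBall.mem_iff.1 (hs.isClosed.isOpen_compl.mem_nhds hy)
    exact ⟨ε, hε, fun z hz hz' => h hz' hz⟩
  refine ⟨fun hy => ?_, fun hy => ⟨fun U hU => ?_, ?_⟩⟩
  · obtain ⟨ε, hε, h⟩ := hfin _ c₀.finite hy
    have := key (fun d => ∀ z ∈ d.carrier, z ∉ Metric.closedBall y ε) ?_ ?_
    · refine eventually_prod_iff.2 ⟨_, this, fun z => z ∈ Metric.ball 0 r ∩ Metric.closedBall y ε,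
        inter_mem hball (Metric.closedBall_mem_nhds y hε), ?_⟩
      intro c hc z hz hz'
      exact hc z ⟨hz', Metric.ball_subset_closedBall hz.1⟩ hz.2
    · simp only [ofOrdered_carrier, forall_mem_range, ofPred_forall]
      exact isOpen_iInter_of_finite fun i =>
        (Metric.isClosed_closedBall.isOpen_compl).preimage (hcont i)
    · exact fun z hz => h z hz.1
  · obtain ⟨V, hVU, hV, hyV⟩ := mem_nhds_iff.1 hU
    have := key (fun d => ∃ z ∈ d.carrier, z ∈ V) ?_ ⟨y, ⟨hy, hyc⟩, hyV⟩
    · filter_upwards [this] with c ⟨z, hz, hz'⟩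
      exact ⟨z, hz.1, hVU hz'⟩
    · simp only [ofOrdered_carrier, exists_range_iff, ofPred_exists]
      exact isOpen_iUnion fun i => hV.preimage (hcont i)
  -- Uniqueness is phrased with one exceptional point `z₀`, since `y` itself need not belong to the
  -- nearby configurations; the ball around `y` then contains no other point.
  · obtain ⟨ε, hε, h⟩ := hfin _ (c₀.finite.subset (sdiff_subset (t := {y}))) (by simp)
    have := key (fun d => ∃ z₀ ∈ d.carrier, ∀ z ∈ d.carrier, z ≠ z₀ →
      z ∉ Metric.closedBall y ε) ?_ ⟨y, ⟨hy, hyc⟩, fun z hz hzy => h z ⟨hz.1, by simpa using hzy⟩⟩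
    · refine ⟨Metric.ball 0 r ∩ Metric.closedBall y ε,
        inter_mem hball (Metric.closedBall_mem_nhds y hε), ?_⟩
      filter_upwards [this] with c ⟨z₀, hz₀, hc⟩
      have hh : ∀ z ∈ c.carrier ∩ (Metric.ball 0 r ∩ Metric.closedBall y ε), z = z₀ := by
        rintro z ⟨hz, hz1, hz2⟩
        by_contra hne
        exact hc z ⟨hz, Metric.ball_subset_closedBall hz1⟩ hne hz2
      intro a ha b hb
      rw [hh a ha, hh b hb]
    · have : {x : Ordered n (c₀.restrict (Metric.closedBall 0 r)).carrier.ncard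
          (Metric.ball 0 r) | ∃ z₀ ∈ (ofOrdered x).carrier, ∀ z ∈ (ofOrdered x).carrier,
            z ≠ z₀ → z ∉ Metric.closedBall y ε} =
          ⋃ i, ⋂ j, ⋂ (_ : j ≠ i), {x | x.1 j ∈ (Metric.closedBall y ε)ᶜ} := by
        ext x
        simp only [ofOrdered_carrier, exists_range_iff, forall_mem_range, mem_ofPred_eq,
          mem_iUnion, mem_iInter, x.2.1.ne_iff, mem_compl_iff]
      rw [this]
      exact isOpen_iUnion fun i => isOpen_iInter_of_finite fun j => isOpen_iInter_of_finite
        fun _ => (Metric.isClosed_closedBall.isOpen_compl).preimage (hcont j)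

/-- For the converse, each point of `c₀` in the ball eventually has exactly one nearby point of `c
p`, and the rest of the closed ball, being compact, eventually contains none. The nearby points form
an ordered tuple close to the one for `c₀`. -/
theorem tendsto_nhds_iff {ι : Type*} {F : Filter ι} {c : ι → PointConfig n} {c₀ : PointConfig n} :
    Tendsto c F (𝓝 c₀) ↔ ∀ y, LocTendsto F (fun p => (c p).carrier) c₀.carrier y := by
  constructor
  · intro h y
    obtain ⟨h1, h2⟩ := locTendsto_nhds c₀ y
    refine ⟨fun hy => ?_, fun hy => ⟨fun U hU => h.eventually ((h2 hy).1 U hU), ?_⟩⟩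
    · exact (h.prodMap tendsto_id).eventually (h1 hy)
    · obtain ⟨U, hU, h3⟩ := (h2 hy).2
      exact ⟨U, hU, h.eventually h3⟩
  · intro h
    refine TopologicalSpace.tendsto_nhds_generateFrom_iff.2 ?_
    rintro _ ⟨r, hr, p, V, ⟨hV, hVo⟩, rfl⟩ ⟨hd, hc⟩
    obtain ⟨hsub, hcard⟩ := hV _ hc
    subst hcard
    obtain ⟨x, hx⟩ := exists_ordered _ hsub
    have hxV : x ∈ {x | ofOrdered x ∈ V} := by
      rw [mem_ofPred_eq, hx]
      exact hc
    obtain ⟨ε, hε, hball⟩ := Metric.isOpen_iff.1 hVo x hxV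
    have hxc : ∀ i, x.1 i ∈ c₀.carrier := fun i => by
      have : x.1 i ∈ (ofOrdered x).carrier := ⟨i, rfl⟩
      rw [hx] at this
      exact this.1
    have hcx : ∀ y ∈ c₀.carrier, y ∈ Metric.closedBall 0 r → ∃ i, x.1 i = y := by
      intro y h1 h2
      have : y ∈ (c₀.restrict (Metric.closedBall 0 r)).carrier := ⟨h1, h2⟩
      rw [← hx] at this
      exact this
    choose U hU hUs using fun i => ((h (x.1 i)).2 (hxc i)).2
    -- The `δ`-balls stay in the neighborhoods of uniqueness and in the open ball, are pairwise
    -- disjoint so that the chosen points are distinct, and are small enough for the tuple to remain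
    -- in the open set defining `V`.
    have hδ : ∃ δ > 0, δ < ε ∧ (∀ i, Metric.ball (x.1 i) δ ⊆ U i ∩ Metric.ball 0 r) ∧
        ∀ i j, i ≠ j → δ + δ ≤ dist (x.1 i) (x.1 j) := by
      have h1 : ∀ᶠ δ : ℝ in 𝓝[>] 0, δ < ε :=
        mem_nhdsWithin_of_mem_nhds (Iio_mem_nhds hε)
      have h2 : ∀ᶠ δ : ℝ in 𝓝[>] 0, ∀ i, Metric.ball (x.1 i) δ ⊆ U i ∩ Metric.ball 0 r := by
        refine eventually_all.2 fun i => ?_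
        obtain ⟨η, hη, hs⟩ := Metric.nhds_basis_ball.mem_iff.1
          (inter_mem (hU i) (Metric.isOpen_ball.mem_nhds (x.2.2 i)))
        filter_upwards [mem_nhdsWithin_of_mem_nhds (Iio_mem_nhds hη)] with δ hδ
        exact (Metric.ball_subset_ball (le_of_lt hδ)).trans hs
      have h3 : ∀ᶠ δ : ℝ in 𝓝[>] 0, ∀ i j, i ≠ j → δ + δ ≤ dist (x.1 i) (x.1 j) := by
        refine eventually_all.2 fun i => eventually_all.2 fun j => ?_
        by_cases hij : i = j
        · simp [hij]
        · have : 0 < dist (x.1 i) (x.1 j) / 2 := half_pos (dist_pos.2 (x.2.1.ne hij))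
          filter_upwards [mem_nhdsWithin_of_mem_nhds (Iio_mem_nhds this)] with δ hδ _
          have : δ < dist (x.1 i) (x.1 j) / 2 := hδ
          linarith
      obtain ⟨δ, ⟨⟨h1, h2⟩, h3⟩, h4⟩ := ((h1.and h2).and h3).and
        (self_mem_nhdsWithin (a := (0 : ℝ)) (s := Ioi 0)) |>.exists
      exact ⟨δ, h4, h1, h2, h3⟩
    obtain ⟨δ, hδ0, hδε, hδU, hδd⟩ := hδ
    have e1 : ∀ᶠ p in F, ∀ i, ((c p).carrier ∩ Metric.ball (x.1 i) δ).Nonempty :=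
      eventually_all.2 fun i => ((h (x.1 i)).2 (hxc i)).1 _ (Metric.ball_mem_nhds _ hδ0)
    have e2 : ∀ᶠ p in F, ∀ i, ((c p).carrier ∩ U i).Subsingleton := eventually_all.2 hUs
    have e3 : ∀ᶠ p in F, ∀ y ∈ Metric.closedBall 0 r \ ⋃ i, Metric.ball (x.1 i) δ,
        y ∉ (c p).carrier := by
      refine LocTendsto.eventually_notMem_compact ((isCompact_closedBall _ _).diff
        (isOpen_iUnion fun i => Metric.isOpen_ball)) ?_ fun y _ => h y
      rintro y ⟨hy1, hy2⟩ hyc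
      obtain ⟨i, rfl⟩ := hcx y hyc hy1
      exact hy2 (mem_iUnion.2 ⟨i, Metric.mem_ball_self hδ0⟩)
    filter_upwards [e1, e2, e3] with p h1 h2 h3
    choose z hz using h1
    have hzb : ∀ i, z i ∈ Metric.ball 0 r := fun i => (hδU i (hz i).2).2
    have hzi : Function.Injective z := by
      intro i j hij
      by_contra hne
      have a1 := Metric.mem_ball.1 (hz i).2
      have a2 := Metric.mem_ball.1 (hz j).2
      rw [← hij] at a2
      have := hδd i j hne
      have := dist_triangle_left (x.1 i) (x.1 j) (z i)
      linarith
    have hmem : ∀ y ∈ (c p).carrier, y ∈ Metric.closedBall 0 r → ∃ i, z i = y := by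
      intro y hy hyr
      by_contra! hne
      refine h3 y ⟨hyr, fun hyU => ?_⟩ hy
      obtain ⟨i, hi⟩ := mem_iUnion.1 hyU
      exact hne i (h2 i ⟨(hz i).1, (hδU i (hz i).2).1⟩ ⟨hy, (hδU i hi).1⟩)
    refine ⟨?_, ?_⟩
    · rw [disjoint_left]
      intro y hy hyr
      obtain ⟨i, rfl⟩ := hmem y hy (Metric.sphere_subset_closedBall hyr)
      have := hzb i
      simp only [Metric.mem_ball, mem_sphere_iff_norm, dist_zero_right, sub_zero] at this hyr
      linarith
    · have : (⟨z, hzi, hzb⟩ : Ordered n _ (Metric.ball 0 r)) ∈ {x | ofOrdered x ∈ V} := by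
        apply hball
        rw [Metric.mem_ball, Subtype.dist_eq, dist_pi_lt_iff hε]
        exact fun i => (Metric.mem_ball.1 (hz i).2).trans hδε
      rw [mem_ofPred_eq] at this
      convert this using 1
      apply PointConfig.ext
      rw [ofOrdered_carrier]
      ext y
      constructor
      · exact fun hy => hmem y hy.1 hy.2
      · rintro ⟨i, rfl⟩
        exact ⟨(hz i).1, Metric.ball_subset_closedBall (hzb i)⟩

end PointConfig

/-! ### Pulling back configurations along coordinatewise maps -/

/-- The map of `ℝⁿ` given by a map of `ℝ` in each coordinate. -/
def coordMap {n : ℕ} (f : Fin n → ℝ → ℝ) (x : EuclideanSpace ℝ (Fin n)) :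
    EuclideanSpace ℝ (Fin n) :=
  WithLp.toLp 2 fun i => f i (x i)

section coordMap

variable {n : ℕ}

@[simp]
theorem coordMap_apply (f : Fin n → ℝ → ℝ) (x : EuclideanSpace ℝ (Fin n)) (i : Fin n) :
    coordMap f x i = f i (x i) := rfl

theorem tendsto_coordMap {ι : Type*} {F : Filter ι} {f : ι → Fin n → ℝ → ℝ} {f₀ : Fin n → ℝ → ℝ}
    {y : EuclideanSpace ℝ (Fin n)}
    (hf : ∀ i, Tendsto (fun q : ι × ℝ => f q.1 i q.2) (F ×ˢ 𝓝 (y i)) (𝓝 (f₀ i (y i)))) :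
    Tendsto (fun q : ι × EuclideanSpace ℝ (Fin n) => coordMap (f q.1) q.2) (F ×ˢ 𝓝 y)
      (𝓝 (coordMap f₀ y)) := by
  have h : Tendsto (fun q : ι × EuclideanSpace ℝ (Fin n) => fun i => f q.1 i (q.2 i)) (F ×ˢ 𝓝 y)
      (𝓝 (fun i => f₀ i (y i))) := by
    refine tendsto_pi_nhds.2 fun i => ?_
    have hc : Continuous fun z : EuclideanSpace ℝ (Fin n) => z i := by fun_prop
    have h : Tendsto (fun q : ι × EuclideanSpace ℝ (Fin n) => (q.1, q.2 i)) (F ×ˢ 𝓝 y)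
        (F ×ˢ 𝓝 (y i)) := tendsto_id.prodMap hc.continuousAt
    exact (hf i).comp h
  exact ((PiLp.continuous_toLp 2 fun _ : Fin n => ℝ).tendsto _).comp h

theorem exists_box {y : EuclideanSpace ℝ (Fin n)} {U : Set (EuclideanSpace ℝ (Fin n))}
    (hU : U ∈ 𝓝 y) {η : ℝ} (hη : 0 < η) :
    ∃ δ, 0 < δ ∧ δ ≤ η ∧ ∀ z : EuclideanSpace ℝ (Fin n),
      (∀ i, z i ∈ Icc (y i - δ) (y i + δ)) → z ∈ U := by
  have : (WithLp.toLp 2 : (Fin n → ℝ) → EuclideanSpace ℝ (Fin n)) ⁻¹' U ∈ 𝓝 (y.ofLp) :=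
    (PiLp.continuous_toLp 2 fun _ : Fin n => ℝ).continuousAt hU
  obtain ⟨ε, hε, h⟩ := Metric.nhds_basis_closedBall.mem_iff.1 this
  refine ⟨min ε η, lt_min hε hη, min_le_right _ _, fun z hz => ?_⟩
  have hz' : z.ofLp ∈ Metric.closedBall y.ofLp ε := by
    rw [closedBall_pi _ hε.le, mem_univ_pi]
    intro i
    rw [Real.closedBall_eq_Icc]
    have := hz i
    have := min_le_left ε η
    exact ⟨by linarith [(hz i).1], by linarith [(hz i).2]⟩
  exact h hz'

theorem box_mem_nhds (y : EuclideanSpace ℝ (Fin n)) {η : Fin n → ℝ} (hη : ∀ i, 0 < η i) :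
    {z : EuclideanSpace ℝ (Fin n) | ∀ i, z i ∈ Icc (y i - η i) (y i + η i)} ∈ 𝓝 y := by
  have : ∀ i, ∀ᶠ z : EuclideanSpace ℝ (Fin n) in 𝓝 y, z i ∈ Icc (y i - η i) (y i + η i) := by
    intro i
    have hc : Continuous fun z : EuclideanSpace ℝ (Fin n) => z i := by fun_prop
    exact hc.continuousAt.eventually_mem
      (Icc_mem_nhds (by linarith [hη i]) (by linarith [hη i]))
  exact eventually_all.2 this

/-- The intermediate value theorem with parameters. -/
theorem eventually_exists_eq {ι : Type*} {F : Filter ι} {g : ι → ℝ → ℝ} {g₀ : ℝ → ℝ} {s δ : ℝ}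
    (hδ : 0 < δ) (h1 : ∀ t ∈ Icc (s - δ) (s + δ), Tendsto (fun p => g p t) F (𝓝 (g₀ t)))
    (h2 : ContinuousOn g₀ (Icc (s - δ) (s + δ))) (h3 : InjOn g₀ (Icc (s - δ) (s + δ)))
    (h4 : ∀ᶠ p in F, ContinuousOn (g p) (Icc (s - δ) (s + δ))) :
    ∃ U ∈ 𝓝 (g₀ s), ∀ᶠ p in F, ∀ t ∈ U, ∃ s' ∈ Icc (s - δ) (s + δ), g p s' = t := by
  have hle : s - δ ≤ s + δ := by linarith
  have ms : s ∈ Icc (s - δ) (s + δ) := ⟨by linarith, by linarith⟩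
  have ml : s - δ ∈ Icc (s - δ) (s + δ) := ⟨le_rfl, hle⟩
  have mr : s + δ ∈ Icc (s - δ) (s + δ) := ⟨hle, le_rfl⟩
  rcases h2.strictMonoOn_of_injOn_Icc' hle h3 with hm | hm
  · have a1 : g₀ (s - δ) < g₀ s := hm ml ms (by linarith)
    have a2 : g₀ s < g₀ (s + δ) := hm ms mr (by linarith)
    refine ⟨Icc ((g₀ (s - δ) + g₀ s) / 2) ((g₀ s + g₀ (s + δ)) / 2),
      Icc_mem_nhds (by linarith) (by linarith), ?_⟩
    filter_upwards [h4, (h1 _ ml).eventually_lt_const (by linarith : g₀ (s - δ) < (g₀ (s - δ) + g₀ s) / 2),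
      (h1 _ mr).eventually_const_lt (by linarith : (g₀ s + g₀ (s + δ)) / 2 < g₀ (s + δ))] with p b1 b2 b3 t ht
    exact intermediate_value_Icc hle b1 ⟨b2.le.trans ht.1, ht.2.trans b3.le⟩
  · have a1 : g₀ s < g₀ (s - δ) := hm ml ms (by linarith)
    have a2 : g₀ (s + δ) < g₀ s := hm ms mr (by linarith)
    refine ⟨Icc ((g₀ (s + δ) + g₀ s) / 2) ((g₀ s + g₀ (s - δ)) / 2),
      Icc_mem_nhds (by linarith) (by linarith), ?_⟩
    filter_upwards [h4, (h1 _ mr).eventually_lt_const (by linarith : g₀ (s + δ) < (g₀ (s + δ) + g₀ s) / 2),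
      (h1 _ ml).eventually_const_lt (by linarith : (g₀ s + g₀ (s - δ)) / 2 < g₀ (s - δ))] with p b1 b2 b3 t ht
    exact intermediate_value_Icc' hle b1 ⟨b2.le.trans ht.1, ht.2.trans b3.le⟩

/-- Solutions near `y` exist by the intermediate value theorem in each coordinate, applied uniformly
in the parameter, and are unique by injectivity. Continuity and injectivity are only asked near `y`,
and only if `y` maps into `c₀`, because `unstretch` is injective only on an interval and a stretch
of radius zero is constant. -/
theorem LocTendsto.preimage_coordMap {ι : Type*} {F : Filter ι} {f : ι → Fin n → ℝ → ℝ}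
    {f₀ : Fin n → ℝ → ℝ} {c : ι → Set (EuclideanSpace ℝ (Fin n))}
    {c₀ : Set (EuclideanSpace ℝ (Fin n))} {y : EuclideanSpace ℝ (Fin n)}
    (hc : LocTendsto F c c₀ (coordMap f₀ y))
    (hf : ∀ i, Tendsto (fun q : ι × ℝ => f q.1 i q.2) (F ×ˢ 𝓝 (y i)) (𝓝 (f₀ i (y i))))
    (hloc : coordMap f₀ y ∈ c₀ → ∀ i, ∃ η > 0,
      (∀ t ∈ Icc (y i - η) (y i + η), Tendsto (fun p => f p i t) F (𝓝 (f₀ i t))) ∧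
      ContinuousOn (f₀ i) (Icc (y i - η) (y i + η)) ∧ InjOn (f₀ i) (Icc (y i - η) (y i + η)) ∧
      ∀ᶠ p in F, ContinuousOn (f p i) (Icc (y i - η) (y i + η)) ∧
        InjOn (f p i) (Icc (y i - η) (y i + η))) :
    LocTendsto F (fun p => coordMap (f p) ⁻¹' c p) (coordMap f₀ ⁻¹' c₀) y := by
  have ht := tendsto_coordMap hf
  constructor
  · intro hy
    have h1 := hc.1 hy
    exact (tendsto_fst.prodMk ht).eventually h1
  · intro hy
    obtain ⟨h1, U, hU, hUs⟩ := hc.2 hy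
    choose η hη a1 a2 a3 a4 using hloc hy
    have a4' := eventually_all.2 a4
    constructor
    · intro V hV
      obtain ⟨η', hη', hη'le⟩ : ∃ η' > 0, ∀ i, η' ≤ η i := by
        have : ∀ᶠ e : ℝ in 𝓝[>] 0, ∀ i, e ≤ η i := eventually_all.2 fun i =>
          mem_nhdsWithin_of_mem_nhds (Iic_mem_nhds (hη i))
        obtain ⟨e, he, he'⟩ := (this.and (self_mem_nhdsWithin (a := (0 : ℝ)) (s := Ioi 0))).exists
        exact ⟨e, he', he⟩
      obtain ⟨δ, hδ, hδη, hbox⟩ := exists_box hV hη'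
      have hsub : ∀ i, Icc (y i - δ) (y i + δ) ⊆ Icc (y i - η i) (y i + η i) := fun i =>
        Icc_subset_Icc (by linarith [hη'le i]) (by linarith [hη'le i])
      have := fun i => eventually_exists_eq hδ (fun t ht => a1 i t (hsub i ht))
        ((a2 i).mono (hsub i)) ((a3 i).mono (hsub i)) ((a4 i).mono fun p hp => hp.1.mono (hsub i))
      choose W hW hWe using this
      have hWn : {z : EuclideanSpace ℝ (Fin n) | ∀ i, z i ∈ W i} ∈ 𝓝 (coordMap f₀ y) := by
        refine eventually_all.2 fun i => ?_
        have hcc : Continuous fun z : EuclideanSpace ℝ (Fin n) => z i := by fun_prop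
        exact hcc.continuousAt.eventually_mem (hW i)
      filter_upwards [h1 _ hWn, eventually_all.2 hWe] with p ⟨z, hz, hzW⟩ hp
      choose s hs hs' using fun i => hp i (z i) (hzW i)
      refine ⟨WithLp.toLp 2 s, ?_, hbox _ hs⟩
      have : coordMap (f p) (WithLp.toLp 2 s) = z := by
        ext i
        exact hs' i
      rwa [mem_preimage, this]
    · obtain ⟨pa, hpa, V, hV, hVc⟩ := (eventually_prod_iff).1 (ht.eventually_mem hU)
      refine ⟨{z | V z} ∩ {z | ∀ i, z i ∈ Icc (y i - η i) (y i + η i)},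
        inter_mem hV (box_mem_nhds y hη), ?_⟩
      filter_upwards [hpa, hUs, a4'] with p h2 h3 h4
      rintro a ⟨ha, ha1, ha2⟩ b ⟨hb, hb1, hb2⟩
      have := h3 ⟨ha, hVc h2 ha1⟩ ⟨hb, hVc h2 hb1⟩
      ext i
      refine (h4 i).2 (ha2 i) (hb2 i) ?_
      exact congrArg (fun z : EuclideanSpace ℝ (Fin n) => z i) this

/-- The same for globally injective maps. -/
theorem LocTendsto.preimage_coordMap' {ι : Type*} {F : Filter ι} {f : ι → Fin n → ℝ → ℝ}
    {f₀ : Fin n → ℝ → ℝ} {c : ι → Set (EuclideanSpace ℝ (Fin n))}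
    {c₀ : Set (EuclideanSpace ℝ (Fin n))} {y : EuclideanSpace ℝ (Fin n)}
    (hc : LocTendsto F c c₀ (coordMap f₀ y))
    (hf : ∀ i t, Tendsto (fun q : ι × ℝ => f q.1 i q.2) (F ×ˢ 𝓝 t) (𝓝 (f₀ i t)))
    (hloc : coordMap f₀ y ∈ c₀ → ∀ i, Continuous (f₀ i) ∧ Function.Injective (f₀ i) ∧
      ∀ᶠ p in F, Continuous (f p i) ∧ Function.Injective (f p i)) :
    LocTendsto F (fun p => coordMap (f p) ⁻¹' c p) (coordMap f₀ ⁻¹' c₀) y := by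
  refine hc.preimage_coordMap (fun i => hf i _) fun hy i => ⟨1, one_pos, fun t _ => ?_,
    (hloc hy i).1.continuousOn, (hloc hy i).2.1.injOn, ?_⟩
  · exact (hf i t).comp (tendsto_id.prodMk tendsto_const_nhds)
  · filter_upwards [(hloc hy i).2.2] with p hp
    exact ⟨hp.1.continuousOn, hp.2.injOn⟩

theorem coordMap_injective {f : Fin n → ℝ → ℝ} (hf : ∀ i, Function.Injective (f i)) :
    Function.Injective (coordMap f) := by
  intro a b hab
  ext i
  exact hf i (congrArg (fun z : EuclideanSpace ℝ (Fin n) => z i) hab)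

end coordMap

/-- The map of `ℝⁿ` given by a map of `ℝ` in the coordinate `k`. -/
def axisMap {n : ℕ} (k : Fin n) (g : ℝ → ℝ) : EuclideanSpace ℝ (Fin n) → EuclideanSpace ℝ (Fin n) :=
  coordMap fun i => if i = k then g else id

section axisMap

variable {n : ℕ} {k : Fin n}

@[simp]
theorem axisMap_self (g : ℝ → ℝ) (x : EuclideanSpace ℝ (Fin n)) : axisMap k g x k = g (x k) := by
  simp [axisMap]

theorem axisMap_of_ne (g : ℝ → ℝ) (x : EuclideanSpace ℝ (Fin n)) {i : Fin n} (h : i ≠ k) :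
    axisMap k g x i = x i := by
  simp [axisMap, h]

theorem axisMap_axisMap (g h : ℝ → ℝ) (x : EuclideanSpace ℝ (Fin n)) :
    axisMap k g (axisMap k h x) = axisMap k (fun t => g (h t)) x := by
  ext i
  by_cases hi : i = k
  · subst hi
    simp
  · simp [axisMap_of_ne _ _ hi]

theorem axisMap_congr {g h : ℝ → ℝ} {x : EuclideanSpace ℝ (Fin n)} (e : g (x k) = h (x k)) :
    axisMap k g x = axisMap k h x := by
  ext i
  by_cases hi : i = k
  · subst hi
    simpa using e
  · simp [axisMap_of_ne _ _ hi]

theorem axisMap_eq_self {g : ℝ → ℝ} {x : EuclideanSpace ℝ (Fin n)} (e : g (x k) = x k) :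
    axisMap k g x = x := by
  ext i
  by_cases hi : i = k
  · subst hi
    simpa using e
  · simp [axisMap_of_ne _ _ hi]

theorem axisMap_injective {g : ℝ → ℝ} (hg : Function.Injective g) :
    Function.Injective (axisMap k g) := by
  refine coordMap_injective fun i => ?_
  split_ifs
  · exact hg
  · exact Function.injective_id

theorem add_single_eq (x : EuclideanSpace ℝ (Fin n)) (a : ℝ) :
    x + EuclideanSpace.single k a = axisMap k (· + a) x := by
  ext i
  by_cases hi : i = k
  · subst hi
    simp
  · simp [axisMap_of_ne _ _ hi, hi]

theorem image_add_single (s : Set (EuclideanSpace ℝ (Fin n))) (a : ℝ) :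
    (fun x => x + EuclideanSpace.single k a) '' s = axisMap k (· - a) ⁻¹' s := by
  ext x
  simp only [mem_image, mem_preimage, add_single_eq]
  constructor
  · rintro ⟨y, hy, rfl⟩
    rw [axisMap_axisMap, axisMap_eq_self (by simp)]
    exact hy
  · intro hx
    refine ⟨_, hx, ?_⟩
    rw [axisMap_axisMap, axisMap_eq_self (by simp)]

theorem squeeze_eq (φ : ℝ ≃ₜ Set.Ioo (-1 : ℝ) 1) (lo hi : ℝ) :
    squeeze k φ lo hi = axisMap k fun t => (lo + hi) / 2 + (hi - lo) / 2 * (φ t : ℝ) := by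
  funext x
  ext i
  by_cases h : i = k
  · subst h
    simp [squeeze]
  · simp [squeeze, axisMap_of_ne _ _ h, h]

theorem LocTendsto.preimage_axisMap {ι : Type*} {F : Filter ι} {g : ι → ℝ → ℝ} {g₀ : ℝ → ℝ}
    {c : ι → Set (EuclideanSpace ℝ (Fin n))} {c₀ : Set (EuclideanSpace ℝ (Fin n))}
    {y : EuclideanSpace ℝ (Fin n)} (hc : LocTendsto F c c₀ (axisMap k g₀ y))
    (hg : ∀ t, Tendsto (fun q : ι × ℝ => g q.1 q.2) (F ×ˢ 𝓝 t) (𝓝 (g₀ t)))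
    (hloc : axisMap k g₀ y ∈ c₀ → Continuous g₀ ∧ Function.Injective g₀ ∧
      ∀ᶠ p in F, Continuous (g p) ∧ Function.Injective (g p)) :
    LocTendsto F (fun p => axisMap k (g p) ⁻¹' c p) (axisMap k g₀ ⁻¹' c₀) y := by
  refine LocTendsto.preimage_coordMap' (f := fun p i => if i = k then g p else id)
    (f₀ := fun i => if i = k then g₀ else id) hc ?_ ?_
  · intro i t
    by_cases hi : i = k
    · simpa [hi] using hg t
    · simpa [hi] using tendsto_snd
  · intro hy i
    by_cases hi : i = k
    · simpa [hi] using hloc hy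
    · simp [hi, continuous_id, Function.injective_id]

theorem LocTendsto.preimage_translate {ι : Type*} {F : Filter ι} {a : ι → ℝ} {a₀ : ℝ}
    {c : ι → Set (EuclideanSpace ℝ (Fin n))} {c₀ : Set (EuclideanSpace ℝ (Fin n))}
    {y : EuclideanSpace ℝ (Fin n)} (hc : LocTendsto F c c₀ (axisMap k (· + a₀) y))
    (ha : Tendsto a F (𝓝 a₀)) :
    LocTendsto F (fun p => axisMap k (· + a p) ⁻¹' c p) (axisMap k (· + a₀) ⁻¹' c₀) y := by
  refine hc.preimage_axisMap (g := fun p t => t + a p) ?_ fun _ => ⟨by fun_prop, add_left_injective _, ?_⟩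
  · exact fun t => tendsto_snd.add (ha.comp tendsto_fst)
  · exact Eventually.of_forall fun p => ⟨by fun_prop, add_left_injective _⟩

end axisMap

theorem ConfigSpace.tendsto_iff {n j : ℕ} {ι : Type*} {F : Filter ι} {c : ι → ConfigSpace n j}
    {c₀ : ConfigSpace n j} :
    Tendsto c F (𝓝 c₀) ↔ ∀ y, LocTendsto F (fun p => (c p).1.carrier) c₀.1.carrier y := by
  rw [tendsto_subtype_rng, PointConfig.tendsto_nhds_iff]

theorem ConfigSpace.ext' {n j : ℕ} {c d : ConfigSpace n j} (h : c.1.carrier = d.1.carrier) :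
    c = d := Subtype.ext (PointConfig.ext h)

/-! ### Convergence and continuity of multiplication in the monoid of slabs -/

namespace SlabMonoid

variable {n : ℕ} {k : Fin n}

theorem tendsto_iff {ι : Type*} {F : Filter ι} {m : ι → SlabMonoid n k} {m₀ : SlabMonoid n k} :
    Tendsto m F (𝓝 m₀) ↔
      (∀ y, LocTendsto F (fun p => (m p).config.carrier) m₀.config.carrier y) ∧
        Tendsto (fun p => ((m p).width : ℝ)) F (𝓝 (m₀.width : ℝ)) := by
  rw [NNReal.tendsto_coe, ← PointConfig.tendsto_nhds_iff]
  have h : Tendsto m F (𝓝 m₀) ↔ Tendsto (fun p => (m p).1) F (𝓝 m₀.1) := tendsto_subtype_rng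
  rw [nhds_prod_eq, tendsto_prod_iff'] at h
  exact h

theorem continuous_width : Continuous fun m : SlabMonoid n k => (m.width : ℝ) :=
  continuous_iff_continuousAt.2 fun m => (tendsto_iff.1 (tendsto_id (α := SlabMonoid n k) (x := 𝓝 m))).2

/-- The two slabs are open and disjoint, so a point `y` belongs to at most one of the two pieces of
the limit. The other piece eventually has no points near `y`, and `LocTendsto.union_left` applies.
-/
instance : ContinuousMul (SlabMonoid n k) where
  continuous_mul := by
    refine continuous_iff_continuousAt.2 fun ⟨m, m'⟩ => tendsto_iff.2 ⟨fun y => ?_, ?_⟩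
    · have h1 := (tendsto_iff.1 (continuous_fst.tendsto (m, m'))).1 y
      have h2 := (tendsto_iff.1 (continuous_snd.tendsto (m, m'))).1
        (axisMap k (· + -(m.width : ℝ)) y)
      have h3 := h2.preimage_translate
        (((continuous_width.comp continuous_fst).neg).tendsto (m, m'))
      simp only [config_mul, image_add_single, sub_eq_add_neg]
      by_cases hy : y ∈ axisMap k (· + -(m.width : ℝ)) ⁻¹' m'.config.carrier
      · have hy' : y ∉ m.config.carrier := by
          intro hm
          have b1 := (m.2 y hm).1.2
          have b2 := (m'.2 _ hy).1.1
          simp only [axisMap_self] at b2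
          change y k < m.width at b1
          linarith
        simp only [union_comm (config _).carrier]
        exact h3.union_left (h1.1 hy') hy'
      · exact h1.union_left (h3.1 hy) hy
    · exact ((continuous_width.comp continuous_fst).add
        (continuous_width.comp continuous_snd)).tendsto (m, m')

end SlabMonoid

/-! ### Cutting slabs out of configurations -/

/-- The part of a configuration between the slices at `a` and `b`, translated to start at `0`. -/
def seg {n : ℕ} {k : Fin n} (S : ConfigSpace n (k + 1)) (a b : ℝ) : SlabMonoid n k :=
  ⟨(⟨{y | axisMap k (· + a) y ∈ S.1.carrier ∧ 0 < y k ∧ y k < b - a},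
    (S.1.finite.preimage (axisMap_injective (add_left_injective a)).injOn).subset
      fun _ hy => hy.1⟩, (b - a).toNNReal), by
    rintro y ⟨h1, h2, h3⟩
    refine ⟨⟨h2, h3.trans_le (Real.le_coe_toNNReal _)⟩, fun i hi => ?_⟩
    have := S.2 _ h1 i hi
    rwa [axisMap_of_ne _ _ hi.ne'] at this⟩

section seg

variable {n : ℕ} {k : Fin n}

theorem mem_seg {S : ConfigSpace n (k + 1)} {a b : ℝ} {y : EuclideanSpace ℝ (Fin n)} :
    y ∈ (seg S a b).config.carrier ↔
      axisMap k (· + a) y ∈ S.1.carrier ∧ 0 < y k ∧ y k < b - a := Iff.rfl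

theorem seg_width {S : ConfigSpace n (k + 1)} {a b : ℝ} (h : a ≤ b) :
    ((seg S a b).width : ℝ) = b - a := Real.coe_toNNReal _ (by linarith)

/-- Both segments are open, so the product loses exactly the points at height `b`; there are none.
-/
theorem seg_mul {S : ConfigSpace n (k + 1)} {a b c : ℝ} (hab : a ≤ b) (hbc : b ≤ c)
    (hb : ∀ x ∈ S.1.carrier, x k ≠ b) : seg S a b * seg S b c = seg S a c := by
  refine SlabMonoid.ext' ?_ ?_
  · rw [SlabMonoid.config_mul, image_add_single, seg_width hab]
    ext y
    simp only [mem_union, mem_seg, mem_preimage, axisMap_axisMap, axisMap_self]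
    have e : axisMap k (fun t => t - (b - a) + b) y = axisMap k (· + a) y :=
      axisMap_congr (by ring)
    rw [e]
    constructor
    · rintro (⟨h1, h2, h3⟩ | ⟨h1, h2, h3⟩)
      · exact ⟨h1, h2, by linarith⟩
      · exact ⟨h1, by linarith, by linarith⟩
    · rintro ⟨h1, h2, h3⟩
      have := hb _ h1
      rw [axisMap_self] at this
      rcases lt_or_gt_of_ne this with h | h
      · exact Or.inl ⟨h1, h2, by linarith⟩
      · exact Or.inr ⟨h1, by linarith, by linarith⟩
  · rw [← NNReal.coe_inj, SlabMonoid.width_mul, NNReal.coe_add, seg_width hab, seg_width hbc,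
      seg_width (hab.trans hbc)]
    ring

/-- No point can cross a bounding slice in the limit, since `S₀` misses both. Convergence is only
assumed on the closed slab: a squeezed configuration need not converge outside the open slab into
which it is squeezed. -/
theorem tendsto_seg {ι : Type*} {F : Filter ι} {S : ι → ConfigSpace n (k + 1)}
    {S₀ : ConfigSpace n (k + 1)} {a b : ι → ℝ} {a₀ b₀ : ℝ}
    (hS : ∀ y : EuclideanSpace ℝ (Fin n), a₀ ≤ y k → y k ≤ b₀ →
      LocTendsto F (fun p => (S p).1.carrier) S₀.1.carrier y)
    (ha : Tendsto a F (𝓝 a₀)) (hb : Tendsto b F (𝓝 b₀))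
    (ha₀ : ∀ x ∈ S₀.1.carrier, x k ≠ a₀) (hb₀ : ∀ x ∈ S₀.1.carrier, x k ≠ b₀) :
    Tendsto (fun p => seg (S p) (a p) (b p)) F (𝓝 (seg S₀ a₀ b₀)) := by
  refine SlabMonoid.tendsto_iff.2 ⟨fun y => ?_, ?_⟩
  · have hk : Tendsto (fun q : ι × EuclideanSpace ℝ (Fin n) => q.2 k) (F ×ˢ 𝓝 y) (𝓝 (y k)) := by
      have : Continuous fun z : EuclideanSpace ℝ (Fin n) => z k := by fun_prop
      exact (this.tendsto y).comp tendsto_snd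
    have hba : Tendsto (fun q : ι × EuclideanSpace ℝ (Fin n) => b q.1 - a q.1) (F ×ˢ 𝓝 y)
      (𝓝 (b₀ - a₀)) := (hb.sub ha).comp tendsto_fst
    rcases lt_or_ge (y k) 0 with h0 | h0
    · refine LocTendsto.of_notMem ?_ fun h => ?_
      · filter_upwards [hk.eventually_lt_const h0] with q hq h
        exact absurd h.2.1 hq.not_gt
      · exact absurd h.2.1 h0.not_gt
    rcases lt_or_ge (b₀ - a₀) (y k) with h1 | h1
    · refine LocTendsto.of_notMem ?_ fun h => ?_
      · filter_upwards [hba.eventually_lt hk h1] with q hq h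
        exact absurd h.2.2 hq.not_gt
      · exact absurd h.2.2 h1.not_gt
    have hloc := (hS (axisMap k (· + a₀) y) (by simpa using h0)
      (by simpa using (by linarith : y k + a₀ ≤ b₀))).preimage_translate ha
    rcases h0.eq_or_lt with h0 | h0
    · refine LocTendsto.of_notMem ?_ fun h => h.2.1.ne h0
      filter_upwards [hloc.1 fun h => ha₀ _ h (by simp [← h0])] with q hq h
      exact hq h.1
    rcases h1.eq_or_lt with h1 | h1
    · refine LocTendsto.of_notMem ?_ fun h => h.2.2.ne h1
      filter_upwards [hloc.1 fun h => hb₀ _ h (by simp [h1])] with q hq h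
      exact hq h.1
    refine hloc.congr ?_ ?_
    · filter_upwards [hk.eventually_const_lt h0, hk.eventually_lt hba h1] with q h2 h3
      exact ⟨fun h => ⟨h, h2, h3⟩, fun h => h.1⟩
    · exact ⟨fun h => ⟨h, h0, h1⟩, fun h => h.1⟩
  · rw [NNReal.tendsto_coe]
    exact (continuous_real_toNNReal.tendsto _).comp (hb.sub ha)

end seg

/-! ### Tuples of slabs and slicings of configurations -/

section Slicing

variable {n : ℕ} {k : Fin n}

/-- A configuration in a slab as a configuration in `ℝᵏ⁺¹ × (0,1)ⁿ⁻ᵏ⁻¹`. -/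
def SlabMonoid.toSpace (m : SlabMonoid n k) : ConfigSpace n (k + 1) :=
  ⟨m.config, fun x hx i hi => (m.2 x hx).2 i (Fin.lt_def.2 hi)⟩

/-- The configuration of the product of a tuple. -/
def totalConfig {p : ℕ} (m : Fin p → SlabMonoid n k) : ConfigSpace n (k + 1) :=
  (List.ofFn m).prod.toSpace

theorem totalConfig_carrier {p : ℕ} (m : Fin p → SlabMonoid n k) :
    (totalConfig m).1.carrier = (List.ofFn m).prod.config.carrier := rfl

theorem SlabMonoid.continuous_toSpace :
    Continuous (SlabMonoid.toSpace : SlabMonoid n k → ConfigSpace n (k + 1)) :=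
  continuous_iff_continuousAt.2 fun m => ConfigSpace.tendsto_iff.2
    (SlabMonoid.tendsto_iff.1 (tendsto_id (α := SlabMonoid n k) (x := 𝓝 m))).1

theorem continuous_totalConfig {p : ℕ} :
    Continuous (totalConfig : (Fin p → SlabMonoid n k) → ConfigSpace n (k + 1)) := by
  refine SlabMonoid.continuous_toSpace.comp ?_
  simp only [List.ofFn_eq_map]
  exact continuous_list_prod _ fun i _ => continuous_apply i

variable {p : ℕ}

@[simp]
theorem slicePosition_zero (m : Fin p → SlabMonoid n k) : slicePosition m 0 = 0 := by
  simp [slicePosition]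

theorem slicePosition_succ (m : Fin p → SlabMonoid n k) (j : Fin p) :
    slicePosition m j.succ = slicePosition m j.castSucc + (m j).width := by
  have : ∀ l : Fin p, (if l.castSucc < j.succ then ((m l).width : ℝ) else 0) =
      (if l.castSucc < j.castSucc then ((m l).width : ℝ) else 0) +
        if l = j then ((m l).width : ℝ) else 0 := by
    intro l
    rcases lt_trichotomy l j with h | h | h
    · simp [h, h.ne, Fin.castSucc_lt_succ_iff, h.le]
    · simp [h]
    · simp [h.not_gt, h.ne', Fin.castSucc_lt_succ_iff, h]
  simp only [slicePosition, this, Finset.sum_add_distrib, Finset.sum_ite_eq', Finset.mem_univ,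
    if_true]

theorem slicePosition_monotone (m : Fin p → SlabMonoid n k) : Monotone (slicePosition m) := by
  refine Fin.monotone_iff_le_succ.2 fun i => ?_
  rw [slicePosition_succ]
  linarith [(m i).width.2]

theorem slicePosition_cons (m : Fin (p + 1) → SlabMonoid n k) (i : Fin (p + 1)) :
    slicePosition m i.succ = (m 0).width + slicePosition (fun j => m j.succ) i := by
  induction i using Fin.induction with
  | zero => rw [slicePosition_succ, Fin.castSucc_zero]; simp
  | succ i ih =>
    rw [slicePosition_succ, ← Fin.succ_castSucc, ih, slicePosition_succ, add_assoc]

theorem continuous_slicePosition (i : Fin (p + 1)) :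
    Continuous fun m : Fin p → SlabMonoid n k => slicePosition m i := by
  refine continuous_finsetSum _ fun j _ => ?_
  split_ifs
  · exact SlabMonoid.continuous_width.comp (continuous_apply j)
  · exact continuous_const

theorem mem_totalConfig (m : Fin p → SlabMonoid n k) (x : EuclideanSpace ℝ (Fin n)) :
    x ∈ (totalConfig m).1.carrier ↔
      ∃ j, axisMap k (· - slicePosition m j.castSucc) x ∈ (m j).config.carrier := by
  rw [totalConfig_carrier]
  induction p generalizing x with
  | zero => simp [SlabMonoid.config_one]
  | succ p ih =>
    rw [List.ofFn_succ, List.prod_cons, SlabMonoid.config_mul, image_add_single, mem_union,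
      mem_preimage, ih, Fin.exists_fin_succ]
    have e0 : axisMap k (· - slicePosition m (Fin.castSucc 0)) x = x :=
      axisMap_eq_self (by simp)
    have e1 : ∀ j : Fin p, axisMap k (· - slicePosition (fun j => m j.succ) j.castSucc)
        (axisMap k (· - ((m 0).width : ℝ)) x) =
        axisMap k (· - slicePosition m j.succ.castSucc) x := by
      intro j
      rw [axisMap_axisMap, ← Fin.succ_castSucc, slicePosition_cons]
      exact axisMap_congr (by ring)
    simp only [e0, e1]

/-- Slices of a configuration: weakly increasing positions not met by the configuration. -/
def IsSlicing (S : ConfigSpace n (k + 1)) (a : Fin (p + 1) → ℝ) : Prop :=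
  Monotone a ∧ ∀ i, ∀ x ∈ S.1.carrier, x k ≠ a i

/-- The tuple of slabs cut out of a configuration by slices. -/
def segs (S : ConfigSpace n (k + 1)) (a : Fin (p + 1) → ℝ) : Fin p → SlabMonoid n k :=
  fun j => seg S (a j.castSucc) (a j.succ)

theorem exists_slab_of_mem {m : Fin p → SlabMonoid n k} {x : EuclideanSpace ℝ (Fin n)}
    (hx : x ∈ (totalConfig m).1.carrier) :
    ∃ j : Fin p, axisMap k (· - slicePosition m j.castSucc) x ∈ (m j).config.carrier ∧
      slicePosition m j.castSucc < x k ∧ x k < slicePosition m j.succ := by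
  obtain ⟨j, hj⟩ := (mem_totalConfig m x).1 hx
  have := ((m j).2 _ hj).1
  rw [axisMap_self] at this
  have h2 : x k - slicePosition m j.castSucc < (m j).width := this.2
  refine ⟨j, hj, by linarith [this.1], ?_⟩
  rw [slicePosition_succ]
  linarith

theorem isSlicing_slicePosition (m : Fin p → SlabMonoid n k) :
    IsSlicing (totalConfig m) (slicePosition m) := by
  refine ⟨slicePosition_monotone m, fun i x hx h => ?_⟩
  obtain ⟨j, _, h1, h2⟩ := exists_slab_of_mem hx
  rw [h] at h1 h2
  have h1' := (slicePosition_monotone m).reflect_lt h1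
  have h2' := (slicePosition_monotone m).reflect_lt h2
  rw [Fin.lt_def] at h1' h2'
  simp at h1' h2'
  omega

/-- With `prod_segs` and `slicePosition_segs` this makes a tuple the same thing as its total
configuration together with its slice positions. A point of the total configuration lies strictly
between consecutive slices, which identifies the factor it comes from. -/
theorem segs_totalConfig (m : Fin p → SlabMonoid n k) :
    segs (totalConfig m) (slicePosition m) = m := by
  funext j
  refine SlabMonoid.ext' ?_ ?_
  · ext x
    rw [segs, mem_seg]
    constructor
    · rintro ⟨h1, h2, h3⟩
      obtain ⟨l, h4, h5, h6⟩ := exists_slab_of_mem h1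
      simp only [axisMap_self] at h5 h6
      have h7 := (slicePosition_monotone m).reflect_lt
        (h5.trans (by linarith : x k + slicePosition m j.castSucc < slicePosition m j.succ))
      have h8 := (slicePosition_monotone m).reflect_lt
        ((by linarith : slicePosition m j.castSucc < x k + slicePosition m j.castSucc).trans h6)
      have : l = j := by
        rw [Fin.lt_def] at h7 h8
        simp at h7 h8
        exact Fin.ext (by omega)
      subst this
      rwa [axisMap_axisMap, axisMap_eq_self (by ring)] at h4
    · intro hx
      have h := ((m j).2 _ hx).1
      refine ⟨(mem_totalConfig m _).2 ⟨j, ?_⟩, h.1, ?_⟩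
      · rwa [axisMap_axisMap, axisMap_eq_self (by ring)]
      · rw [slicePosition_succ, add_sub_cancel_left]
        exact h.2
  · rw [← NNReal.coe_inj, segs, seg_width, slicePosition_succ, add_sub_cancel_left]
    exact slicePosition_monotone m (Fin.castSucc_lt_succ).le

theorem prod_segs {S : ConfigSpace n (k + 1)} {a : Fin (p + 1) → ℝ} (h : IsSlicing S a) :
    (List.ofFn (segs S a)).prod = seg S (a 0) (a (Fin.last p)) := by
  induction p with
  | zero =>
    refine SlabMonoid.ext' ?_ ?_
    · ext y
      simp only [List.ofFn_zero, List.prod_nil, SlabMonoid.config_one, mem_empty_iff_false,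
        mem_seg, false_iff, not_and, not_lt, Fin.last_zero]
      intro _ _
      linarith
    · rw [← NNReal.coe_inj, seg_width (by simp)]
      simp [SlabMonoid.width_one]
  | succ p ih =>
    rw [List.ofFn_succ, List.prod_cons]
    have h' : IsSlicing S fun i : Fin (p + 1) => a i.succ :=
      ⟨h.1.comp (Fin.strictMono_succ.monotone), fun i => h.2 _⟩
    have := ih h'
    change segs S a 0 * (List.ofFn (segs S fun i : Fin (p + 1) => a i.succ)).prod = _
    rw [this, segs]
    exact seg_mul (h.1 (Fin.castSucc_lt_succ).le) (h.1 (Fin.succ_le_succ_iff.2 (Fin.zero_le _))) (h.2 _)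

theorem slicePosition_segs {S : ConfigSpace n (k + 1)} {a : Fin (p + 1) → ℝ} (h : IsSlicing S a)
    (i : Fin (p + 1)) : slicePosition (segs S a) i = a i - a 0 := by
  induction i using Fin.induction with
  | zero => simp
  | succ i ih =>
    rw [slicePosition_succ, ih, segs, seg_width (h.1 (Fin.castSucc_lt_succ).le)]
    ring

theorem IsSlicing.comp_succAbove {S : ConfigSpace n (k + 1)} {a : Fin (p + 2) → ℝ}
    (h : IsSlicing S a) (i : Fin (p + 2)) : IsSlicing S (fun j => a (i.succAbove j)) :=
  ⟨h.1.comp (Fin.strictMono_succAbove i).monotone, fun _ => h.2 _⟩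

/-- In terms of slices, every face map forgets one slice: an inner face merges two adjacent slabs by
`seg_mul`, an outer one discards the first or last slab. -/
theorem barFace_segs {S : ConfigSpace n (k + 1)} {a : Fin (p + 2) → ℝ}
    (h : IsSlicing S a) (i : Fin (p + 2)) :
    barFace i (segs S a) = segs S (fun j => a (i.succAbove j)) := by
  funext j
  simp only [barFace, segs]
  have hm : ∀ {u v : Fin (p + 2)}, (u : ℕ) ≤ v → a u ≤ a v := fun h' => h.1 (Fin.le_def.2 h')
  split_ifs with h1 h2
  · rw [Fin.succAbove_of_castSucc_lt i j.castSucc (Fin.lt_def.2 (by simp; omega)),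
      Fin.succAbove_of_castSucc_lt i j.succ (Fin.lt_def.2 (by simpa using h1))]
    rfl
  · rw [Fin.succAbove_of_castSucc_lt i j.castSucc (Fin.lt_def.2 (by simp; omega)),
      Fin.succAbove_of_le_castSucc i j.succ (Fin.le_def.2 (by simp; omega))]
    have e : j.castSucc.succ = j.succ.castSucc := rfl
    rw [e]
    exact seg_mul (hm (by simp)) (hm (by simp)) (h.2 _)
  · rw [Fin.succAbove_of_le_castSucc i j.castSucc (Fin.le_def.2 (by simp; omega)),
      Fin.succAbove_of_le_castSucc i j.succ (Fin.le_def.2 (by simp; omega))]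
    rfl

end Slicing

/-! ### Classifying spaces: continuity and representatives -/

section Simplex

variable {p : ℕ}

theorem stdSimplex_map_succAbove (i : Fin (p + 2)) (w : stdSimplex ℝ (Fin (p + 1)))
    (j : Fin (p + 1)) : stdSimplex.map i.succAbove w (i.succAbove j) = w j := by
  rw [stdSimplex.map_coe, FunOnFinite.linearMap_apply_apply]
  rw [Finset.sum_eq_single j]
  · intro l hl hlj
    simp only [Finset.mem_filter, Finset.mem_univ, true_and] at hl
    exact absurd (Fin.succAbove_right_injective hl) hlj
  · simp

theorem stdSimplex_map_succAbove_self (i : Fin (p + 2)) (w : stdSimplex ℝ (Fin (p + 1))) :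
    stdSimplex.map i.succAbove w i = 0 := by
  rw [stdSimplex.map_coe, FunOnFinite.linearMap_apply_apply]
  refine Finset.sum_eq_zero fun l hl => ?_
  simp only [Finset.mem_filter, Finset.mem_univ, true_and] at hl
  exact absurd hl (Fin.succAbove_ne i l)

theorem stdSimplex_sum_map_succAbove (i : Fin (p + 2)) (w : stdSimplex ℝ (Fin (p + 1)))
    (f : Fin (p + 2) → ℝ) :
    ∑ j, stdSimplex.map i.succAbove w j * f j = ∑ j, w j * f (i.succAbove j) := by
  rw [Fin.sum_univ_succAbove _ i, stdSimplex_map_succAbove_self, zero_mul, zero_add]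
  simp only [stdSimplex_map_succAbove]

theorem exists_eq_map_succAbove {w : stdSimplex ℝ (Fin (p + 2))} {i : Fin (p + 2)} (h : w i = 0) :
    ∃ w' : stdSimplex ℝ (Fin (p + 1)), w = stdSimplex.map i.succAbove w' := by
  refine ⟨⟨fun j => w (i.succAbove j), fun j => stdSimplex.zero_le w _, ?_⟩, ?_⟩
  · have := stdSimplex.sum_eq_one w
    rwa [Fin.sum_univ_succAbove _ i, h, zero_add] at this
  · ext j
    rcases eq_or_ne j i with rfl | hj
    · rw [stdSimplex_map_succAbove_self, h]
    · obtain ⟨l, rfl⟩ := Fin.exists_succAbove_eq hj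
      rw [stdSimplex_map_succAbove]
      rfl

end Simplex

namespace ClassifyingSpace

variable {M : Type*} [Monoid M] [TopologicalSpace M]

/-- The quotient map remains a quotient map after restriction to the preimage of an open set and
after taking the product with a locally compact space. Continuity may therefore be tested on the
cells, even for families and on an open part of the classifying space. -/
theorem continuousOn_of_cells {P Z : Type*} [TopologicalSpace P] [LocallyCompactSpace P]
    [TopologicalSpace Z] {O : Set (ClassifyingSpace M)} (hO : IsOpen O)
    {f : ClassifyingSpace M × P → Z}
    (h : ∀ (p : ℕ) (w : stdSimplex ℝ (Fin (p + 1))) (m : Fin p → M) (t : P), mk w m ∈ O →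
      ContinuousAt (fun z : (stdSimplex ℝ (Fin (p + 1)) × (Fin p → M)) × P =>
        f (mk z.1.1 z.1.2, z.2)) ((w, m), t)) :
    ContinuousOn f (O ×ˢ univ) := by
  have hq : IsQuotientMap (Quot.mk (BarGlue M) : BarCells M → ClassifyingSpace M) :=
    isQuotientMap_quot_mk
  have hqO := hq.restrictPreimage_isOpen hO
  have hc : Continuous fun z : O × P => f (z.1.1, z.2) := by
    refine hqO.continuous_lift_prod_left ?_
    refine continuous_iff_continuousAt.2 ?_
    rintro ⟨⟨⟨p, w, m⟩, hz⟩, t⟩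
    have hcell : ContinuousAt (fun z : BarCells M × P => f (Quot.mk _ z.1, z.2))
        (⟨p, w, m⟩, t) := by
      have he : IsOpenEmbedding (Prod.map (fun c => (⟨p, c⟩ : BarCells M)) id :
          (stdSimplex ℝ (Fin (p + 1)) × (Fin p → M)) × P → BarCells M × P) :=
        (IsOpenEmbedding.sigmaMk (σ := fun p : ℕ => stdSimplex ℝ (Fin (p + 1)) ×
          (Fin p → M))).prodMap IsOpenEmbedding.id
      exact (he.continuousAt_iff (x := ((w, m), t))).1 (h p w m t hz)
    have hv : ContinuousAt (fun z : (Quot.mk (BarGlue M) ⁻¹' O) × P => (z.1.1, z.2))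
        (⟨⟨p, w, m⟩, hz⟩, t) := by fun_prop
    exact ContinuousAt.comp (f := fun z : (Quot.mk (BarGlue M) ⁻¹' O) × P => (z.1.1, z.2))
      (g := fun z : BarCells M × P => f (Quot.mk _ z.1, z.2)) hcell hv
  rintro ⟨x, t⟩ ⟨hx, -⟩
  have he : IsOpenEmbedding (Prod.map Subtype.val id : O × P → ClassifyingSpace M × P) :=
    hO.isOpenEmbedding_subtypeVal.prodMap IsOpenEmbedding.id
  exact ((he.continuousAt_iff (x := (⟨x, hx⟩, t))).1 hc.continuousAt).continuousWithinAt

theorem continuous_of_cells {P Z : Type*} [TopologicalSpace P] [LocallyCompactSpace P]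
    [TopologicalSpace Z] {f : ClassifyingSpace M × P → Z}
    (h : ∀ p : ℕ, Continuous (fun z : (stdSimplex ℝ (Fin (p + 1)) × (Fin p → M)) × P =>
        f (mk z.1.1 z.1.2, z.2))) : Continuous f := by
  have := continuousOn_of_cells (f := f) isOpen_univ fun p w m t _ => (h p).continuousAt
  rwa [univ_prod_univ, continuousOn_univ] at this

theorem continuous_mk (p : ℕ) :
    Continuous fun z : stdSimplex ℝ (Fin (p + 1)) × (Fin p → M) => mk z.1 z.2 :=
  continuous_quot_mk.comp (continuous_sigmaMk (σ := fun p : ℕ => stdSimplex ℝ (Fin (p + 1)) ×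
          (Fin p → M)))

omit [TopologicalSpace M] in
theorem mk_map_succAbove {p : ℕ} (i : Fin (p + 2)) (w : stdSimplex ℝ (Fin (p + 1)))
    (m : Fin (p + 1) → M) : mk (stdSimplex.map i.succAbove w) m = mk w (barFace i m) :=
  Quot.sound (BarGlue.face p i w m)

omit [TopologicalSpace M] in
theorem exists_eq_mk (x : ClassifyingSpace M) :
    ∃ (p : ℕ) (w : stdSimplex ℝ (Fin (p + 1))) (m : Fin p → M), x = mk w m := by
  obtain ⟨⟨p, w, m⟩, rfl⟩ := Quot.exists_rep x
  exact ⟨p, w, m, rfl⟩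

end ClassifyingSpace

/-! ### Lists of weighted slices -/

/-- The list of slices of positions `a` with weights `w`. -/
def sliceList {p : ℕ} (w a : Fin p → ℝ) : List (ℝ × ℝ) := List.ofFn fun i => (a i, w i)

/-- The slices with nonzero weight. -/
def slicePart (l : List (ℝ × ℝ)) : List (ℝ × ℝ) := l.filter fun z => decide (z.2 ≠ 0)

section Lists

theorem mem_slicePart {l : List (ℝ × ℝ)} {z : ℝ × ℝ} : z ∈ slicePart l ↔ z ∈ l ∧ z.2 ≠ 0 := by
  simp [slicePart]

theorem mem_sliceList {p : ℕ} {w a : Fin p → ℝ} {z : ℝ × ℝ} :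
    z ∈ sliceList w a ↔ ∃ i, (a i, w i) = z := by
  simp [sliceList]

@[simp]
theorem slicePart_slicePart (l : List (ℝ × ℝ)) : slicePart (slicePart l) = slicePart l := by
  simp [slicePart, List.filter_filter]

theorem slicePart_append (l l' : List (ℝ × ℝ)) :
    slicePart (l ++ l') = slicePart l ++ slicePart l' := by
  simp [slicePart]

theorem slicePart_eq_nil {l : List (ℝ × ℝ)} (h : ∀ z ∈ l, z.2 = 0) : slicePart l = [] := by
  simpa [slicePart] using h

theorem slicePart_eq_self {l : List (ℝ × ℝ)} (h : ∀ z ∈ l, z.2 ≠ 0) : slicePart l = l := by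
  simpa [slicePart] using h

theorem slicePart_cons (z : ℝ × ℝ) (l : List (ℝ × ℝ)) :
    slicePart (z :: l) = if z.2 = 0 then slicePart l else z :: slicePart l := by
  by_cases h : z.2 = 0 <;> simp [slicePart, h]

theorem sliceList_succ {p : ℕ} (w a : Fin (p + 1) → ℝ) :
    sliceList w a = (a 0, w 0) :: sliceList (fun i => w i.succ) fun i => a i.succ := by
  simp [sliceList, List.ofFn_succ]

/-- The positions of slices of weight zero are irrelevant. This freedom is used to keep slices in
order and off the configuration. -/
theorem slicePart_sliceList_congr {p : ℕ} {w a a' : Fin p → ℝ} (h : ∀ i, w i ≠ 0 → a i = a' i) :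
    slicePart (sliceList w a) = slicePart (sliceList w a') := by
  induction p with
  | zero => simp [sliceList]
  | succ p ih =>
    rw [sliceList_succ, sliceList_succ, slicePart_cons, slicePart_cons, ih fun i => h i.succ]
    by_cases h0 : w 0 = 0
    · simp [h0]
    · simp [h0, h 0 h0]

theorem slicePart_sliceList_succAbove {p : ℕ} {w a : Fin (p + 1) → ℝ} {i : Fin (p + 1)}
    (h : w i = 0) : slicePart (sliceList w a) =
      slicePart (sliceList (fun j => w (i.succAbove j)) fun j => a (i.succAbove j)) := by
  induction p with
  | zero =>
    obtain rfl : i = 0 := Fin.ext (by omega)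
    simp [slicePart_cons, h, sliceList]
  | succ p ih =>
    refine Fin.cases (motive := fun i => w i = 0 → slicePart (sliceList w a) =
      slicePart (sliceList (fun j => w (i.succAbove j)) fun j => a (i.succAbove j))) ?_ ?_ i h
    · intro h
      rw [sliceList_succ, slicePart_cons]
      simp [h]
    · intro i h
      rw [sliceList_succ w, sliceList_succ (fun j => w (i.succ.succAbove j)), slicePart_cons,
        slicePart_cons]
      rw [ih (w := fun i => w i.succ) (a := fun i => a i.succ) h]
      simp

/-- Two configurations agree strictly between the extreme slices of a list. -/
def AgreeBetween {n : ℕ} (k : Fin n) {j : ℕ} (l : List (ℝ × ℝ)) (S S' : ConfigSpace n j) : Prop :=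
  ∀ x : EuclideanSpace ℝ (Fin n), (∃ z ∈ l, z.1 < x k) → (∃ z ∈ l, x k < z.1) →
    (x ∈ S.1.carrier ↔ x ∈ S'.1.carrier)

end Lists

/-! ### Points of the classifying space cut out by weighted slices -/

section Representatives

variable {n : ℕ} {k : Fin n}

open ClassifyingSpace

/-- A slice of weight zero puts the point on a face, and passing to the face forgets that slice;
induction on the number of slices removes all of them. -/
theorem exists_reduced {p : ℕ} (w : stdSimplex ℝ (Fin (p + 1))) {S : ConfigSpace n (k + 1)}
    {a : Fin (p + 1) → ℝ} (ha : IsSlicing S a) :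
    ∃ (p' : ℕ) (w' : stdSimplex ℝ (Fin (p' + 1))) (a' : Fin (p' + 1) → ℝ), IsSlicing S a' ∧
      (∀ i, w' i ≠ 0) ∧ mk w (segs S a) = mk w' (segs S a') ∧
        slicePart (sliceList w a) = sliceList w' a' := by
  induction p with
  | zero =>
    have h0 : ∀ i, w i ≠ 0 := fun i => by simp
    refine ⟨0, w, a, ha, h0, rfl, slicePart_eq_self fun z hz => ?_⟩
    obtain ⟨i, rfl⟩ := mem_sliceList.1 hz
    exact h0 i
  | succ p ih =>
    by_cases h : ∃ i, w i = 0
    · obtain ⟨i, hi⟩ := h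
      obtain ⟨w₁, rfl⟩ := exists_eq_map_succAbove hi
      obtain ⟨p', w', a', h1, h2, h3, h4⟩ := ih w₁ (ha.comp_succAbove i)
      refine ⟨p', w', a', h1, h2, ?_, ?_⟩
      · rw [mk_map_succAbove, barFace_segs ha, h3]
      · rw [slicePart_sliceList_succAbove hi, ← h4]
        simp only [stdSimplex_map_succAbove]
    · push Not at h
      refine ⟨p + 1, w, a, ha, h, rfl, slicePart_eq_self fun z hz => ?_⟩
      obtain ⟨i, rfl⟩ := mem_sliceList.1 hz
      exact h i

/-- A point of the classifying space cut out by slices only depends on the slices with positive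
weight and on the configuration between them. -/
theorem mk_segs_eq {p p' : ℕ} {w : stdSimplex ℝ (Fin (p + 1))} {w' : stdSimplex ℝ (Fin (p' + 1))}
    {S S' : ConfigSpace n (k + 1)} {a : Fin (p + 1) → ℝ} {a' : Fin (p' + 1) → ℝ}
    (ha : IsSlicing S a) (ha' : IsSlicing S' a')
    (hl : slicePart (sliceList w a) = slicePart (sliceList w' a'))
    (hS : AgreeBetween k (slicePart (sliceList w a)) S S') :
    mk w (segs S a) = mk w' (segs S' a') := by
  obtain ⟨q, v, c, h1, h2, h3, h4⟩ := exists_reduced w ha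
  obtain ⟨q', v', c', h1', h2', h3', h4'⟩ := exists_reduced w' ha'
  rw [h3, h3']
  rw [h4] at hS
  -- After reduction no slice has weight zero, so equality of the filtered lists gives the same
  -- number of slices, positions and weights. Only the configurations can still differ, and they
  -- agree between the extreme slices.
  have e := h4.symm.trans (hl.trans h4')
  have hq : q = q' := by
    have := congrArg List.length e
    simpa [sliceList] using this
  subst hq
  have e2 := List.ofFn_injective e
  have hc : c = c' := funext fun i => congrArg Prod.fst (congrFun e2 i)
  have hv : v = v' := stdSimplex.ext (funext fun i => congrArg Prod.snd (congrFun e2 i))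
  subst hc hv
  congr 1
  funext j
  refine SlabMonoid.ext' ?_ rfl
  ext y
  rw [segs, segs, mem_seg, mem_seg]
  refine and_congr_left fun hy => hS _ ⟨(c j.castSucc, v j.castSucc), mem_sliceList.2 ⟨_, rfl⟩, ?_⟩
    ⟨(c j.succ, v j.succ), mem_sliceList.2 ⟨_, rfl⟩, ?_⟩
  · simpa using hy.1
  · simpa using by linarith [hy.2]

open Classical in
/-- The point of the classifying space cut out of a configuration by a list of slices with positive
weights. -/
def cutPoint (S : ConfigSpace n (k + 1)) (l : List (ℝ × ℝ)) :
    ClassifyingSpace (SlabMonoid n k) :=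
  if h : ∃ (p : ℕ) (w : stdSimplex ℝ (Fin (p + 1))) (a : Fin (p + 1) → ℝ), IsSlicing S a ∧
      slicePart (sliceList w a) = l then
    mk h.choose_spec.choose (segs S h.choose_spec.choose_spec.choose)
  -- Junk value for lists that do not cut `S`.
  else mk (p := 0) default Fin.elim0

/-- The point of the classifying space cut out of a configuration by a list of weighted slices. -/
def slicedPoint (S : ConfigSpace n (k + 1)) (l : List (ℝ × ℝ)) :
    ClassifyingSpace (SlabMonoid n k) :=
  cutPoint S (slicePart l)

/-- By `mk_segs_eq` the choice in `cutPoint` is immaterial. The configuration may also be replaced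
by one that agrees with it between the extreme slices. -/
theorem slicedPoint_eq {p : ℕ} {w : stdSimplex ℝ (Fin (p + 1))} {S S' : ConfigSpace n (k + 1)}
    {l : List (ℝ × ℝ)} {a : Fin (p + 1) → ℝ} (ha : IsSlicing S a) (ha' : IsSlicing S' a)
    (hl : slicePart (sliceList w a) = slicePart l) (hS : AgreeBetween k (slicePart l) S' S) :
    slicedPoint S' l = mk w (segs S a) := by
  have h : ∃ (p : ℕ) (w : stdSimplex ℝ (Fin (p + 1))) (a : Fin (p + 1) → ℝ), IsSlicing S' a ∧
      slicePart (sliceList w a) = slicePart l := ⟨p, w, a, ha', hl⟩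
  rw [slicedPoint, cutPoint, dif_pos h]
  have h2 := h.choose_spec.choose_spec.choose_spec
  refine mk_segs_eq h2.1 ha (h2.2.trans hl.symm) ?_
  rw [h2.2]
  exact hS

theorem slicedPoint_slicePart_congr (S : ConfigSpace n (k + 1)) {l l' : List (ℝ × ℝ)}
    (h : slicePart l = slicePart l') : slicedPoint S l = slicedPoint S l' := by
  rw [slicedPoint, slicedPoint, h]

end Representatives

/-! ### Barycenters of lists of weighted slices -/

/-- Weighted sums over lists of slices. -/
def sliceSum (g : ℝ → ℝ) (l : List (ℝ × ℝ)) : ℝ := (l.map fun z => z.2 * g z.1).sum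

/-- The barycenter of a list of slices. -/
def sliceCenter (l : List (ℝ × ℝ)) : ℝ := sliceSum id l

/-- Half of the distance between the lower and the upper barycenter of a list of slices. -/
def sliceRadius (l : List (ℝ × ℝ)) : ℝ := sliceSum (fun t => |t - sliceCenter l|) l / 2

section Sums

theorem sliceSum_slicePart (g : ℝ → ℝ) (l : List (ℝ × ℝ)) :
    sliceSum g (slicePart l) = sliceSum g l := by
  induction l with
  | nil => rfl
  | cons z l ih =>
    rw [slicePart_cons]
    simp only [sliceSum, List.map_cons, List.sum_cons] at ih ⊢
    split_ifs with h
    · rw [ih, h, zero_mul, zero_add]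
    · rw [List.map_cons, List.sum_cons, ih]

theorem sliceSum_sliceList {p : ℕ} (g : ℝ → ℝ) (w a : Fin p → ℝ) :
    sliceSum g (sliceList w a) = ∑ i, w i * g (a i) := by
  simp [sliceSum, sliceList, List.map_ofFn, List.sum_ofFn]

theorem sliceCenter_congr {l l' : List (ℝ × ℝ)} (h : slicePart l = slicePart l') :
    sliceCenter l = sliceCenter l' := by
  rw [sliceCenter, sliceCenter, ← sliceSum_slicePart, h, sliceSum_slicePart]

theorem sliceRadius_congr {l l' : List (ℝ × ℝ)} (h : slicePart l = slicePart l') :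
    sliceRadius l = sliceRadius l' := by
  rw [sliceRadius, sliceRadius, sliceCenter_congr h, ← sliceSum_slicePart, h, sliceSum_slicePart]

theorem sliceCenter_sliceList {p : ℕ} (w a : Fin (p + 1) → ℝ) :
    sliceCenter (sliceList w a) = baryCenter w a := sliceSum_sliceList _ _ _

theorem sliceRadius_sliceList {p : ℕ} (w a : Fin (p + 1) → ℝ) :
    sliceRadius (sliceList w a) = (∑ i, w i * |a i - baryCenter w a|) / 2 := by
  rw [sliceRadius, sliceSum_sliceList, sliceCenter_sliceList]

variable {p : ℕ}

theorem sum_mul_sub_baryCenter (w : stdSimplex ℝ (Fin (p + 1))) (a : Fin (p + 1) → ℝ) :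
    ∑ i, w i * (a i - baryCenter w a) = 0 := by
  simp only [mul_sub, Finset.sum_sub_distrib, ← Finset.sum_mul, stdSimplex.sum_eq_one]
  simp [baryCenter]

/-- The maximum of `a i` and `b` is `b` plus half of the deviation plus half of its absolute value,
and the deviations from the barycenter average to zero. Thus both barycenters lie at the same
distance from `b`. -/
theorem upperBaryCenter_eq (w : stdSimplex ℝ (Fin (p + 1))) (a : Fin (p + 1) → ℝ) :
    upperBaryCenter w a = baryCenter w a + sliceRadius (sliceList w a) := by
  have h : ∀ i, w i * max (a i) (baryCenter w a) = w i * baryCenter w a +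
      w i * (a i - baryCenter w a) / 2 + w i * |a i - baryCenter w a| / 2 := by
    intro i
    rw [max_def]
    split_ifs with h
    · rw [abs_of_nonpos (by linarith)]
      ring
    · rw [abs_of_nonneg (by linarith)]
      ring
  rw [upperBaryCenter, sliceRadius_sliceList]
  simp only [h, Finset.sum_add_distrib, ← Finset.sum_div, sum_mul_sub_baryCenter,
    ← Finset.sum_mul, stdSimplex.sum_eq_one]
  ring

theorem lowerBaryCenter_eq (w : stdSimplex ℝ (Fin (p + 1))) (a : Fin (p + 1) → ℝ) :
    lowerBaryCenter w a = baryCenter w a - sliceRadius (sliceList w a) := by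
  have h : ∀ i, w i * min (a i) (baryCenter w a) = w i * baryCenter w a +
      w i * (a i - baryCenter w a) / 2 - w i * |a i - baryCenter w a| / 2 := by
    intro i
    rw [min_def]
    split_ifs with h
    · rw [abs_of_nonpos (by linarith)]
      ring
    · rw [abs_of_nonneg (by linarith)]
      ring
  rw [lowerBaryCenter, sliceRadius_sliceList]
  simp only [h, Finset.sum_add_distrib, Finset.sum_sub_distrib, ← Finset.sum_div,
    sum_mul_sub_baryCenter, ← Finset.sum_mul, stdSimplex.sum_eq_one]
  ring

theorem sliceRadius_sliceList_nonneg (w : stdSimplex ℝ (Fin (p + 1))) (a : Fin (p + 1) → ℝ) :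
    0 ≤ sliceRadius (sliceList w a) := by
  rw [sliceRadius_sliceList]
  exact div_nonneg (Finset.sum_nonneg fun i _ =>
    mul_nonneg (stdSimplex.zero_le w i) (abs_nonneg _)) (by norm_num)

/-- The radius is half the mean absolute deviation, so it vanishes only if all slices of positive
weight coincide. -/
theorem eq_baryCenter_of_sliceRadius {w : stdSimplex ℝ (Fin (p + 1))} {a : Fin (p + 1) → ℝ}
    (h : sliceRadius (sliceList w a) = 0) {i : Fin (p + 1)} (hi : w i ≠ 0) :
    a i = baryCenter w a := by
  rw [sliceRadius_sliceList, div_eq_zero_iff, Finset.sum_eq_zero_iff_of_nonneg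
    fun i _ => mul_nonneg (stdSimplex.zero_le w i) (abs_nonneg _)] at h
  have := (h.resolve_right (by norm_num)) i (Finset.mem_univ i)
  have := (mul_eq_zero.1 this).resolve_left hi
  linarith [abs_eq_zero.1 this]

theorem stdSimplex_exists_ne_zero (w : stdSimplex ℝ (Fin (p + 1))) : ∃ i, w i ≠ 0 := by
  by_contra! h
  have := stdSimplex.sum_eq_one w
  simp [h] at this

theorem sum_mul_le_of_forall {w : stdSimplex ℝ (Fin (p + 1))} {g : Fin (p + 1) → ℝ} {A : ℝ}
    (h : ∀ i, w i ≠ 0 → g i ≤ A) : ∑ i, w i * g i ≤ A := by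
  calc ∑ i, w i * g i ≤ ∑ i, w i * A := by
        refine Finset.sum_le_sum fun i _ => ?_
        by_cases hi : w i = 0
        · simp [hi]
        · exact mul_le_mul_of_nonneg_left (h i hi) (stdSimplex.zero_le w i)
    _ = A := by rw [← Finset.sum_mul, stdSimplex.sum_eq_one, one_mul]

theorem le_sum_mul_of_forall {w : stdSimplex ℝ (Fin (p + 1))} {g : Fin (p + 1) → ℝ} {A : ℝ}
    (h : ∀ i, w i ≠ 0 → A ≤ g i) : A ≤ ∑ i, w i * g i := by
  have := sum_mul_le_of_forall (w := w) (g := fun i => - g i) (A := -A) fun i hi => neg_le_neg (h i hi)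
  simp only [mul_neg, Finset.sum_neg_distrib] at this
  linarith

/-- The upper barycenter averages the numbers `max (a i) b`, none of which exceeds the highest slice
of positive weight. -/
theorem exists_upper_le (w : stdSimplex ℝ (Fin (p + 1))) (a : Fin (p + 1) → ℝ) :
    ∃ i, w i ≠ 0 ∧ baryCenter w a + sliceRadius (sliceList w a) ≤ a i := by
  obtain ⟨i₀, h₀⟩ := stdSimplex_exists_ne_zero w
  obtain ⟨i, hi, him⟩ := Finset.exists_max_image (Finset.univ.filter fun i => w i ≠ 0) a
    ⟨i₀, by simpa using h₀⟩
  simp only [Finset.mem_filter, Finset.mem_univ, true_and] at hi him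
  refine ⟨i, hi, ?_⟩
  rw [← upperBaryCenter_eq]
  exact sum_mul_le_of_forall fun j hj => max_le (him j hj) (sum_mul_le_of_forall him)

theorem exists_le_lower (w : stdSimplex ℝ (Fin (p + 1))) (a : Fin (p + 1) → ℝ) :
    ∃ i, w i ≠ 0 ∧ a i ≤ baryCenter w a - sliceRadius (sliceList w a) := by
  obtain ⟨i₀, h₀⟩ := stdSimplex_exists_ne_zero w
  obtain ⟨i, hi, him⟩ := Finset.exists_min_image (Finset.univ.filter fun i => w i ≠ 0) a
    ⟨i₀, by simpa using h₀⟩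
  simp only [Finset.mem_filter, Finset.mem_univ, true_and] at hi him
  refine ⟨i, hi, ?_⟩
  rw [← lowerBaryCenter_eq]
  exact le_sum_mul_of_forall fun j hj => le_min (him j hj) (le_sum_mul_of_forall him)

theorem baryCenter_sub (w : stdSimplex ℝ (Fin (p + 1))) (a : Fin (p + 1) → ℝ) (τ : ℝ) :
    baryCenter w (fun i => a i - τ) = baryCenter w a - τ := by
  simp only [baryCenter, mul_sub, Finset.sum_sub_distrib, ← Finset.sum_mul, stdSimplex.sum_eq_one,
    one_mul]

theorem sliceRadius_sub (w : stdSimplex ℝ (Fin (p + 1))) (a : Fin (p + 1) → ℝ) (τ : ℝ) :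
    sliceRadius (sliceList w fun i => a i - τ) = sliceRadius (sliceList w a) := by
  simp only [sliceRadius_sliceList, baryCenter_sub, sub_sub_sub_cancel_right]

end Sums

/-! ### Translating, cutting and stretching configurations -/

section Operations

variable {n : ℕ} {k : Fin n}

/-- Translation in the coordinate `k`. -/
def shift (τ : ℝ) (S : ConfigSpace n (k + 1)) : ConfigSpace n (k + 1) :=
  ⟨⟨axisMap k (· + τ) ⁻¹' S.1.carrier,
    S.1.finite.preimage (axisMap_injective (add_left_injective τ)).injOn⟩, by
    intro x hx i hi
    have := S.2 _ hx i hi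
    rwa [axisMap_of_ne _ _ (fun h => by subst h; omega)] at this⟩

theorem mem_shift {τ : ℝ} {S : ConfigSpace n (k + 1)} {x : EuclideanSpace ℝ (Fin n)} :
    x ∈ (shift τ S).1.carrier ↔ axisMap k (· + τ) x ∈ S.1.carrier := Iff.rfl

theorem segs_shift {p : ℕ} (τ : ℝ) (S : ConfigSpace n (k + 1)) (a : Fin (p + 1) → ℝ) :
    segs (shift τ S) (fun i => a i - τ) = segs S a := by
  funext j
  refine SlabMonoid.ext' ?_ ?_
  · ext y
    simp only [segs, mem_seg, mem_shift, axisMap_axisMap, sub_sub_sub_cancel_right]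
    have e : axisMap k (fun t => t + (a j.castSucc - τ) + τ) y = axisMap k (· + a j.castSucc) y :=
      axisMap_congr (by ring)
    rw [e]
  · simp [segs, seg, SlabMonoid.width]

theorem IsSlicing.shift {p : ℕ} {S : ConfigSpace n (k + 1)} {a : Fin (p + 1) → ℝ}
    (h : IsSlicing S a) (τ : ℝ) : IsSlicing (shift τ S) fun i => a i - τ := by
  refine ⟨fun i j hij => by simpa using h.1 hij, fun i x hx => ?_⟩
  have := h.2 i _ (mem_shift.1 hx)
  rw [axisMap_self] at this
  exact fun h' => this (by linarith)

/-- The part of a configuration strictly between the extreme slices of a list. -/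
def cutBetween (S : ConfigSpace n (k + 1)) (l : List (ℝ × ℝ)) : ConfigSpace n (k + 1) :=
  ⟨⟨{x | x ∈ S.1.carrier ∧ (∃ z ∈ l, z.1 < x k) ∧ ∃ z ∈ l, x k < z.1},
    S.1.finite.subset fun _ hx => hx.1⟩, fun x hx => S.2 x hx.1⟩

theorem cutBetween_eq {S S' : ConfigSpace n (k + 1)} {l : List (ℝ × ℝ)}
    (h : AgreeBetween k l S S') : cutBetween S l = cutBetween S' l := by
  refine ConfigSpace.ext' (Set.ext fun x => ?_)
  exact and_congr_left fun hx => h x hx.1 hx.2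

theorem agreeBetween_cutBetween (S : ConfigSpace n (k + 1)) (l : List (ℝ × ℝ)) :
    AgreeBetween k l (cutBetween S l) S :=
  fun _ h1 h2 => ⟨fun h => h.1, fun h => ⟨h, h1, h2⟩⟩

theorem IsSlicing.of_subset {p : ℕ} {S S' : ConfigSpace n (k + 1)} {a : Fin (p + 1) → ℝ}
    (h : IsSlicing S a) (hS : S'.1.carrier ⊆ S.1.carrier) : IsSlicing S' a :=
  ⟨h.1, fun i x hx => h.2 i x (hS hx)⟩

variable (φ : ℝ ≃ₜ Set.Ioo (-1 : ℝ) 1)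

theorem stretch_injective {c ρ : ℝ} (h : ρ ≠ 0) :
    Function.Injective fun t => c + ρ * (φ t : ℝ) := by
  intro s t hst
  exact φ.injective (Subtype.ext (mul_left_cancel₀ h (add_left_cancel hst)))

theorem stretch_mem_Ioo {c ρ : ℝ} (h : 0 < ρ) (t : ℝ) :
    c + ρ * (φ t : ℝ) ∈ Ioo (c - ρ) (c + ρ) := by
  have h1 := (φ t).2.1
  have h2 := (φ t).2.2
  constructor <;> nlinarith

/-- The configuration in the slab with center `c` and radius `ρ`, stretched to the whole space. -/
def pull (S : ConfigSpace n (k + 1)) (c ρ : ℝ) : ConfigSpace n (k + 1) :=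
  -- For `ρ = 0` the stretching map is constant in the coordinate `k` and a preimage could be
  -- infinite, so the configuration is declared empty.
  ⟨⟨{y | ρ ≠ 0 ∧ axisMap k (fun t => c + ρ * (φ t : ℝ)) y ∈ S.1.carrier}, by
    by_cases h : ρ = 0
    · simp [h]
    · exact (S.1.finite.preimage (axisMap_injective (stretch_injective φ h)).injOn).subset
        fun _ hy => hy.2⟩, by
    intro x hx i hi
    have := S.2 _ hx.2 i hi
    rwa [axisMap_of_ne _ _ (fun h => by subst h; omega)] at this⟩

variable {φ}

theorem mem_pull {S : ConfigSpace n (k + 1)} {c ρ : ℝ} {y : EuclideanSpace ℝ (Fin n)} :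
    y ∈ (pull φ S c ρ).1.carrier ↔
      ρ ≠ 0 ∧ axisMap k (fun t => c + ρ * (φ t : ℝ)) y ∈ S.1.carrier := Iff.rfl

/-- Stretching only looks at heights strictly between `c - ρ` and `c + ρ`. -/
theorem pull_congr {S S' : ConfigSpace n (k + 1)} {c ρ : ℝ} {l : List (ℝ × ℝ)} (hρ : 0 ≤ ρ)
    (hS : AgreeBetween k l S S') (h1 : ∃ z ∈ l, z.1 ≤ c - ρ) (h2 : ∃ z ∈ l, c + ρ ≤ z.1) :
    pull φ S c ρ = pull φ S' c ρ := by
  refine ConfigSpace.ext' (Set.ext fun y => ?_)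
  simp only [mem_pull]
  refine and_congr_right fun h => ?_
  obtain ⟨z, hz, hz'⟩ := h1
  obtain ⟨z2, hz2, hz2'⟩ := h2
  have := stretch_mem_Ioo φ (c := c) (lt_of_le_of_ne hρ (Ne.symm h)) (y k)
  refine hS _ ⟨z, hz, ?_⟩ ⟨z2, hz2, ?_⟩
  · rw [axisMap_self]
    exact hz'.trans_lt this.1
  · rw [axisMap_self]
    exact this.2.trans_le hz2'

theorem pull_shift (S : ConfigSpace n (k + 1)) (τ c ρ : ℝ) :
    pull φ (shift τ S) c ρ = pull φ S (c + τ) ρ := by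
  refine ConfigSpace.ext' (Set.ext fun y => ?_)
  simp only [mem_pull, mem_shift, axisMap_axisMap]
  have e : axisMap k (fun t => c + ρ * (φ t : ℝ) + τ) y =
      axisMap k (fun t => c + τ + ρ * (φ t : ℝ)) y := axisMap_congr (by ring)
  rw [e]

/-- Where the limit radius is nonzero this is pullback along converging embeddings. Where it is zero
the limit map takes the height `c₀`, which `S₀` avoids, so points disappear locally and the limit is
empty, as `pull` prescribes. -/
theorem tendsto_pull {ι : Type*} {F : Filter ι} {S : ι → ConfigSpace n (k + 1)}
    {S₀ : ConfigSpace n (k + 1)} {c ρ : ι → ℝ} {c₀ ρ₀ : ℝ}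
    (hS : ∀ y, LocTendsto F (fun p => (S p).1.carrier) S₀.1.carrier
      (axisMap k (fun t => c₀ + ρ₀ * (φ t : ℝ)) y))
    (hc : Tendsto c F (𝓝 c₀)) (hρ : Tendsto ρ F (𝓝 ρ₀))
    (h0 : ρ₀ = 0 → ∀ x ∈ S₀.1.carrier, x k ≠ c₀) :
    Tendsto (fun p => pull φ (S p) (c p) (ρ p)) F (𝓝 (pull φ S₀ c₀ ρ₀)) := by
  have hφ : Continuous fun t => (φ t : ℝ) := continuous_subtype_val.comp φ.continuous
  refine ConfigSpace.tendsto_iff.2 fun y => ?_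
  have hne : axisMap k (fun t => c₀ + ρ₀ * (φ t : ℝ)) y ∈ S₀.1.carrier → ρ₀ ≠ 0 := by
    intro hy h
    exact h0 h _ hy (by simp [h])
  have h1 : LocTendsto F (fun p => axisMap k (fun t => c p + ρ p * (φ t : ℝ)) ⁻¹' (S p).1.carrier)
      (axisMap k (fun t => c₀ + ρ₀ * (φ t : ℝ)) ⁻¹' S₀.1.carrier) y := by
    refine (hS y).preimage_axisMap (g := fun p t => c p + ρ p * (φ t : ℝ)) ?_ ?_
    · intro t
      exact (hc.comp tendsto_fst).add ((hρ.comp tendsto_fst).mul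
        ((hφ.tendsto t).comp tendsto_snd))
    · intro hy
      refine ⟨by fun_prop, stretch_injective φ (hne hy), ?_⟩
      filter_upwards [hρ.eventually_ne (hne hy)] with p hp
      exact ⟨by fun_prop, stretch_injective φ hp⟩
  by_cases hρ0 : ρ₀ = 0
  · refine LocTendsto.of_notMem ?_ fun h => h.1 hρ0
    filter_upwards [h1.1 fun h => hne h hρ0] with q hq h
    exact hq h.2
  · refine h1.congr ?_ ?_
    · filter_upwards [(hρ.comp tendsto_fst).eventually_ne hρ0] with q hq
      exact ⟨fun h => ⟨hq, h⟩, fun h => h.2⟩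
    · exact ⟨fun h => ⟨hρ0, h⟩, fun h => h.2⟩

/-- If the radius is zero, the barycenter is itself the position of a slice and misses the
configuration, so the plain preimage is empty too and the condition `ρ ≠ 0` in `pull` changes
nothing. -/
theorem stretchedConfig_eq {p : ℕ} (w : stdSimplex ℝ (Fin (p + 1))) (m : Fin p → SlabMonoid n k) :
    stretchedConfig φ w m = (pull φ (totalConfig m) (baryCenter w (slicePosition m))
      (sliceRadius (sliceList w (slicePosition m)))).1.carrier := by
  have e : stretchedConfig φ w m = axisMap k (fun t => baryCenter w (slicePosition m) +
      sliceRadius (sliceList w (slicePosition m)) * (φ t : ℝ)) ⁻¹' (totalConfig m).1.carrier := by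
    rw [stretchedConfig, squeeze_eq, lowerBaryCenter_eq, upperBaryCenter_eq]
    congr 2
    funext t
    ring
  rw [e]
  ext y
  rw [mem_pull, mem_preimage]
  refine ⟨fun h => ⟨fun h0 => ?_, h⟩, fun h => h.2⟩
  obtain ⟨i, hi⟩ := stdSimplex_exists_ne_zero w
  refine (isSlicing_slicePosition m).2 i _ h ?_
  rw [eq_baryCenter_of_sliceRadius h0 hi, h0]
  simp

end Operations

theorem ClassifyingSpace.continuous_of_forall_cell {M Z : Type*} [Monoid M] [TopologicalSpace M]
    [TopologicalSpace Z] {f : ClassifyingSpace M → Z}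
    (h : ∀ p : ℕ, Continuous fun z : stdSimplex ℝ (Fin (p + 1)) × (Fin p → M) =>
      f (mk z.1 z.2)) : Continuous f := by
  have hq : IsQuotientMap (Quot.mk (BarGlue M) : BarCells M → ClassifyingSpace M) :=
    isQuotientMap_quot_mk
  refine hq.continuous_iff.2 ?_
  exact continuous_sigma h

/-! ### The configuration and the weighted slices of a point of the classifying space -/

section Datum

variable {n : ℕ} {k : Fin n}

open ClassifyingSpace

/-- The configuration between the extreme slices of a point of the classifying space, and its
slices of positive weight, in coordinates in which the barycenter is at the origin. -/
def cellDatum {p : ℕ} (w : stdSimplex ℝ (Fin (p + 1))) (m : Fin p → SlabMonoid n k) :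
    ConfigSpace n (k + 1) × List (ℝ × ℝ) :=
  let b := baryCenter w (slicePosition m)
  let l := slicePart (sliceList w fun i => slicePosition m i - b)
  (cutBetween (shift b (totalConfig m)) l, l)

/-- Centering at the barycenter cancels the translation by `a 0` inherent in `segs`, and the points
of `S` outside the outer slices are cut off on both sides. -/
theorem cellDatum_segs {p : ℕ} (w : stdSimplex ℝ (Fin (p + 1))) {S : ConfigSpace n (k + 1)}
    {a : Fin (p + 1) → ℝ} (h : IsSlicing S a) :
    cellDatum w (segs S a) =
      (cutBetween (shift (baryCenter w a) S)
        (slicePart (sliceList w fun i => a i - baryCenter w a)),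
        slicePart (sliceList w fun i => a i - baryCenter w a)) := by
  have e1 : slicePosition (segs S a) = fun i => a i - a 0 := funext (slicePosition_segs h)
  have e2 : baryCenter w (slicePosition (segs S a)) = baryCenter w a - a 0 := by
    rw [e1, baryCenter_sub]
  have e3 : (fun i => slicePosition (segs S a) i - baryCenter w (slicePosition (segs S a))) =
      fun i => a i - baryCenter w a := by
    rw [e2, e1]
    funext i
    ring
  rw [cellDatum]
  rw [e3, e2]
  refine Prod.ext (cutBetween_eq ?_) rfl
  rintro x ⟨z, hz, hzx⟩ ⟨z', hz', hzx'⟩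
  obtain ⟨i, rfl⟩ := mem_sliceList.1 (mem_slicePart.1 hz).1
  obtain ⟨j, rfl⟩ := mem_sliceList.1 (mem_slicePart.1 hz').1
  have h0 := h.1 (Fin.zero_le i)
  have h1 := h.1 (Fin.le_last j)
  rw [mem_shift, mem_shift, totalConfig_carrier, prod_segs h, mem_seg, axisMap_axisMap, axisMap_self]
  have e : axisMap k (fun t => t + (baryCenter w a - a 0) + a 0) x =
      axisMap k (· + baryCenter w a) x := axisMap_congr (by ring)
  rw [e]
  simp only at hzx hzx'
  refine and_iff_left ⟨by linarith, by linarith⟩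

/-- The configuration and the weighted slices of a point of the classifying space. -/
def datum (x : ClassifyingSpace (SlabMonoid n k)) : ConfigSpace n (k + 1) × List (ℝ × ℝ) :=
  Quot.lift (fun c : BarCells (SlabMonoid n k) => cellDatum c.2.1 c.2.2) (by
    rintro _ _ ⟨p, i, w, m⟩
    have hm := isSlicing_slicePosition m
    change cellDatum (stdSimplex.map i.succAbove w) m = cellDatum w (barFace i m)
    -- The face forgets a slice of weight zero, which affects neither the barycenter nor the list of
    -- slices of positive weight.
    rw [← segs_totalConfig m, barFace_segs hm, cellDatum_segs _ hm,
      cellDatum_segs _ (hm.comp_succAbove i)]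
    have eb : baryCenter (stdSimplex.map i.succAbove w) (slicePosition m) =
        baryCenter w fun j => slicePosition m (i.succAbove j) := stdSimplex_sum_map_succAbove _ _ _
    rw [eb, slicePart_sliceList_succAbove (stdSimplex_map_succAbove_self i w)]
    simp only [stdSimplex_map_succAbove]) x

theorem datum_mk {p : ℕ} (w : stdSimplex ℝ (Fin (p + 1))) (m : Fin p → SlabMonoid n k) :
    datum (mk w m) = cellDatum w m := rfl

theorem datum_mk_snd {p : ℕ} (w : stdSimplex ℝ (Fin (p + 1))) (m : Fin p → SlabMonoid n k) :
    (datum (mk w m)).2 =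
      slicePart (sliceList w fun i => slicePosition m i - baryCenter w (slicePosition m)) := rfl

theorem mem_datum_mk_snd {p : ℕ} {w : stdSimplex ℝ (Fin (p + 1))} {m : Fin p → SlabMonoid n k}
    {z : ℝ × ℝ} : z ∈ (datum (mk w m)).2 ↔
      ∃ i, w i ≠ 0 ∧ z = (slicePosition m i - baryCenter w (slicePosition m), w i) := by
  rw [datum_mk_snd, mem_slicePart, mem_sliceList]
  constructor
  · rintro ⟨⟨i, rfl⟩, h⟩
    exact ⟨i, h, rfl⟩
  · rintro ⟨i, h, rfl⟩
    exact ⟨⟨i, rfl⟩, h⟩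

theorem datum_fst_subset {p : ℕ} (w : stdSimplex ℝ (Fin (p + 1))) (m : Fin p → SlabMonoid n k) :
    (datum (mk w m)).1.1.carrier ⊆
      (shift (baryCenter w (slicePosition m)) (totalConfig m)).1.carrier := fun _ hx => hx.1

/-- The slices of `l'` lie between the extreme slices of `l`. -/
def SlicesWithin (l' l : List (ℝ × ℝ)) : Prop :=
  ∀ z ∈ l', (∃ y ∈ l, y.1 ≤ z.1) ∧ ∃ y ∈ l, z.1 ≤ y.1

theorem SlicesWithin.agreeBetween {l l' : List (ℝ × ℝ)} (h : SlicesWithin l' l)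
    {S S' : ConfigSpace n (k + 1)} (hS : AgreeBetween k l S S') : AgreeBetween k l' S S' := by
  rintro x ⟨z, hz, hzx⟩ ⟨z', hz', hzx'⟩
  obtain ⟨y, hy, hyz⟩ := (h z hz).1
  obtain ⟨y', hy', hyz'⟩ := (h z' hz').2
  exact hS x ⟨y, hy, hyz.trans_lt hzx⟩ ⟨y', hy', hzx'.trans_le hyz'⟩

theorem slicedPoint_datum_eq {p q : ℕ} {w : stdSimplex ℝ (Fin (p + 1))}
    {m : Fin p → SlabMonoid n k} {v : stdSimplex ℝ (Fin (q + 1))} {a : Fin (q + 1) → ℝ}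
    {l : List (ℝ × ℝ)} (ha : IsSlicing (totalConfig m) a)
    (hl : slicePart (sliceList v fun i => a i - baryCenter w (slicePosition m)) = slicePart l)
    (hw : SlicesWithin (slicePart l) (datum (mk w m)).2) :
    slicedPoint (datum (mk w m)).1 l = mk v (segs (totalConfig m) a) := by
  rw [← segs_shift (baryCenter w (slicePosition m))]
  exact slicedPoint_eq (ha.shift _) ((ha.shift _).of_subset (datum_fst_subset w m)) hl
    (hw.agreeBetween (agreeBetween_cutBetween _ _))

/-- The datum determines the point. Homotopies in the classifying space can therefore be written by
changing the list of slices and keeping the configuration. -/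
theorem slicedPoint_datum (x : ClassifyingSpace (SlabMonoid n k)) :
    slicedPoint (datum x).1 (datum x).2 = x := by
  obtain ⟨p, w, m, rfl⟩ := exists_eq_mk x
  have := slicedPoint_datum_eq (w := w) (v := w) (l := (datum (mk w m)).2)
    (isSlicing_slicePosition m) (by rw [datum_mk_snd, slicePart_slicePart])
    (by
      rw [datum_mk_snd, slicePart_slicePart]
      exact fun z hz => ⟨⟨z, hz, le_rfl⟩, ⟨z, hz, le_rfl⟩⟩)
  rw [this, segs_totalConfig]

/-- Half of the distance between the barycenters of a point of the classifying space. -/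
def radius (x : ClassifyingSpace (SlabMonoid n k)) : ℝ := sliceRadius (datum x).2

theorem radius_mk {p : ℕ} (w : stdSimplex ℝ (Fin (p + 1))) (m : Fin p → SlabMonoid n k) :
    radius (mk w m) = sliceRadius (sliceList w (slicePosition m)) := by
  rw [radius, datum_mk_snd, sliceRadius_congr (slicePart_slicePart _), sliceRadius_sub]

theorem radius_nonneg (x : ClassifyingSpace (SlabMonoid n k)) : 0 ≤ radius x := by
  obtain ⟨p, w, m, rfl⟩ := exists_eq_mk x
  rw [radius_mk]
  exact sliceRadius_sliceList_nonneg _ _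

theorem continuous_baryCenter {p : ℕ} : Continuous fun z : stdSimplex ℝ (Fin (p + 1)) ×
    (Fin p → SlabMonoid n k) => baryCenter z.1 (slicePosition z.2) := by
  refine continuous_finsetSum _ fun i _ => ?_
  exact ((continuous_apply i).comp (continuous_subtype_val.comp continuous_fst)).mul
    ((continuous_slicePosition i).comp continuous_snd)

theorem continuous_sliceRadius {p : ℕ} : Continuous fun z : stdSimplex ℝ (Fin (p + 1)) ×
    (Fin p → SlabMonoid n k) => sliceRadius (sliceList z.1 (slicePosition z.2)) := by
  simp only [sliceRadius_sliceList]
  refine (continuous_finsetSum _ fun i _ => ?_).div_const _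
  exact ((continuous_apply i).comp (continuous_subtype_val.comp continuous_fst)).mul
    (((continuous_slicePosition i).comp continuous_snd).sub continuous_baryCenter).abs

theorem continuous_radius : Continuous (radius : ClassifyingSpace (SlabMonoid n k) → ℝ) := by
  refine ClassifyingSpace.continuous_of_forall_cell fun p => ?_
  have : (fun z : stdSimplex ℝ (Fin (p + 1)) × (Fin p → SlabMonoid n k) =>
      radius (mk z.1 z.2)) = fun z => sliceRadius (sliceList z.1 (slicePosition z.2)) :=
    funext fun z => radius_mk _ _
  exact this ▸ continuous_sliceRadius

theorem exists_le_neg_radius (x : ClassifyingSpace (SlabMonoid n k)) :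
    ∃ z ∈ (datum x).2, z.1 ≤ - radius x := by
  obtain ⟨p, w, m, rfl⟩ := exists_eq_mk x
  obtain ⟨i, hi, h⟩ := exists_le_lower w (slicePosition m)
  refine ⟨_, mem_datum_mk_snd.2 ⟨i, hi, rfl⟩, ?_⟩
  rw [radius_mk]
  simp only
  linarith

theorem exists_radius_le (x : ClassifyingSpace (SlabMonoid n k)) :
    ∃ z ∈ (datum x).2, radius x ≤ z.1 := by
  obtain ⟨p, w, m, rfl⟩ := exists_eq_mk x
  obtain ⟨i, hi, h⟩ := exists_upper_le w (slicePosition m)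
  refine ⟨_, mem_datum_mk_snd.2 ⟨i, hi, rfl⟩, ?_⟩
  rw [radius_mk]
  simp only
  linarith

variable (φ : ℝ ≃ₜ Set.Ioo (-1 : ℝ) 1)

/-- The scanning map from the classifying space to the space of configurations. -/
def scan (x : ClassifyingSpace (SlabMonoid n k)) : ConfigSpace n (k + 1) :=
  pull φ (datum x).1 0 (radius x)

variable {φ}

theorem pull_datum_mk {p : ℕ} {w : stdSimplex ℝ (Fin (p + 1))} {m : Fin p → SlabMonoid n k}
    {c ρ : ℝ} (hρ : 0 ≤ ρ) (h1 : ∃ z ∈ (datum (mk w m)).2, z.1 ≤ c - ρ)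
    (h2 : ∃ z ∈ (datum (mk w m)).2, c + ρ ≤ z.1) :
    pull φ (datum (mk w m)).1 c ρ =
      pull φ (totalConfig m) (c + baryCenter w (slicePosition m)) ρ := by
  rw [← pull_shift]
  exact pull_congr hρ (agreeBetween_cutBetween _ _) h1 h2

theorem scan_mk {p : ℕ} (w : stdSimplex ℝ (Fin (p + 1))) (m : Fin p → SlabMonoid n k) :
    scan φ (mk w m) = pull φ (totalConfig m) (baryCenter w (slicePosition m))
      (sliceRadius (sliceList w (slicePosition m))) := by
  rw [scan, pull_datum_mk (radius_nonneg _), zero_add, radius_mk]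
  · rw [zero_sub]
    exact exists_le_neg_radius _
  · rw [zero_add]
    exact exists_radius_le _

theorem scan_mk_segs {p : ℕ} (w : stdSimplex ℝ (Fin (p + 1))) {S : ConfigSpace n (k + 1)}
    {a : Fin (p + 1) → ℝ} (h : IsSlicing S a) :
    scan φ (mk w (segs S a)) = pull φ S (baryCenter w a) (sliceRadius (sliceList w a)) := by
  have hr : radius (mk w (segs S a)) = sliceRadius (sliceList w a) := by
    rw [radius_mk]
    have e1 : slicePosition (segs S a) = fun i => a i - a 0 := funext (slicePosition_segs h)
    rw [e1, sliceRadius_sub]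
  have h1 := exists_le_neg_radius (mk w (segs S a))
  have h2 := exists_radius_le (mk w (segs S a))
  have h3 := radius_nonneg (mk w (segs S a))
  rw [scan]
  rw [hr] at *
  rw [datum_mk, cellDatum_segs w h] at *
  rw [pull_congr h3 (agreeBetween_cutBetween _ _) (by simpa using h1) (by simpa using h2),
    pull_shift, zero_add]

theorem scan_slicedPoint {p : ℕ} {w : stdSimplex ℝ (Fin (p + 1))} {S : ConfigSpace n (k + 1)}
    {a : Fin (p + 1) → ℝ} {l : List (ℝ × ℝ)} (h : IsSlicing S a)
    (hl : slicePart (sliceList w a) = slicePart l) :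
    scan φ (slicedPoint S l) = pull φ S (sliceCenter l) (sliceRadius l) := by
  rw [slicedPoint_eq h h hl fun _ _ _ => Iff.rfl, scan_mk_segs w h, ← sliceRadius_congr hl,
    ← sliceCenter_congr hl, sliceCenter_sliceList]

theorem tendsto_pull_slicing {ι : Type*} {F : Filter ι} {S : ι → ConfigSpace n (k + 1)}
    {S₀ : ConfigSpace n (k + 1)} {c ρ : ι → ℝ} {c₀ ρ₀ : ℝ} (hS : Tendsto S F (𝓝 S₀))
    (hc : Tendsto c F (𝓝 c₀)) (hρ : Tendsto ρ F (𝓝 ρ₀))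
    (h0 : ρ₀ = 0 → ∀ x ∈ S₀.1.carrier, x k ≠ c₀) :
    Tendsto (fun p => pull φ (S p) (c p) (ρ p)) F (𝓝 (pull φ S₀ c₀ ρ₀)) :=
  tendsto_pull (fun _ => ConfigSpace.tendsto_iff.1 hS _) hc hρ h0

/-- On a cell everything varies continuously, and at radius zero the configuration misses the
barycenter because a slice lies there. -/
theorem continuous_scan :
    Continuous (scan φ : ClassifyingSpace (SlabMonoid n k) → ConfigSpace n (k + 1)) := by
  refine ClassifyingSpace.continuous_of_forall_cell fun p => ?_
  have : (fun z : stdSimplex ℝ (Fin (p + 1)) × (Fin p → SlabMonoid n k) => scan φ (mk z.1 z.2)) =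
      fun z => pull φ (totalConfig z.2) (baryCenter z.1 (slicePosition z.2))
        (sliceRadius (sliceList z.1 (slicePosition z.2))) := funext fun z => scan_mk _ _
  rw [this]
  refine continuous_iff_continuousAt.2 fun z => tendsto_pull_slicing
    ((continuous_totalConfig.comp continuous_snd).tendsto z) (continuous_baryCenter.tendsto z)
    (continuous_sliceRadius.tendsto z) fun h => ?_
  obtain ⟨i, hi⟩ := stdSimplex_exists_ne_zero z.1
  rw [← eq_baryCenter_of_sliceRadius h hi]
  exact (isSlicing_slicePosition z.2).2 i

theorem scan_mk_carrier {p : ℕ} (w : stdSimplex ℝ (Fin (p + 1))) (m : Fin p → SlabMonoid n k) :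
    (scan φ (mk w m)).1.carrier = stretchedConfig φ w m := by
  rw [scan_mk, stretchedConfig_eq]

end Datum

/-! ### Pushing points to infinity in the first `k` coordinates -/

/-- An isotopy of embeddings of `ℝ` from the identity to the arctangent. -/
def shrink (s : unitInterval) (t : ℝ) : ℝ := (1 - (s : ℝ)) * t + s * Real.arctan t

theorem shrink_strictMono (s : unitInterval) : StrictMono (shrink s) := by
  intro a b hab
  have h1 := Real.arctan_strictMono hab
  have h2 := s.2.1
  have h3 := s.2.2
  unfold shrink
  rcases h2.eq_or_lt with h | h
  · rw [← h]
    linarith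
  · have := mul_lt_mul_of_pos_left h1 h
    have := mul_le_mul_of_nonneg_left hab.le (sub_nonneg.2 h3)
    linarith

theorem continuous_shrink : Continuous fun z : unitInterval × ℝ => shrink z.1 z.2 := by
  unfold shrink
  have := Real.continuous_arctan
  fun_prop

@[simp]
theorem shrink_zero (t : ℝ) : shrink 0 t = t := by
  simp [shrink]

section Dilate

variable {n : ℕ} (k : Fin n)

/-- The embedding of `ℝⁿ` given by `shrink` in the coordinates before the coordinate `k`. -/
def shrinkMap (s : unitInterval) : EuclideanSpace ℝ (Fin n) → EuclideanSpace ℝ (Fin n) :=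
  coordMap fun i => if i < k then shrink s else id

variable {k}

theorem shrinkMap_of_lt {s : unitInterval} {x : EuclideanSpace ℝ (Fin n)} {i : Fin n} (h : i < k) :
    shrinkMap k s x i = shrink s (x i) := by
  simp [shrinkMap, h]

theorem shrinkMap_of_le {s : unitInterval} {x : EuclideanSpace ℝ (Fin n)} {i : Fin n} (h : k ≤ i) :
    shrinkMap k s x i = x i := by
  simp [shrinkMap, h.not_gt]

theorem shrinkMap_injective (s : unitInterval) : Function.Injective (shrinkMap k s) := by
  refine coordMap_injective fun i => ?_
  split_ifs
  · exact (shrink_strictMono s).injective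
  · exact Function.injective_id

theorem shrinkMap_zero (x : EuclideanSpace ℝ (Fin n)) : shrinkMap k 0 x = x := by
  ext i
  by_cases h : i < k <;> simp [shrinkMap, h]

theorem shrinkMap_axisMap (s : unitInterval) (g : ℝ → ℝ) (x : EuclideanSpace ℝ (Fin n)) :
    shrinkMap k s (axisMap k g x) = axisMap k g (shrinkMap k s x) := by
  ext i
  rcases lt_trichotomy i k with h | rfl | h
  · rw [shrinkMap_of_lt h, axisMap_of_ne _ _ h.ne, axisMap_of_ne _ _ h.ne, shrinkMap_of_lt h]
  · rw [shrinkMap_of_le le_rfl, axisMap_self, axisMap_self, shrinkMap_of_le le_rfl]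
  · rw [shrinkMap_of_le h.le, axisMap_of_ne _ _ h.ne', axisMap_of_ne _ _ h.ne', shrinkMap_of_le h.le]

theorem LocTendsto.preimage_shrinkMap {ι : Type*} {F : Filter ι} {s : ι → unitInterval}
    {s₀ : unitInterval} {c : ι → Set (EuclideanSpace ℝ (Fin n))}
    {c₀ : Set (EuclideanSpace ℝ (Fin n))} {y : EuclideanSpace ℝ (Fin n)}
    (hc : LocTendsto F c c₀ (shrinkMap k s₀ y)) (hs : Tendsto s F (𝓝 s₀)) :
    LocTendsto F (fun p => shrinkMap k (s p) ⁻¹' c p) (shrinkMap k s₀ ⁻¹' c₀) y := by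
  have hcont : ∀ s, Continuous (shrink s) := fun s =>
    continuous_shrink.comp (by fun_prop : Continuous fun t : ℝ => (s, t))
  refine LocTendsto.preimage_coordMap' (f := fun p i => if i < k then shrink (s p) else id)
    (f₀ := fun i => if i < k then shrink s₀ else id) hc ?_ ?_
  · intro i t
    by_cases hi : i < k
    · simp only [hi, if_true]
      exact (continuous_shrink.tendsto (s₀, t)).comp ((hs.comp tendsto_fst).prodMk_nhds tendsto_snd)
    · simpa [hi] using tendsto_snd
  · intro hy i
    by_cases hi : i < k
    · simp only [hi, if_true]
      exact ⟨hcont _, (shrink_strictMono _).injective,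
        Eventually.of_forall fun p => ⟨hcont _, (shrink_strictMono _).injective⟩⟩
    · simp [hi, continuous_id, Function.injective_id]

/-- Dilation of configurations in the coordinates before the coordinate `k`. -/
def ConfigSpace.dilate (s : unitInterval) (S : ConfigSpace n (k + 1)) : ConfigSpace n (k + 1) :=
  ⟨⟨shrinkMap k s ⁻¹' S.1.carrier, S.1.finite.preimage (shrinkMap_injective s).injOn⟩, by
    intro x hx i hi
    have := S.2 _ hx i hi
    rwa [shrinkMap_of_le (Fin.le_def.2 (by omega))] at this⟩

theorem ConfigSpace.mem_dilate {s : unitInterval} {S : ConfigSpace n (k + 1)}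
    {x : EuclideanSpace ℝ (Fin n)} :
    x ∈ (S.dilate s).1.carrier ↔ shrinkMap k s x ∈ S.1.carrier := Iff.rfl

theorem ConfigSpace.dilate_zero (S : ConfigSpace n (k + 1)) : S.dilate 0 = S :=
  ConfigSpace.ext' (Set.ext fun x => by rw [ConfigSpace.mem_dilate, shrinkMap_zero])

theorem ConfigSpace.continuous_dilate :
    Continuous fun z : ConfigSpace n (k + 1) × unitInterval => z.1.dilate z.2 :=
  continuous_iff_continuousAt.2 fun z => ConfigSpace.tendsto_iff.2 fun _ =>
    (ConfigSpace.tendsto_iff.1 (continuous_fst.tendsto z) _).preimage_shrinkMap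
      (continuous_snd.tendsto z)

/-- Dilation of a configuration in a slab in the coordinates before the coordinate `k`. -/
def SlabMonoid.dilateConfig (s : unitInterval) (m : SlabMonoid n k) : SlabMonoid n k :=
  ⟨(⟨shrinkMap k s ⁻¹' m.config.carrier,
    m.config.finite.preimage (shrinkMap_injective s).injOn⟩, m.width), by
      intro x hx
      have := m.2 _ hx
      rw [shrinkMap_of_le le_rfl] at this
      refine ⟨this.1, fun i hi => ?_⟩
      simpa [shrinkMap_of_le hi.le] using this.2 i hi⟩

theorem SlabMonoid.dilateConfig_carrier (s : unitInterval) (m : SlabMonoid n k) :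
    (m.dilateConfig s).config.carrier = shrinkMap k s ⁻¹' m.config.carrier := rfl

theorem SlabMonoid.dilateConfig_width (s : unitInterval) (m : SlabMonoid n k) :
    (m.dilateConfig s).width = m.width := rfl

/-- Dilation as an endomorphism of the monoid of slabs. -/
def SlabMonoid.dilate (s : unitInterval) : SlabMonoid n k →* SlabMonoid n k where
  toFun := dilateConfig s
  map_one' := SlabMonoid.ext' rfl rfl
  map_mul' m m' := by
    refine SlabMonoid.ext' ?_ rfl
    rw [config_mul, image_add_single, dilateConfig_carrier, dilateConfig_carrier,
      dilateConfig_carrier, dilateConfig_width, config_mul, image_add_single]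
    ext x
    simp only [mem_preimage, mem_union, shrinkMap_axisMap]

theorem SlabMonoid.mem_dilate {s : unitInterval} {m : SlabMonoid n k}
    {x : EuclideanSpace ℝ (Fin n)} :
    x ∈ (dilate s m).config.carrier ↔ shrinkMap k s x ∈ m.config.carrier := Iff.rfl

theorem SlabMonoid.dilate_zero (m : SlabMonoid n k) : dilate 0 m = m :=
  SlabMonoid.ext' (Set.ext fun x => by rw [mem_dilate, shrinkMap_zero]) rfl

theorem SlabMonoid.continuous_dilate :
    Continuous fun z : SlabMonoid n k × unitInterval => dilate z.2 z.1 := by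
  refine continuous_iff_continuousAt.2 fun z => SlabMonoid.tendsto_iff.2 ⟨fun _ => ?_, ?_⟩
  · exact ((SlabMonoid.tendsto_iff.1 (continuous_fst.tendsto z)).1 _).preimage_shrinkMap
      (continuous_snd.tendsto z)
  · exact (SlabMonoid.tendsto_iff.1 (continuous_fst.tendsto z)).2

theorem barFace_map {M N : Type*} [Monoid M] [Monoid N] (f : M →* N) {p : ℕ} (i : Fin (p + 2))
    (m : Fin (p + 1) → M) : barFace i (fun j => f (m j)) = fun j => f (barFace i m j) := by
  funext j
  simp only [barFace]
  split_ifs <;> simp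

open ClassifyingSpace

/-- Dilation on the classifying space. -/
def barDilate (x : ClassifyingSpace (SlabMonoid n k)) (s : unitInterval) :
    ClassifyingSpace (SlabMonoid n k) :=
  Quot.lift (fun c : BarCells (SlabMonoid n k) =>
    ClassifyingSpace.mk c.2.1 fun j => SlabMonoid.dilate s (c.2.2 j)) (by
    rintro _ _ ⟨p, i, w, m⟩
    change mk (stdSimplex.map i.succAbove w) (fun j => SlabMonoid.dilate s (m j)) =
      mk w (fun j => SlabMonoid.dilate s (barFace i m j))
    rw [mk_map_succAbove, barFace_map]) x

theorem barDilate_mk {p : ℕ} (w : stdSimplex ℝ (Fin (p + 1))) (m : Fin p → SlabMonoid n k)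
    (s : unitInterval) : barDilate (mk w m) s = mk w fun j => SlabMonoid.dilate s (m j) := rfl

theorem continuous_barDilate :
    Continuous fun z : ClassifyingSpace (SlabMonoid n k) × unitInterval => barDilate z.1 z.2 := by
  refine continuous_of_cells fun p => ?_
  simp only [barDilate_mk]
  have h : Continuous fun z : (stdSimplex ℝ (Fin (p + 1)) × (Fin p → SlabMonoid n k)) ×
      unitInterval => (z.1.1, fun j => SlabMonoid.dilate z.2 (z.1.2 j)) := ?_
  · exact (continuous_mk (M := SlabMonoid n k) p).comp h
  refine (continuous_fst.comp continuous_fst).prodMk (continuous_pi fun j => ?_)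
  have h2 : Continuous fun z : (stdSimplex ℝ (Fin (p + 1)) × (Fin p → SlabMonoid n k)) ×
      unitInterval => (z.1.2 j, z.2) := by fun_prop
  exact SlabMonoid.continuous_dilate.comp h2

theorem barDilate_zero (x : ClassifyingSpace (SlabMonoid n k)) : barDilate x 0 = x := by
  obtain ⟨p, w, m, rfl⟩ := exists_eq_mk x
  rw [barDilate_mk]
  simp only [SlabMonoid.dilate_zero]

theorem slicePosition_dilate {p : ℕ} (m : Fin p → SlabMonoid n k) (s : unitInterval) :
    (slicePosition fun j => SlabMonoid.dilate s (m j)) = slicePosition m := rfl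

theorem totalConfig_dilate {p : ℕ} (m : Fin p → SlabMonoid n k) (s : unitInterval) :
    (totalConfig fun j => SlabMonoid.dilate s (m j)) = (totalConfig m).dilate s := by
  refine ConfigSpace.ext' ?_
  rw [totalConfig_carrier]
  have : (List.ofFn fun j => SlabMonoid.dilate s (m j)) = (List.ofFn m).map (SlabMonoid.dilate s) := by
    rw [List.map_ofFn]
    rfl
  rw [this, ← map_list_prod]
  rfl

variable {φ : ℝ ≃ₜ Set.Ioo (-1 : ℝ) 1}

theorem pull_dilate (S : ConfigSpace n (k + 1)) (s : unitInterval) (c ρ : ℝ) :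
    pull φ (S.dilate s) c ρ = (pull φ S c ρ).dilate s := by
  refine ConfigSpace.ext' (Set.ext fun y => ?_)
  rw [mem_pull, ConfigSpace.mem_dilate, ConfigSpace.mem_dilate, mem_pull, shrinkMap_axisMap]

/-- Dilation leaves the coordinate `k` alone, so it respects slices and barycenters and commutes
with stretching. -/
theorem scan_barDilate (x : ClassifyingSpace (SlabMonoid n k)) (s : unitInterval) :
    scan φ (barDilate x s) = (scan φ x).dilate s := by
  obtain ⟨p, w, m, rfl⟩ := exists_eq_mk x
  rw [barDilate_mk, scan_mk, scan_mk, slicePosition_dilate, totalConfig_dilate, pull_dilate]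

theorem radius_barDilate (x : ClassifyingSpace (SlabMonoid n k)) (s : unitInterval) :
    radius (barDilate x s) = radius x := by
  obtain ⟨p, w, m, rfl⟩ := exists_eq_mk x
  rw [barDilate_mk, radius_mk, radius_mk, slicePosition_dilate]

variable (k) in
/-- The configurations that meet the hyperplane at `s` only far away from the origin. -/
def clearAt (s : ℝ) : Set (ConfigSpace n (k + 1)) :=
  {S | ∀ x ∈ S.1.carrier, x k = s → ∃ i, i < k ∧ 2 < |x i|}

/-- A forbidden point lies in the compact box `K`: its height is `s`, its earlier coordinates are at
most `2` in absolute value, and its later ones are in `[0,1]`. Missing a compact set is an open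
condition. -/
theorem isOpen_clearAt (s : ℝ) : IsOpen (clearAt k s) := by
  refine isOpen_iff_mem_nhds.2 fun S hS => ?_
  let K : Set (EuclideanSpace ℝ (Fin n)) := (WithLp.toLp 2 : (Fin n → ℝ) → _) ''
    univ.pi fun i => if i = k then {s} else if i < k then Icc (-2 : ℝ) 2 else Icc 0 1
  have hK : IsCompact K := by
    refine (isCompact_univ_pi fun i => ?_).image (PiLp.continuous_toLp 2 _)
    split_ifs
    · exact isCompact_singleton
    · exact isCompact_Icc
    · exact isCompact_Icc
  have hmem : ∀ x : EuclideanSpace ℝ (Fin n), x k = s → (∀ i, i < k → |x i| ≤ 2) →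
      (∀ i, k < i → x i ∈ Ioo (0 : ℝ) 1) → x ∈ K := by
    intro x h1 h2 h3
    refine ⟨x.ofLp, fun i _ => ?_, rfl⟩
    dsimp only
    split_ifs with h h'
    · rw [h]
      exact h1
    · exact abs_le.1 (h2 i h')
    · exact Ioo_subset_Icc_self (h3 i (lt_of_le_of_ne (not_lt.1 h') (Ne.symm h)))
  have h := LocTendsto.eventually_notMem_compact (F := 𝓝 S) (c := fun S' => S'.1.carrier)
    (c₀ := S.1.carrier) hK ?_ fun y _ => ConfigSpace.tendsto_iff.1 tendsto_id y
  · filter_upwards [h] with S' hS' x hx hxs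
    by_contra! hne
    exact hS' x (hmem x hxs hne fun i hi => S'.2 x hx i (Fin.lt_def.1 hi)) hx
  · rintro _ ⟨x, hx, rfl⟩ hxS
    have hk := hx k (mem_univ k)
    simp only [if_true, mem_singleton_iff] at hk
    obtain ⟨i, hi, hi'⟩ := hS _ hxS hk
    have := hx i (mem_univ i)
    simp only [hi.ne, hi, if_true, if_false] at this
    exact absurd (abs_le.2 this) (not_le.2 hi')

/-- The preimage under the arctangent forgets every point with an early coordinate larger than `2`
in absolute value, and a configuration in `clearAt k s` has no other points at height `s`. -/
theorem ne_of_mem_dilate_one {s : ℝ} {S : ConfigSpace n (k + 1)} (hS : S ∈ clearAt k s)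
    {x : EuclideanSpace ℝ (Fin n)} (hx : x ∈ (S.dilate 1).1.carrier) : x k ≠ s := by
  intro h
  obtain ⟨i, hi, hi'⟩ := hS _ hx (by rwa [shrinkMap_of_le le_rfl])
  rw [shrinkMap_of_lt hi] at hi'
  -- The bound `2` in `clearAt` is any number at least `π / 2`; `π < 4` suffices.
  have : |shrink 1 (x i)| ≤ 2 := by
    simp only [shrink, Set.Icc.coe_one, sub_self, zero_mul, one_mul, zero_add]
    have := Real.arctan_lt_pi_div_two (x i)
    have := Real.neg_pi_div_two_lt_arctan (x i)
    have := Real.pi_lt_four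
    exact abs_le.2 ⟨by linarith, by linarith⟩
  linarith

end Dilate

/-! ### Doubling the slices -/

section Double

variable {n : ℕ} {k : Fin n}

/-- The empty slab of a given width. -/
def emptySlab (c : ℝ) : SlabMonoid n k :=
  ⟨(PointConfig.empty n, c.toNNReal), fun _ hx => hx.elim⟩

theorem emptySlab_zero : (emptySlab 0 : SlabMonoid n k) = 1 :=
  SlabMonoid.ext' rfl Real.toNNReal_zero

theorem width_emptySlab {c : ℝ} (h : 0 ≤ c) : ((emptySlab c : SlabMonoid n k).width : ℝ) = c :=
  Real.coe_toNNReal _ h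

theorem continuous_emptySlab : Continuous (emptySlab : ℝ → SlabMonoid n k) := by
  have h : Continuous fun c : ℝ => (PointConfig.empty n, c.toNNReal) :=
    continuous_const.prodMk continuous_real_toNNReal
  exact h.subtype_mk _

theorem seg_self (S : ConfigSpace n (k + 1)) (a : ℝ) : seg S a a = 1 := by
  refine SlabMonoid.ext' ?_ ?_
  · ext y
    simp only [mem_seg, sub_self, SlabMonoid.config_one, mem_empty_iff_false, iff_false]
    rintro ⟨-, h1, h2⟩
    exact absurd h1 h2.not_gt
  · simp [seg, SlabMonoid.width]
    rfl

/-- The index of the block of two containing a given index. -/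
def half {q : ℕ} (j : Fin (2 * q)) : Fin q := ⟨j / 2, by omega⟩

theorem half_monotone {q : ℕ} : Monotone (half : Fin (2 * q) → Fin q) :=
  fun _ _ h => Fin.le_def.2 (Nat.div_le_div_right (Fin.le_def.1 h))

theorem half_succ_succ {q : ℕ} (j : Fin (2 * q)) :
    half (q := q + 1) (j.succ.succ : Fin (2 * q + 1 + 1)) = (half j).succ := by
  apply Fin.ext
  simp [half]
  omega

theorem half_zero {q : ℕ} : half (q := q + 1) (0 : Fin (2 * q + 1 + 1)) = 0 := by
  simp [half]

theorem half_one {q : ℕ} : half (q := q + 1) (Fin.succ 0 : Fin (2 * q + 1 + 1)) = 0 := by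
  apply Fin.ext
  change (0 + 1) / 2 = 0
  norm_num

/-- Splitting the weight of each slice into two weights. -/
def splitWeight {q : ℕ} (α β : ℝ) (w : Fin q → ℝ) (j : Fin (2 * q)) : ℝ :=
  if (j : ℕ) % 2 = 0 then α * w (half j) else β * w (half j)

theorem splitWeight_zero {q : ℕ} (α β : ℝ) (w : Fin (q + 1) → ℝ) :
    splitWeight α β w (0 : Fin (2 * q + 1 + 1)) = α * w 0 := by
  rw [splitWeight, if_pos (by simp), half_zero]

theorem splitWeight_one {q : ℕ} (α β : ℝ) (w : Fin (q + 1) → ℝ) :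
    splitWeight α β w (Fin.succ 0 : Fin (2 * q + 1 + 1)) = β * w 0 := by
  rw [splitWeight, if_neg (by simp), half_one]

theorem splitWeight_succ_succ {q : ℕ} (α β : ℝ) (w : Fin (q + 1) → ℝ) (j : Fin (2 * q)) :
    splitWeight α β w (j.succ.succ : Fin (2 * q + 1 + 1)) =
      splitWeight α β (fun i => w i.succ) j := by
  rw [splitWeight, splitWeight, half_succ_succ]
  have : ((j.succ.succ : Fin (2 * q + 1 + 1)) : ℕ) % 2 = (j : ℕ) % 2 := by
    simp only [Fin.val_succ]
    omega
  rw [this]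

theorem sum_splitWeight {q : ℕ} (α β : ℝ) (w : Fin q → ℝ) :
    ∑ j, splitWeight α β w j = (α + β) * ∑ i, w i := by
  induction q with
  | zero => simp
  | succ q ih =>
    rw [show (∑ j, splitWeight α β w j) = ∑ j : Fin (2 * q + 1 + 1), splitWeight α β w j from rfl,
      Fin.sum_univ_succ, Fin.sum_univ_succ, splitWeight_zero, splitWeight_one]
    simp only [splitWeight_succ_succ, ih]
    rw [Fin.sum_univ_succ (fun i => w i)]
    ring

theorem slicePart_splitWeight {q : ℕ} (w a : Fin q → ℝ) :
    slicePart (sliceList (splitWeight 1 0 w) fun j => a (half j)) = slicePart (sliceList w a) := by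
  induction q with
  | zero => rfl
  | succ q ih =>
    rw [show sliceList (splitWeight 1 0 w) (fun j => a (half j)) =
      sliceList (p := 2 * q + 1 + 1) (splitWeight 1 0 w) (fun j => a (half j)) from rfl,
      sliceList_succ, sliceList_succ, sliceList_succ w, splitWeight_zero, splitWeight_one]
    simp only [splitWeight_succ_succ, half_succ_succ, half_zero, half_one]
    have ih' := ih (fun i => w i.succ) (fun i => a i.succ)
    rw [slicePart_cons, slicePart_cons, slicePart_cons]
    simp only [one_mul, zero_mul, if_true]
    rw [← ih']
    rfl

variable {p : ℕ}

/-- Doubled weights. -/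
def doubleWeights (w : stdSimplex ℝ (Fin (p + 1))) (v : unitInterval) :
    stdSimplex ℝ (Fin (2 * p + 1 + 1)) :=
  ⟨splitWeight (q := p + 1) (1 - v / 2) (v / 2) w, by
    intro j
    have h1 := v.2.1
    have h2 := v.2.2
    have := stdSimplex.zero_le w (half (q := p + 1) j)
    unfold splitWeight
    split_ifs
    · exact mul_nonneg (by linarith) this
    · exact mul_nonneg (by linarith) this, by
    have := sum_splitWeight (q := p + 1) (1 - (v : ℝ) / 2) (v / 2) w
    rw [stdSimplex.sum_eq_one] at this
    exact this.trans (by ring)⟩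

theorem doubleWeights_apply (w : stdSimplex ℝ (Fin (p + 1))) (v : unitInterval)
    (j : Fin (2 * p + 1 + 1)) :
    doubleWeights w v j = splitWeight (q := p + 1) (1 - v / 2) (v / 2) w j := rfl

theorem doubleWeights_mk {w : stdSimplex ℝ (Fin (p + 1))} {v : unitInterval} {l : ℕ}
    (hl : l < p + 1) {h : 2 * l < 2 * p + 1 + 1} :
    doubleWeights w v ⟨2 * l, h⟩ = (1 - v / 2) * w ⟨l, hl⟩ := by
  rw [doubleWeights_apply, splitWeight, if_pos (by simp)]
  congr 2
  apply Fin.ext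
  simp [half]

theorem doubleWeights_mk' {w : stdSimplex ℝ (Fin (p + 1))} {v : unitInterval} {l : ℕ}
    (hl : l < p + 1) {h : 2 * l + 1 < 2 * p + 1 + 1} :
    doubleWeights w v ⟨2 * l + 1, h⟩ = (v / 2) * w ⟨l, hl⟩ := by
  rw [doubleWeights_apply, splitWeight, if_neg (by simp)]
  congr 2
  apply Fin.ext
  simp [half]
  omega

/-- The tuple of slabs obtained by inserting empty slabs at all slices. -/
def doubleTuple (w : stdSimplex ℝ (Fin (p + 1))) (m : Fin p → SlabMonoid n k) (v : unitInterval)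
    (j : Fin (2 * p + 1)) : SlabMonoid n k :=
  if h : (j : ℕ) % 2 = 0 then emptySlab (v * w ⟨j / 2, by omega⟩) else m ⟨j / 2, by omega⟩

theorem doubleTuple_mk {w : stdSimplex ℝ (Fin (p + 1))} {m : Fin p → SlabMonoid n k}
    {v : unitInterval} {l : ℕ} (hl : l < p + 1) {h : 2 * l < 2 * p + 1} :
    doubleTuple w m v ⟨2 * l, h⟩ = emptySlab (v * w ⟨l, hl⟩) := by
  rw [doubleTuple, dif_pos (by simp)]
  congr 4
  simp

theorem doubleTuple_mk' {w : stdSimplex ℝ (Fin (p + 1))} {m : Fin p → SlabMonoid n k}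
    {v : unitInterval} {l : ℕ} (hl : l < p) {h : 2 * l + 1 < 2 * p + 1} :
    doubleTuple w m v ⟨2 * l + 1, h⟩ = m ⟨l, hl⟩ := by
  rw [doubleTuple, dif_neg (by simp)]
  congr 2
  simp
  omega

section barFace

variable {M : Type*} [Monoid M] {q : ℕ} {m : Fin (q + 1) → M} {i : Fin (q + 2)} {j : ℕ}

theorem barFace_of_lt (hj : j < q) (h : j + 1 < i) : barFace i m ⟨j, hj⟩ = m ⟨j, by omega⟩ := by
  simp only [barFace, h, if_true]
  rfl

theorem barFace_of_eq (hj : j < q) (h : j + 1 = i) :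
    barFace i m ⟨j, hj⟩ = m ⟨j, by omega⟩ * m ⟨j + 1, by omega⟩ := by
  unfold barFace
  rw [if_neg (by simpa using h.ge), if_pos (by simpa using h)]
  rfl

theorem barFace_of_gt (hj : j < q) (h : i < j + 1) :
    barFace i m ⟨j, hj⟩ = m ⟨j + 1, by omega⟩ := by
  simp only [barFace, h.not_gt, h.ne', if_false]
  rfl

end barFace

theorem stdSimplex_map_succAbove_mk_lt {i : Fin (p + 2)} {w : stdSimplex ℝ (Fin (p + 1))} {l : ℕ}
    (hl : l < p + 2) (h : l < i) :
    stdSimplex.map i.succAbove w ⟨l, hl⟩ = w ⟨l, by omega⟩ := by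
  have e := stdSimplex_map_succAbove i w ⟨l, by omega⟩
  rw [Fin.succAbove_of_castSucc_lt _ _ (Fin.lt_def.2 (by simpa using h))] at e
  exact e

theorem stdSimplex_map_succAbove_mk_gt {i : Fin (p + 2)} {w : stdSimplex ℝ (Fin (p + 1))} {l : ℕ}
    (hl : l + 1 < p + 2) (h : i < l + 1) :
    stdSimplex.map i.succAbove w ⟨l + 1, hl⟩ = w ⟨l, by omega⟩ := by
  have e := stdSimplex_map_succAbove i w ⟨l, by omega⟩
  rw [Fin.succAbove_of_le_castSucc _ _ (Fin.le_def.2 (Nat.lt_succ_iff.1 h))] at e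
  exact e

/-- A slice `i` of weight zero doubles to the slices `2 * i` and `2 * i + 1`, both of weight zero.
-/
theorem doubleWeights_map_succAbove (i : Fin (p + 2)) (w : stdSimplex ℝ (Fin (p + 1)))
    (v : unitInterval) : doubleWeights (stdSimplex.map i.succAbove w) v =
      stdSimplex.map (Fin.succAbove (⟨2 * i + 1, by omega⟩ : Fin (2 * p + 1 + 1 + 1 + 1)))
        (stdSimplex.map (Fin.succAbove (⟨2 * i, by omega⟩ : Fin (2 * p + 1 + 1 + 1)))
          (doubleWeights w v)) := by
  ext ⟨j, hj⟩
  have hz : stdSimplex.map i.succAbove w ⟨i, i.2⟩ = 0 := stdSimplex_map_succAbove_self i w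
  rcases Nat.even_or_odd' j with ⟨l, rfl | rfl⟩
  · rw [doubleWeights_mk (by omega)]
    rcases lt_trichotomy l i with h | h | h
    · rw [stdSimplex_map_succAbove_mk_lt (by omega) h,
        stdSimplex_map_succAbove_mk_lt hj (by simp; omega),
        stdSimplex_map_succAbove_mk_lt (by omega) (by simp; omega), doubleWeights_mk (by omega)]
    · subst h
      rw [hz, mul_zero, stdSimplex_map_succAbove_mk_lt hj (by simp)]
      exact (stdSimplex_map_succAbove_self _ _).symm
    · obtain ⟨l, rfl⟩ : ∃ l', l = l' + 1 := ⟨l - 1, by omega⟩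
      rw [stdSimplex_map_succAbove_mk_gt (by omega) h]
      refine Eq.trans ?_ (stdSimplex_map_succAbove_mk_gt (l := 2 * l + 1) hj (by simp; omega)).symm
      rw [stdSimplex_map_succAbove_mk_gt (by omega) (by simp; omega), doubleWeights_mk (by omega)]
  · rw [doubleWeights_mk' (by omega)]
    rcases lt_trichotomy l i with h | h | h
    · rw [stdSimplex_map_succAbove_mk_lt (by omega) h,
        stdSimplex_map_succAbove_mk_lt hj (by simp; omega),
        stdSimplex_map_succAbove_mk_lt (by omega) (by simp; omega), doubleWeights_mk' (by omega)]
    · subst h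
      rw [hz, mul_zero]
      exact (stdSimplex_map_succAbove_self _ _).symm
    · obtain ⟨l, rfl⟩ : ∃ l', l = l' + 1 := ⟨l - 1, by omega⟩
      rw [stdSimplex_map_succAbove_mk_gt (by omega) h]
      refine Eq.trans ?_ (stdSimplex_map_succAbove_mk_gt (l := 2 * l + 2) hj (by simp; omega)).symm
      refine Eq.trans ?_ (stdSimplex_map_succAbove_mk_gt (l := 2 * l + 1) (by omega)
        (by simp; omega)).symm
      rw [doubleWeights_mk' (by omega)]

/-- The inserted slab at a slice has width proportional to the weight of that slice. At a slice of
weight zero it is trivial, and forgetting both copies of the slice has the same effect as forgetting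
it before doubling. -/
theorem doubleTuple_barFace (i : Fin (p + 2)) (w : stdSimplex ℝ (Fin (p + 1)))
    (m : Fin (p + 1) → SlabMonoid n k) (v : unitInterval) :
    barFace (⟨2 * i, by omega⟩ : Fin (2 * p + 1 + 1 + 1))
      (barFace (⟨2 * i + 1, by omega⟩ : Fin (2 * p + 1 + 1 + 1 + 1))
        (doubleTuple (stdSimplex.map i.succAbove w) m v)) = doubleTuple w (barFace i m) v := by
  funext ⟨j, hj⟩
  have hz : stdSimplex.map i.succAbove w ⟨i, i.2⟩ = 0 := stdSimplex_map_succAbove_self i w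
  rcases Nat.even_or_odd' j with ⟨l, rfl | rfl⟩
  · rw [doubleTuple_mk (by omega)]
    rcases lt_or_ge l i with h | h
    · rw [barFace_of_lt hj (by simp; omega), barFace_of_lt (by omega) (by simp; omega),
        doubleTuple_mk (by omega), stdSimplex_map_succAbove_mk_lt (by omega) h]
    · rw [barFace_of_gt hj (by simp; omega), barFace_of_gt (by omega) (by simp; omega)]
      refine (doubleTuple_mk (l := l + 1) (by omega)).trans ?_
      rw [stdSimplex_map_succAbove_mk_gt (by omega) (by omega)]
  · rw [doubleTuple_mk' (by omega)]
    rcases lt_trichotomy (l + 1) i with h | h | h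
    · rw [barFace_of_lt hj (by simp; omega), barFace_of_lt (by omega) (by simp; omega),
        doubleTuple_mk' (by omega), barFace_of_lt (by omega) h]
    · rw [barFace_of_eq hj (by simp; omega), barFace_of_lt (by omega) (by simp; omega),
        barFace_of_eq (by omega) (by simp; omega), doubleTuple_mk' (by omega),
        barFace_of_eq (by omega) h]
      -- The empty slab at the forgotten slice has width zero and is the unit of the monoid.
      have e1 : doubleTuple (stdSimplex.map i.succAbove w) m v ⟨2 * l + 1 + 1, by omega⟩ = 1 := by
        refine (doubleTuple_mk (l := l + 1) (by omega)).trans ?_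
        have : (⟨l + 1, by omega⟩ : Fin (p + 1 + 1)) = ⟨i, i.2⟩ := Fin.ext h
        rw [this, hz, mul_zero, emptySlab_zero]
      have e2 : doubleTuple (stdSimplex.map i.succAbove w) m v ⟨2 * l + 1 + 1 + 1, by omega⟩ =
          m ⟨l + 1, by omega⟩ := doubleTuple_mk' (l := l + 1) (by omega)
      rw [e1, e2, one_mul]
    · rw [barFace_of_gt hj (by simp; omega), barFace_of_gt (by omega) (by simp; omega),
        barFace_of_gt (by omega) h]
      exact doubleTuple_mk' (l := l + 1) (by omega)

open ClassifyingSpace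

/-- The homotopy from the identity of the classifying space that doubles the slices. -/
def barDouble (x : ClassifyingSpace (SlabMonoid n k)) (v : unitInterval) :
    ClassifyingSpace (SlabMonoid n k) :=
  Quot.lift (fun c : BarCells (SlabMonoid n k) =>
    ClassifyingSpace.mk (doubleWeights c.2.1 v) (doubleTuple c.2.1 c.2.2 v)) (by
    rintro _ _ ⟨p, i, w, m⟩
    change mk (doubleWeights (stdSimplex.map i.succAbove w) v)
      (doubleTuple (stdSimplex.map i.succAbove w) m v) =
        mk (doubleWeights w v) (doubleTuple w (barFace i m) v)
    rw [doubleWeights_map_succAbove, ← doubleTuple_barFace]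
    exact (mk_map_succAbove _ _ _).trans (mk_map_succAbove _ _ _)) x

theorem barDouble_mk (w : stdSimplex ℝ (Fin (p + 1))) (m : Fin p → SlabMonoid n k)
    (v : unitInterval) :
    barDouble (mk w m) v = mk (doubleWeights w v) (doubleTuple w m v) := rfl

theorem continuous_barDouble :
    Continuous fun z : ClassifyingSpace (SlabMonoid n k) × unitInterval => barDouble z.1 z.2 := by
  refine continuous_of_cells fun p => ?_
  simp only [barDouble_mk]
  have h : Continuous fun z : (stdSimplex ℝ (Fin (p + 1)) × (Fin p → SlabMonoid n k)) ×
      unitInterval => (doubleWeights z.1.1 z.2, doubleTuple z.1.1 z.1.2 z.2) := ?_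
  · exact (continuous_mk (M := SlabMonoid n k) (2 * p + 1)).comp h
  have hw : ∀ i, Continuous fun z : (stdSimplex ℝ (Fin (p + 1)) × (Fin p → SlabMonoid n k)) ×
      unitInterval => z.1.1 i := fun i =>
    (continuous_apply i).comp (continuous_subtype_val.comp (continuous_fst.comp continuous_fst))
  have hv : Continuous fun z : (stdSimplex ℝ (Fin (p + 1)) × (Fin p → SlabMonoid n k)) ×
      unitInterval => (z.2 : ℝ) := continuous_subtype_val.comp continuous_snd
  refine Continuous.prodMk ?_ (continuous_pi fun j => ?_)
  · refine (continuous_pi fun j => ?_).subtype_mk _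
    unfold splitWeight
    split_ifs
    · exact (continuous_const.sub (hv.div_const _)).mul (hw _)
    · exact (hv.div_const _).mul (hw _)
  · unfold doubleTuple
    split_ifs
    · exact continuous_emptySlab.comp (hv.mul (hw _))
    · exact (continuous_apply _).comp (continuous_snd.comp continuous_fst)

/-- At time zero the two copies of a slice coincide and the second has weight zero, so the slices of
positive weight are the original ones. -/
theorem barDouble_zero (x : ClassifyingSpace (SlabMonoid n k)) : barDouble x 0 = x := by
  obtain ⟨p, w, m, rfl⟩ := exists_eq_mk x
  have hm := isSlicing_slicePosition m
  have hd : IsSlicing (totalConfig m) (fun j : Fin (2 * p + 1 + 1) =>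
      slicePosition m (half (q := p + 1) j)) := ⟨hm.1.comp half_monotone, fun j => hm.2 _⟩
  have e : doubleTuple w m 0 = segs (totalConfig m) (fun j : Fin (2 * p + 1 + 1) =>
      slicePosition m (half (q := p + 1) j)) := by
    funext ⟨j, hj⟩
    rcases Nat.even_or_odd' j with ⟨l, rfl | rfl⟩
    · rw [doubleTuple_mk (by omega), Set.Icc.coe_zero, zero_mul, emptySlab_zero, segs]
      have : half (q := p + 1) (Fin.castSucc ⟨2 * l, hj⟩) = half (q := p + 1) (Fin.succ ⟨2 * l, hj⟩) := by
        apply Fin.ext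
        simp [half]
        omega
      rw [this, seg_self]
    · rw [doubleTuple_mk' (by omega), segs]
      have e1 : half (q := p + 1) (Fin.castSucc ⟨2 * l + 1, hj⟩) =
          Fin.castSucc ⟨l, by omega⟩ := by
        apply Fin.ext
        simp [half]
        omega
      have e2 : half (q := p + 1) (Fin.succ ⟨2 * l + 1, hj⟩) = Fin.succ ⟨l, by omega⟩ := by
        apply Fin.ext
        simp [half]
        omega
      rw [e1, e2]
      exact (congrFun (segs_totalConfig m) ⟨l, by omega⟩).symm
  have ew : ⇑(doubleWeights w 0) = splitWeight (q := p + 1) 1 0 w := by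
    funext j
    rw [doubleWeights_apply]
    simp
  rw [barDouble_mk, e]
  refine (mk_segs_eq hd hm (w' := w) ?_ fun _ _ _ => Iff.rfl).trans (by rw [segs_totalConfig])
  rw [ew]
  exact slicePart_splitWeight (q := p + 1) w (slicePosition m)

/-- A slice of positive weight yields two slices of positive weight at distance equal to that
weight, so the slices do not all coincide. -/
theorem radius_barDouble_pos (x : ClassifyingSpace (SlabMonoid n k)) : 0 < radius (barDouble x 1) := by
  refine lt_of_le_of_ne (radius_nonneg _) fun h => ?_
  obtain ⟨p, w, m, rfl⟩ := exists_eq_mk x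
  rw [barDouble_mk, radius_mk] at h
  obtain ⟨⟨i, hi⟩, hwi⟩ := stdSimplex_exists_ne_zero w
  have h1 := eq_baryCenter_of_sliceRadius h.symm (i := ⟨2 * i, by omega⟩)
    (by rw [doubleWeights_mk hi]; norm_num; exact hwi)
  have h2 := eq_baryCenter_of_sliceRadius h.symm (i := ⟨2 * i + 1, by omega⟩)
    (by rw [doubleWeights_mk' hi]; norm_num; exact hwi)
  have h3 := slicePosition_succ (doubleTuple w m 1) ⟨2 * i, by omega⟩
  rw [doubleTuple_mk hi, width_emptySlab (by simp)] at h3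
  change slicePosition (doubleTuple w m 1) ⟨2 * i + 1, _⟩ =
    slicePosition (doubleTuple w m 1) ⟨2 * i, _⟩ + _ at h3
  rw [h1, h2] at h3
  simp at h3
  exact hwi h3

end Double

/-! ### Convergence of slicings -/

section SliceTendsto

variable {n : ℕ} {k : Fin n}

theorem tendsto_shift {ι : Type*} {F : Filter ι} {S : ι → ConfigSpace n (k + 1)}
    {S₀ : ConfigSpace n (k + 1)} {τ : ι → ℝ} {τ₀ : ℝ} (hS : Tendsto S F (𝓝 S₀))
    (hτ : Tendsto τ F (𝓝 τ₀)) :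
    Tendsto (fun p => shift (τ p) (S p)) F (𝓝 (shift τ₀ S₀)) :=
  ConfigSpace.tendsto_iff.2 fun _ => (ConfigSpace.tendsto_iff.1 hS _).preimage_translate hτ

/-- Lists of weighted slices converge to a list of weighted slices, such that all of them cut the
given configurations. -/
def SliceTendsto {ι : Type*} (F : Filter ι) (S : ι → ConfigSpace n (k + 1))
    (S₀ : ConfigSpace n (k + 1)) (l : ι → List (ℝ × ℝ)) (l₀ : List (ℝ × ℝ)) : Prop :=
  ∃ (q : ℕ) (v : ι → Fin (q + 1) → ℝ) (v₀ : Fin (q + 1) → ℝ) (a : ι → Fin (q + 1) → ℝ)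
    (a₀ : Fin (q + 1) → ℝ), Tendsto v F (𝓝 v₀) ∧ Tendsto a F (𝓝 a₀) ∧
    (∀ᶠ p in F, v p ∈ stdSimplex ℝ (Fin (q + 1)) ∧ IsSlicing (S p) (a p) ∧
      slicePart (sliceList (v p) (a p)) = slicePart (l p)) ∧
    (v₀ ∈ stdSimplex ℝ (Fin (q + 1)) ∧ IsSlicing S₀ a₀ ∧
      slicePart (sliceList v₀ a₀) = slicePart l₀) ∧
    ∀ y : EuclideanSpace ℝ (Fin n), a₀ 0 ≤ y k → y k ≤ a₀ (Fin.last q) →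
      LocTendsto F (fun p => (S p).1.carrier) S₀.1.carrier y

variable {ι : Type*} {F : Filter ι} {S : ι → ConfigSpace n (k + 1)} {S₀ : ConfigSpace n (k + 1)}
  {l : ι → List (ℝ × ℝ)} {l₀ : List (ℝ × ℝ)}

/-- The number of slices is fixed in the definition of `SliceTendsto`, so the points move
continuously in a single cell; slices of weight zero are kept in the tuple. -/
theorem SliceTendsto.tendsto_slicedPoint (h : SliceTendsto F S S₀ l l₀) :
    Tendsto (fun p => slicedPoint (S p) (l p)) F (𝓝 (slicedPoint S₀ l₀)) := by
  classical
  obtain ⟨q, v, v₀, a, a₀, hv, ha, hp, ⟨h1, h2, h3⟩, hS⟩ := h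
  -- The weights lie in the simplex only eventually; elsewhere the limit serves as a default.
  let v' : ι → stdSimplex ℝ (Fin (q + 1)) := fun p =>
    if h : v p ∈ stdSimplex ℝ (Fin (q + 1)) then ⟨v p, h⟩ else ⟨v₀, h1⟩
  have hv' : Tendsto v' F (𝓝 ⟨v₀, h1⟩) := by
    refine tendsto_subtype_rng.2 (hv.congr' ?_)
    filter_upwards [hp] with p hp
    simp only [v', dif_pos hp.1]
  have e₀ : slicedPoint S₀ l₀ = ClassifyingSpace.mk ⟨v₀, h1⟩ (segs S₀ a₀) :=
    slicedPoint_eq h2 h2 h3 fun _ _ _ => Iff.rfl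
  have hseg : Tendsto (fun p => segs (S p) (a p)) F (𝓝 (segs S₀ a₀)) := by
    refine tendsto_pi_nhds.2 fun j => tendsto_seg (fun y hy hy' => hS y ?_ ?_)
      (tendsto_pi_nhds.1 ha _) (tendsto_pi_nhds.1 ha _) (h2.2 _) (h2.2 _)
    · exact (h2.1 (Fin.zero_le _)).trans hy
    · exact hy'.trans (h2.1 (Fin.le_last _))
  rw [e₀]
  refine (((ClassifyingSpace.continuous_mk (M := SlabMonoid n k) q).tendsto
    (⟨v₀, h1⟩, segs S₀ a₀)).comp (hv'.prodMk_nhds hseg)).congr' ?_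
  filter_upwards [hp] with p hp
  have : v' p = ⟨v p, hp.1⟩ := dif_pos hp.1
  simp only [Function.comp_apply, this]
  exact (slicedPoint_eq hp.2.1 hp.2.1 hp.2.2 fun _ _ _ => Iff.rfl).symm

theorem SliceTendsto.tendsto_sliceCenter (h : SliceTendsto F S S₀ l l₀) :
    Tendsto (fun p => sliceCenter (l p)) F (𝓝 (sliceCenter l₀)) := by
  obtain ⟨q, v, v₀, a, a₀, hv, ha, hp, ⟨h1, h2, h3⟩, hS⟩ := h
  rw [← sliceCenter_congr h3, sliceCenter_sliceList]
  have : Tendsto (fun p => baryCenter (v p) (a p)) F (𝓝 (baryCenter v₀ a₀)) :=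
    tendsto_finsetSum _ fun i _ => (tendsto_pi_nhds.1 hv i).mul (tendsto_pi_nhds.1 ha i)
  refine this.congr' ?_
  filter_upwards [hp] with p hp
  rw [← sliceCenter_congr hp.2.2, sliceCenter_sliceList]

theorem SliceTendsto.tendsto_sliceRadius (h : SliceTendsto F S S₀ l l₀) :
    Tendsto (fun p => sliceRadius (l p)) F (𝓝 (sliceRadius l₀)) := by
  have hc := h.tendsto_sliceCenter
  obtain ⟨q, v, v₀, a, a₀, hv, ha, hp, ⟨h1, h2, h3⟩, hS⟩ := h
  rw [← sliceCenter_congr h3, sliceCenter_sliceList] at hc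
  rw [← sliceRadius_congr h3, sliceRadius_sliceList]
  have : Tendsto (fun p => (∑ i, v p i * |a p i - sliceCenter (l p)|) / 2) F
      (𝓝 ((∑ i, v₀ i * |a₀ i - baryCenter v₀ a₀|) / 2)) :=
    (tendsto_finsetSum _ fun i _ => (tendsto_pi_nhds.1 hv i).mul
      ((tendsto_pi_nhds.1 ha i).sub hc).abs).div_const _
  refine this.congr' ?_
  filter_upwards [hp] with p hp
  rw [← sliceRadius_congr hp.2.2, sliceRadius_sliceList, ← sliceCenter_congr hp.2.2,
    sliceCenter_sliceList]

theorem SliceTendsto.sliceRadius_nonneg (h : SliceTendsto F S S₀ l l₀) : 0 ≤ sliceRadius l₀ := by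
  obtain ⟨q, v, v₀, a, a₀, hv, ha, hp, ⟨h1, h2, h3⟩, hS⟩ := h
  rw [← sliceRadius_congr h3]
  exact sliceRadius_sliceList_nonneg ⟨v₀, h1⟩ a₀

theorem SliceTendsto.ne_sliceCenter (h : SliceTendsto F S S₀ l l₀) (h0 : sliceRadius l₀ = 0) :
    ∀ x ∈ S₀.1.carrier, x k ≠ sliceCenter l₀ := by
  obtain ⟨q, v, v₀, a, a₀, hv, ha, hp, ⟨h1, h2, h3⟩, hS⟩ := h
  rw [← sliceRadius_congr h3] at h0
  rw [← sliceCenter_congr h3, sliceCenter_sliceList]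
  obtain ⟨i, hi⟩ := stdSimplex_exists_ne_zero ⟨v₀, h1⟩
  have e : a₀ i = baryCenter v₀ a₀ := eq_baryCenter_of_sliceRadius (w := ⟨v₀, h1⟩) h0 hi
  rw [← e]
  exact h2.2 i

/-- A configuration is cut by a list of weighted slices. -/
def Sliceable (S : ConfigSpace n (k + 1)) (l : List (ℝ × ℝ)) : Prop :=
  ∃ (q : ℕ) (v : stdSimplex ℝ (Fin (q + 1))) (a : Fin (q + 1) → ℝ), IsSlicing S a ∧
    slicePart (sliceList v a) = slicePart l

theorem SliceTendsto.sliceable (h : SliceTendsto F S S₀ l l₀) : Sliceable S₀ l₀ := by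
  obtain ⟨q, v, v₀, a, a₀, hv, ha, hp, ⟨h1, h2, h3⟩, hS⟩ := h
  exact ⟨q, ⟨v₀, h1⟩, a₀, h2, h3⟩

theorem SliceTendsto.eventually_sliceable (h : SliceTendsto F S S₀ l l₀) :
    ∀ᶠ p in F, Sliceable (S p) (l p) := by
  obtain ⟨q, v, v₀, a, a₀, hv, ha, hp, -, hS⟩ := h
  filter_upwards [hp] with p hp
  exact ⟨q, ⟨v p, hp.1⟩, a p, hp.2.1, hp.2.2⟩

theorem Sliceable.scan_slicedPoint (φ : ℝ ≃ₜ Set.Ioo (-1 : ℝ) 1) {S : ConfigSpace n (k + 1)}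
    {l : List (ℝ × ℝ)} (h : Sliceable S l) :
    scan φ (slicedPoint S l) = pull φ S (sliceCenter l) (sliceRadius l) := by
  obtain ⟨q, v, a, h2, h3⟩ := h
  exact _root_.scan_slicedPoint h2 h3

variable (φ : ℝ ≃ₜ Set.Ioo (-1 : ℝ) 1)

/-- Stretching the slab with center and radius between those of a symmetric slab and those of a
list of slices. -/
def interpolate (S : ConfigSpace n (k + 1)) (δ : ℝ) (l : List (ℝ × ℝ)) (v : ℝ) :
    ConfigSpace n (k + 1) :=
  pull φ S (v * sliceCenter l) ((1 - v) * δ + v * sliceRadius l)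

variable {φ}

theorem interpolate_zero (S : ConfigSpace n (k + 1)) (δ : ℝ) (l : List (ℝ × ℝ)) :
    interpolate φ S δ l 0 = pull φ S 0 δ := by
  simp [interpolate]

theorem interpolate_one (S : ConfigSpace n (k + 1)) (δ : ℝ) (l : List (ℝ × ℝ)) :
    interpolate φ S δ l 1 = pull φ S (sliceCenter l) (sliceRadius l) := by
  simp [interpolate]

theorem interpolate_congr (S : ConfigSpace n (k + 1)) (δ : ℝ) {l l' : List (ℝ × ℝ)}
    (h : slicePart l = slicePart l') (v : ℝ) :
    interpolate φ S δ l v = interpolate φ S δ l' v := by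
  rw [interpolate, interpolate, sliceCenter_congr h, sliceRadius_congr h]

/-- Since `δ₀ > 0`, the interpolated radius vanishes in the limit only for `v₀ = 1` and list radius
zero. Then the center is the position of a slice and is missed by `S₀`. -/
theorem SliceTendsto.tendsto_interpolate (h : SliceTendsto F S S₀ l l₀) {δ v : ι → ℝ} {δ₀ v₀ : ℝ}
    (hδ : Tendsto δ F (𝓝 δ₀)) (hv : Tendsto v F (𝓝 v₀)) (hδ₀ : 0 < δ₀) (hv₀ : v₀ ∈ Icc (0 : ℝ) 1)
    (hS : ∀ y, LocTendsto F (fun p => (S p).1.carrier) S₀.1.carrier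
      (axisMap k (fun t => v₀ * sliceCenter l₀ +
        ((1 - v₀) * δ₀ + v₀ * sliceRadius l₀) * (φ t : ℝ)) y)) :
    Tendsto (fun p => interpolate φ (S p) (δ p) (l p) (v p)) F
      (𝓝 (interpolate φ S₀ δ₀ l₀ v₀)) := by
  refine tendsto_pull hS (hv.mul h.tendsto_sliceCenter)
    (((tendsto_const_nhds.sub hv).mul hδ).add (hv.mul h.tendsto_sliceRadius)) fun h0 => ?_
  have hr := h.sliceRadius_nonneg
  have h1 : (1 - v₀) * δ₀ = 0 := by
    have h2 := mul_nonneg hv₀.1 hr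
    have h3 := mul_nonneg (sub_nonneg.2 hv₀.2) hδ₀.le
    linarith
  obtain rfl : v₀ = 1 := by
    rcases mul_eq_zero.1 h1 with h | h
    · linarith
    · exact absurd h hδ₀.ne'
  rw [one_mul]
  exact h.ne_sliceCenter (by simpa using h0)

end SliceTendsto

/-! ### Moving the slices to the right and replacing them by given ones -/

/-- Multiplying the weights of the slices by a function of their position. -/
def reweight (g : ℝ → ℝ) (l : List (ℝ × ℝ)) : List (ℝ × ℝ) := l.map fun z => (z.1, z.2 * g z.1)

section Reweight

theorem reweight_sliceList {p : ℕ} (g : ℝ → ℝ) (w a : Fin p → ℝ) :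
    reweight g (sliceList w a) = sliceList (fun i => w i * g (a i)) a := by
  simp only [reweight, sliceList, List.map_ofFn]
  rfl

theorem slicePart_reweight_slicePart (g : ℝ → ℝ) (l : List (ℝ × ℝ)) :
    slicePart (reweight g (slicePart l)) = slicePart (reweight g l) := by
  induction l with
  | nil => rfl
  | cons z l ih =>
    have e : ∀ z l, reweight g (z :: l) = (z.1, z.2 * g z.1) :: reweight g l := fun _ _ => rfl
    rw [slicePart_cons]
    split_ifs with h
    · rw [ih, e, slicePart_cons, if_pos (by simp [h])]
    · rw [e, e, slicePart_cons, slicePart_cons, ih]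

theorem reweight_one (l : List (ℝ × ℝ)) : reweight (fun _ => 1) l = l := by
  simp [reweight]

theorem slicePart_reweight_zero (l : List (ℝ × ℝ)) : slicePart (reweight (fun _ => 0) l) = [] :=
  slicePart_eq_nil fun z hz => by
    obtain ⟨z', -, rfl⟩ := List.mem_map.1 hz
    simp

theorem exists_of_mem_reweight {g : ℝ → ℝ} {l : List (ℝ × ℝ)} {z : ℝ × ℝ} (h : z ∈ reweight g l) :
    ∃ y ∈ l, y.1 = z.1 := by
  obtain ⟨z', hz', rfl⟩ := List.mem_map.1 h
  exact ⟨z', hz', rfl⟩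

theorem slicesWithin_reweight (g : ℝ → ℝ) (l : List (ℝ × ℝ)) :
    SlicesWithin (slicePart (reweight g l)) l := by
  intro z hz
  obtain ⟨y, hy, h⟩ := exists_of_mem_reweight (mem_slicePart.1 hz).1
  exact ⟨⟨y, hy, h.le⟩, ⟨y, hy, h.ge⟩⟩

theorem sliceList_append {p q : ℕ} (w a : Fin p → ℝ) (w' a' : Fin q → ℝ) :
    sliceList (Fin.append w w') (Fin.append a a') = sliceList w a ++ sliceList w' a' := by
  have : (fun i => (Fin.append a a' i, Fin.append w w' i)) =
      Fin.append (fun i => (a i, w i)) fun i => (a' i, w' i) := by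
    funext i
    refine Fin.addCases (fun i => ?_) (fun i => ?_) i <;> simp
  rw [sliceList, this, List.ofFn_fin_append]
  rfl

theorem Fin.append_monotone {p q : ℕ} {a : Fin p → ℝ} {a' : Fin q → ℝ} (ha : Monotone a)
    (ha' : Monotone a') (h : ∀ i j, a i ≤ a' j) : Monotone (Fin.append a a') := by
  intro i j
  refine Fin.addCases (fun i => ?_) (fun i => ?_) i <;>
    refine Fin.addCases (fun j => ?_) (fun j => ?_) j
  · intro hij
    simpa using ha (show i ≤ j from hij)
  · intro _
    simpa using h i j
  · intro hij
    rw [Fin.le_def] at hij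
    simp at hij
    omega
  · intro hij
    have : i ≤ j := by
      rw [Fin.le_def] at hij ⊢
      simpa using hij
    simpa using ha' this

end Reweight

section Moves

variable {n : ℕ} {k : Fin n}

open ClassifyingSpace

/-- The mean distance by which the slices exceed the radius. -/
def excess (x : ClassifyingSpace (SlabMonoid n k)) : ℝ :=
  sliceSum (fun t => max (t - radius x) 0) (datum x).2

/-- The factor for the weights that moves all slices to the right of the radius. -/
def tailFactor (x : ClassifyingSpace (SlabMonoid n k)) (t : ℝ) : ℝ :=
  max (t - radius x) 0 / excess x

/-- Moving the slices to the right of the radius. -/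
def tailMove (x : ClassifyingSpace (SlabMonoid n k)) (u : ℝ) : List (ℝ × ℝ) :=
  reweight (fun t => 1 - u + u * tailFactor x t) (datum x).2

/-- Replacing slices to the right of the radius by slices between the barycenters. -/
def innerMove (x : ClassifyingSpace (SlabMonoid n k)) {N : ℕ} (r μ : Fin (N + 1) → ℝ) (u : ℝ) :
    List (ℝ × ℝ) :=
  sliceList (fun j => u * μ j) (fun j => radius x * r j) ++
    reweight (fun t => (1 - u) * tailFactor x t) (datum x).2

theorem tailMove_zero (x : ClassifyingSpace (SlabMonoid n k)) : tailMove x 0 = (datum x).2 := by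
  simp [tailMove, reweight_one]

theorem slicePart_innerMove_zero (x : ClassifyingSpace (SlabMonoid n k)) {N : ℕ}
    (r μ : Fin (N + 1) → ℝ) : slicePart (innerMove x r μ 0) = slicePart (tailMove x 1) := by
  rw [innerMove, slicePart_append, slicePart_eq_nil, List.nil_append, tailMove]
  · simp
  · intro z hz
    obtain ⟨j, rfl⟩ := mem_sliceList.1 hz
    simp

theorem slicePart_innerMove_one (x : ClassifyingSpace (SlabMonoid n k)) {N : ℕ}
    (r μ : Fin (N + 1) → ℝ) :
    slicePart (innerMove x r μ 1) = slicePart (sliceList μ fun j => radius x * r j) := by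
  rw [innerMove, slicePart_append]
  simp [slicePart_reweight_zero]

theorem slicePart_innerMove_congr (x : ClassifyingSpace (SlabMonoid n k)) {N : ℕ}
    {r r' μ : Fin (N + 1) → ℝ} (h : ∀ j, μ j ≠ 0 → r j = r' j) (u : ℝ) :
    slicePart (innerMove x r μ u) = slicePart (innerMove x r' μ u) := by
  rw [innerMove, innerMove, slicePart_append, slicePart_append]
  congr 1
  exact slicePart_sliceList_congr fun j hj => by rw [h j (right_ne_zero_of_mul hj)]

theorem excess_mk {p : ℕ} (w : stdSimplex ℝ (Fin (p + 1))) (m : Fin p → SlabMonoid n k) :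
    excess (mk w m) = ∑ i, w i * max (slicePosition m i - baryCenter w (slicePosition m) -
      radius (mk w m)) 0 := by
  rw [excess, datum_mk_snd, sliceSum_slicePart, sliceSum_sliceList]

/-- The upper barycenter is the mean of `max (a i) b`. If no slice of positive weight exceeded it,
all these maxima would equal it; being larger than `b`, it would be the common position of all
slices, contradicting that their mean is `b`. -/
theorem excess_pos {x : ClassifyingSpace (SlabMonoid n k)} (h : 0 < radius x) : 0 < excess x := by
  obtain ⟨p, w, m, rfl⟩ := exists_eq_mk x
  rw [excess_mk]
  have hnn : ∀ i ∈ Finset.univ, 0 ≤ w i * max (slicePosition m i -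
      baryCenter w (slicePosition m) - radius (mk w m)) 0 := fun i _ =>
    mul_nonneg (stdSimplex.zero_le w i) (le_max_right _ _)
  refine lt_of_le_of_ne (Finset.sum_nonneg hnn) fun h0 => ?_
  rw [eq_comm, Finset.sum_eq_zero_iff_of_nonneg hnn] at h0
  have hle : ∀ i, w i ≠ 0 →
      slicePosition m i - baryCenter w (slicePosition m) ≤ radius (mk w m) := by
    intro i hi
    have := (mul_eq_zero.1 (h0 i (Finset.mem_univ i))).resolve_left hi
    have := le_max_left (slicePosition m i - baryCenter w (slicePosition m) - radius (mk w m)) 0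
    linarith
  set b := baryCenter w (slicePosition m) with hb
  set δ := radius (mk w m) with hδ
  have h2 : ∑ i, w i * |slicePosition m i - b| = 2 * δ := by
    have := radius_mk w m
    rw [sliceRadius_sliceList] at this
    rw [hδ, this]
    ring
  have h3 : ∑ i, w i * (slicePosition m i - b) = 0 := sum_mul_sub_baryCenter w _
  -- The positive parts of the deviations average to `δ`; each is at most `δ` by `hle`, so each of
  -- positive weight equals `δ`.
  have h4 : ∑ i, w i * (δ - (|slicePosition m i - b| + (slicePosition m i - b)) / 2) = 0 := by
    have e : ∀ i, w i * (δ - (|slicePosition m i - b| + (slicePosition m i - b)) / 2) =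
        w i * δ - w i * |slicePosition m i - b| / 2 - w i * (slicePosition m i - b) / 2 := by
      intro i
      ring
    simp only [e, Finset.sum_sub_distrib, ← Finset.sum_mul, ← Finset.sum_div, h2, h3,
      stdSimplex.sum_eq_one]
    ring
  have h5 : ∀ i, w i ≠ 0 → slicePosition m i - b = δ := by
    have hnn' : ∀ i ∈ Finset.univ,
        0 ≤ w i * (δ - (|slicePosition m i - b| + (slicePosition m i - b)) / 2) := by
      intro i _
      by_cases hi : w i = 0
      · simp [hi]
      refine mul_nonneg (stdSimplex.zero_le w i) ?_
      have := hle i hi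
      rcases abs_cases (slicePosition m i - b) with h | h <;> linarith [h.1]
    rw [Finset.sum_eq_zero_iff_of_nonneg hnn'] at h4
    intro i hi
    have := (mul_eq_zero.1 (h4 i (Finset.mem_univ i))).resolve_left hi
    rcases abs_cases (slicePosition m i - b) with h | h <;> linarith [h.1]
  have h6 : δ ≤ ∑ i, w i * (slicePosition m i - b) := le_sum_mul_of_forall fun i hi => (h5 i hi).ge
  linarith

theorem slicesWithin_tailMove (x : ClassifyingSpace (SlabMonoid n k)) (u : ℝ) :
    SlicesWithin (slicePart (tailMove x u)) (datum x).2 := slicesWithin_reweight _ _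

/-- The new slices lie between the two barycenters, hence between the extreme old slices. -/
theorem slicesWithin_innerMove (x : ClassifyingSpace (SlabMonoid n k)) {N : ℕ}
    {r : Fin (N + 1) → ℝ} (hr : ∀ j, r j ∈ Ioo (-1 : ℝ) 1) (μ : Fin (N + 1) → ℝ) (u : ℝ) :
    SlicesWithin (slicePart (innerMove x r μ u)) (datum x).2 := by
  intro z hz
  rw [innerMove, slicePart_append, List.mem_append] at hz
  rcases hz with hz | hz
  · obtain ⟨j, rfl⟩ := mem_sliceList.1 (mem_slicePart.1 hz).1
    obtain ⟨y, hy, hy'⟩ := exists_le_neg_radius x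
    obtain ⟨y', hy2, hy2'⟩ := exists_radius_le x
    have h0 := radius_nonneg x
    exact ⟨⟨y, hy, by nlinarith [(hr j).1]⟩, ⟨y', hy2, by nlinarith [(hr j).2]⟩⟩
  · exact slicesWithin_reweight _ _ z hz

/-- The configuration of a tuple, with the barycenter of the slices at the origin. -/
def centered {p : ℕ} (w : stdSimplex ℝ (Fin (p + 1))) (m : Fin p → SlabMonoid n k) :
    ConfigSpace n (k + 1) := shift (baryCenter w (slicePosition m)) (totalConfig m)

/-- The configuration in `datum` jumps when the weight of an extreme slice tends to zero. For slices
inside the extreme ones it may be replaced by `centered w m`, which varies continuously over the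
cell. -/
theorem Sliceable.slicedPoint_datum {l : List (ℝ × ℝ)} {p : ℕ}
    {w : stdSimplex ℝ (Fin (p + 1))} {m : Fin p → SlabMonoid n k}
    (h : Sliceable (centered w m) l) (hw : SlicesWithin (slicePart l) (datum (mk w m)).2) :
    slicedPoint (datum (mk w m)).1 l = slicedPoint (centered w m) l := by
  obtain ⟨q, v, a, h2, h3⟩ := h
  rw [slicedPoint_eq h2 h2 h3 fun _ _ _ => Iff.rfl]
  exact slicedPoint_eq h2 (h2.of_subset (datum_fst_subset w m)) h3
    (hw.agreeBetween (agreeBetween_cutBetween _ _))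

end Moves

/-! ### Continuity of the two moves of slices on a cell -/

section Moves

variable {n : ℕ} {k : Fin n}

open ClassifyingSpace

theorem tailFactor_nonneg (x : ClassifyingSpace (SlabMonoid n k)) (t : ℝ) : 0 ≤ tailFactor x t := by
  refine div_nonneg (le_max_right _ _) ?_
  obtain ⟨p, w, m, rfl⟩ := exists_eq_mk x
  rw [excess_mk]
  exact Finset.sum_nonneg fun i _ => mul_nonneg (stdSimplex.zero_le w i) (le_max_right _ _)

theorem tailFactor_of_le {x : ClassifyingSpace (SlabMonoid n k)} {t : ℝ} (h : t ≤ radius x) :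
    tailFactor x t = 0 := by
  rw [tailFactor, max_eq_right (by linarith), zero_div]

theorem sum_mul_tailFactor {p : ℕ} {w : stdSimplex ℝ (Fin (p + 1))} {m : Fin p → SlabMonoid n k}
    (h : 0 < radius (mk w m)) :
    ∑ i, w i * tailFactor (mk w m) (slicePosition m i - baryCenter w (slicePosition m)) = 1 := by
  have h0 := (excess_pos h).ne'
  simp only [tailFactor, ← mul_div_assoc, ← Finset.sum_div]
  rw [← excess_mk, div_self h0]

theorem isSlicing_centered {p : ℕ} (w : stdSimplex ℝ (Fin (p + 1))) (m : Fin p → SlabMonoid n k) :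
    IsSlicing (centered w m) fun i => slicePosition m i - baryCenter w (slicePosition m) :=
  (isSlicing_slicePosition m).shift _

theorem slicePart_reweight_datum {p : ℕ} (g : ℝ → ℝ) (w : stdSimplex ℝ (Fin (p + 1)))
    (m : Fin p → SlabMonoid n k) : slicePart (reweight g (datum (mk w m)).2) =
      slicePart (sliceList (fun i => w i * g (slicePosition m i - baryCenter w (slicePosition m)))
        fun i => slicePosition m i - baryCenter w (slicePosition m)) := by
  rw [datum_mk_snd, slicePart_reweight_slicePart, reweight_sliceList]

variable {ι : Type*} {F : Filter ι} {p : ℕ} {w : ι → stdSimplex ℝ (Fin (p + 1))}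
  {w₀ : stdSimplex ℝ (Fin (p + 1))} {m : ι → Fin p → SlabMonoid n k} {m₀ : Fin p → SlabMonoid n k}

theorem tendsto_position (hw : Tendsto w F (𝓝 w₀)) (hm : Tendsto m F (𝓝 m₀)) (i : Fin (p + 1)) :
    Tendsto (fun t => slicePosition (m t) i - baryCenter (w t) (slicePosition (m t))) F
      (𝓝 (slicePosition m₀ i - baryCenter w₀ (slicePosition m₀))) :=
  (((continuous_slicePosition i).tendsto m₀).comp hm).sub
    ((continuous_baryCenter.tendsto (w₀, m₀)).comp (hw.prodMk_nhds hm))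

theorem tendsto_centered (hw : Tendsto w F (𝓝 w₀)) (hm : Tendsto m F (𝓝 m₀)) :
    Tendsto (fun t => centered (w t) (m t)) F (𝓝 (centered w₀ m₀)) :=
  tendsto_shift ((continuous_totalConfig.tendsto m₀).comp hm)
    ((continuous_baryCenter.tendsto (w₀, m₀)).comp (hw.prodMk_nhds hm))

theorem tendsto_radius_mk (hw : Tendsto w F (𝓝 w₀)) (hm : Tendsto m F (𝓝 m₀)) :
    Tendsto (fun t => radius (mk (w t) (m t))) F (𝓝 (radius (mk w₀ m₀))) := by

  have h1 : Continuous fun z : stdSimplex ℝ (Fin (p + 1)) × (Fin p → SlabMonoid n k) =>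
      radius (mk z.1 z.2) := continuous_radius.comp (continuous_mk (M := SlabMonoid n k) p)
  have h2 := (h1.tendsto (w₀, m₀)).comp (hw.prodMk_nhds hm)
  simpa only [Function.comp_def] using h2

theorem tendsto_weight (hw : Tendsto w F (𝓝 w₀)) (i : Fin (p + 1)) :
    Tendsto (fun t => w t i) F (𝓝 (w₀ i)) :=
  tendsto_pi_nhds.1 (tendsto_subtype_rng.1 hw) i

theorem tendsto_tailFactor (hw : Tendsto w F (𝓝 w₀)) (hm : Tendsto m F (𝓝 m₀))
    (h0 : 0 < radius (mk w₀ m₀)) (i : Fin (p + 1)) :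
    Tendsto (fun t => tailFactor (mk (w t) (m t))
      (slicePosition (m t) i - baryCenter (w t) (slicePosition (m t)))) F
      (𝓝 (tailFactor (mk w₀ m₀) (slicePosition m₀ i - baryCenter w₀ (slicePosition m₀)))) := by
  refine Tendsto.div (((tendsto_position hw hm i).sub (tendsto_radius_mk hw hm)).max
    tendsto_const_nhds) ?_ (excess_pos h0).ne'
  simp only [excess_mk]
  exact tendsto_finsetSum _ fun j _ => (tendsto_weight hw j).mul
    (((tendsto_position hw hm j).sub (tendsto_radius_mk hw hm)).max tendsto_const_nhds)

/-- The positions are those of the cell and only the weights change. They sum to `1` because the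
tail factors have weighted mean `1`. -/
theorem sliceTendsto_tailMove (hw : Tendsto w F (𝓝 w₀)) (hm : Tendsto m F (𝓝 m₀))
    (h0 : 0 < radius (mk w₀ m₀)) {u : ι → unitInterval} {u₀ : unitInterval}
    (hu : Tendsto u F (𝓝 u₀)) :
    SliceTendsto F (fun t => centered (w t) (m t)) (centered w₀ m₀)
      (fun t => tailMove (mk (w t) (m t)) (u t)) (tailMove (mk w₀ m₀) u₀) := by
  have hu' : Tendsto (fun t => (u t : ℝ)) F (𝓝 u₀) := tendsto_subtype_rng.1 hu
  have key : ∀ (w : stdSimplex ℝ (Fin (p + 1))) (m : Fin p → SlabMonoid n k) (u : unitInterval),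
      0 < radius (mk w m) → (fun i => w i * (1 - (u : ℝ) + u * tailFactor (mk w m)
        (slicePosition m i - baryCenter w (slicePosition m)))) ∈ stdSimplex ℝ (Fin (p + 1)) := by
    intro w m u h
    refine ⟨fun i => mul_nonneg (stdSimplex.zero_le w i) (add_nonneg (by linarith [u.2.2])
      (mul_nonneg u.2.1 (tailFactor_nonneg _ _))), ?_⟩
    simp only [mul_add, Finset.sum_add_distrib, ← Finset.sum_mul, stdSimplex.sum_eq_one,
      mul_left_comm _ (u : ℝ), ← Finset.mul_sum, sum_mul_tailFactor h]
    ring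
  refine ⟨p, fun t i => w t i * (1 - u t + u t * tailFactor (mk (w t) (m t))
    (slicePosition (m t) i - baryCenter (w t) (slicePosition (m t)))), _, fun t i =>
    slicePosition (m t) i - baryCenter (w t) (slicePosition (m t)), _, ?_, ?_, ?_,
    ⟨key w₀ m₀ u₀ h0, isSlicing_centered w₀ m₀, (slicePart_reweight_datum (fun t => 1 - (u₀ : ℝ) + u₀ * tailFactor (mk w₀ m₀) t) _ _).symm⟩,
    fun y _ _ => ConfigSpace.tendsto_iff.1 (tendsto_centered hw hm) y⟩
  · exact tendsto_pi_nhds.2 fun i => (tendsto_weight hw i).mul ((tendsto_const_nhds.sub hu').add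
      (hu'.mul (tendsto_tailFactor hw hm h0 i)))
  · exact tendsto_pi_nhds.2 fun i => tendsto_position hw hm i
  · filter_upwards [(tendsto_radius_mk hw hm).eventually_const_lt h0] with t ht
    exact ⟨key _ _ _ ht, isSlicing_centered _ _, (slicePart_reweight_datum
      (fun s => 1 - (u t : ℝ) + u t * tailFactor (mk (w t) (m t)) s) _ _).symm⟩

/-- New slices are listed before old ones. To keep the list monotone, the old slices below index `s`
are moved up to slice `s`; they may be moved because their tail weights vanish at the limit and
nearby. -/
theorem sliceTendsto_innerMove (hw : Tendsto w F (𝓝 w₀)) (hm : Tendsto m F (𝓝 m₀))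
    (h0 : 0 < radius (mk w₀ m₀)) {u : ι → unitInterval} {u₀ : unitInterval}
    (hu : Tendsto u F (𝓝 u₀)) {N : ℕ} {μ : ι → stdSimplex ℝ (Fin (N + 1))}
    {μ₀ : stdSimplex ℝ (Fin (N + 1))} (hμ : Tendsto μ F (𝓝 μ₀)) {r : Fin (N + 1) → ℝ}
    (hr : Monotone r) (hr1 : ∀ j, r j ∈ Ioo (-1 : ℝ) 1)
    (hS : ∀ᶠ t in F, ∀ j, ∀ x ∈ (centered (w t) (m t)).1.carrier,
      x k ≠ radius (mk (w t) (m t)) * r j)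
    (hS₀ : ∀ j, ∀ x ∈ (centered w₀ m₀).1.carrier, x k ≠ radius (mk w₀ m₀) * r j) :
    SliceTendsto F (fun t => centered (w t) (m t)) (centered w₀ m₀)
      (fun t => innerMove (mk (w t) (m t)) r (μ t) (u t)) (innerMove (mk w₀ m₀) r μ₀ u₀) := by
  have hu' : Tendsto (fun t => (u t : ℝ)) F (𝓝 u₀) := tendsto_subtype_rng.1 hu
  have hδ := tendsto_radius_mk hw hm
  obtain ⟨i₁, -, hi₁⟩ := exists_upper_le w₀ (slicePosition m₀)
  have hne : ({i | radius (mk w₀ m₀) ≤ slicePosition m₀ i - baryCenter w₀ (slicePosition m₀)} :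
      Finset (Fin (p + 1))).Nonempty := by
    refine ⟨i₁, ?_⟩
    rw [radius_mk]
    simp only [Finset.mem_filter, Finset.mem_univ, true_and]
    linarith
  -- The first slice at or above the upper barycenter, at the limit. Earlier slices are strictly
  -- below it, which persists nearby, while the new slices stay strictly below slice `s`.
  obtain ⟨s, hs⟩ : ∃ s, s = Finset.min' _ hne := ⟨_, rfl⟩
  have hs1 : radius (mk w₀ m₀) ≤ slicePosition m₀ s - baryCenter w₀ (slicePosition m₀) := by
    have := Finset.min'_mem _ hne
    rw [← hs] at this
    simpa using this
  have hs2 : ∀ i < s, slicePosition m₀ i - baryCenter w₀ (slicePosition m₀) <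
      radius (mk w₀ m₀) := by
    intro i hi
    by_contra! h
    have := Finset.min'_le {i | radius (mk w₀ m₀) ≤
      slicePosition m₀ i - baryCenter w₀ (slicePosition m₀)} i (by simpa using h)
    rw [← hs] at this
    exact absurd this (not_le.2 hi)
  -- the weights form a point of the simplex
  have key : ∀ (w : stdSimplex ℝ (Fin (p + 1))) (m : Fin p → SlabMonoid n k) (u : unitInterval)
      (μ : stdSimplex ℝ (Fin (N + 1))), 0 < radius (mk w m) →
      (Fin.append (m := N + 1) (n := p + 1) (fun j => (u : ℝ) * μ j) fun i => w i * ((1 - (u : ℝ)) * tailFactor (mk w m)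
        (slicePosition m i - baryCenter w (slicePosition m)))) ∈
        stdSimplex ℝ (Fin ((N + 1 + p) + 1)) := by
    intro w m u μ h
    refine ⟨fun i => ?_, ?_⟩
    · refine Fin.addCases (m := N + 1) (n := p + 1) (fun i => ?_) (fun i => ?_) i
      · rw [Fin.append_left]
        exact mul_nonneg u.2.1 (stdSimplex.zero_le μ i)
      · rw [Fin.append_right]
        exact mul_nonneg (stdSimplex.zero_le w i) (mul_nonneg (by linarith [u.2.2])
          (tailFactor_nonneg _ _))
    · refine (Fin.sum_univ_add (a := N + 1) (b := p + 1) _).trans ?_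
      simp only [Fin.append_left, Fin.append_right, ← Finset.mul_sum, mul_left_comm _ (1 - (u : ℝ)),
        stdSimplex.sum_eq_one, sum_mul_tailFactor h]
      ring
  -- the positions cut the configuration
  have key2 : ∀ (w : stdSimplex ℝ (Fin (p + 1))) (m : Fin p → SlabMonoid n k),
      (∀ j, ∀ x ∈ (centered w m).1.carrier, x k ≠ radius (mk w m) * r j) →
      (∀ j, radius (mk w m) * r j < slicePosition m s - baryCenter w (slicePosition m)) →
      IsSlicing (p := N + 1 + p) (centered w m) (Fin.append (m := N + 1) (n := p + 1) (fun j => radius (mk w m) * r j)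
        fun i => slicePosition m (max i s) - baryCenter w (slicePosition m)) := by
    intro w m h1 h2
    have h3 := isSlicing_centered w m
    refine ⟨Fin.append_monotone (hr.const_mul (radius_nonneg _)) ?_ ?_, fun i => ?_⟩
    · exact fun i j hij => h3.1 (max_le_max hij le_rfl)
    · exact fun i j => (h2 i).le.trans (h3.1 (le_max_right _ _))
    · refine Fin.addCases (m := N + 1) (n := p + 1) (fun i => ?_) (fun i => ?_) i
      · rw [Fin.append_left]
        exact h1 i
      · rw [Fin.append_right]
        exact h3.2 _
  -- the slices with positive weight are the right ones
  have key3 : ∀ (w : stdSimplex ℝ (Fin (p + 1))) (m : Fin p → SlabMonoid n k) (u : unitInterval)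
      (μ : stdSimplex ℝ (Fin (N + 1))),
      (∀ i < s, slicePosition m i - baryCenter w (slicePosition m) < radius (mk w m)) →
      slicePart (sliceList (p := N + 1 + p + 1)
        (Fin.append (m := N + 1) (n := p + 1) (fun j => (u : ℝ) * μ j) fun i => w i * ((1 - (u : ℝ)) * tailFactor (mk w m)
          (slicePosition m i - baryCenter w (slicePosition m))))
        (Fin.append (m := N + 1) (n := p + 1) (fun j => radius (mk w m) * r j)
          fun i => slicePosition m (max i s) - baryCenter w (slicePosition m))) =
        slicePart (innerMove (mk w m) r μ u) := by
    intro w m u μ h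
    refine (congrArg slicePart (sliceList_append _ _ _ _)).trans ?_
    rw [slicePart_append, innerMove, slicePart_append, slicePart_reweight_datum]
    congr 1
    refine slicePart_sliceList_congr fun i hi => ?_
    rcases lt_or_ge i s with his | his
    · exact absurd (by rw [tailFactor_of_le (h i his).le]; simp) hi
    · rw [max_eq_left his]
  have hlt : ∀ j, radius (mk w₀ m₀) * r j <
      slicePosition m₀ s - baryCenter w₀ (slicePosition m₀) := by
    intro j
    nlinarith [(hr1 j).2]
  refine ⟨N + 1 + p, fun t => Fin.append (m := N + 1) (n := p + 1) (fun j => (u t : ℝ) * μ t j) fun i => w t i *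
      ((1 - (u t : ℝ)) * tailFactor (mk (w t) (m t))
        (slicePosition (m t) i - baryCenter (w t) (slicePosition (m t)))), _,
    fun t => Fin.append (m := N + 1) (n := p + 1) (fun j => radius (mk (w t) (m t)) * r j)
      fun i => slicePosition (m t) (max i s) - baryCenter (w t) (slicePosition (m t)), _, ?_, ?_, ?_,
    ⟨key w₀ m₀ u₀ μ₀ h0, key2 w₀ m₀ hS₀ hlt, key3 w₀ m₀ u₀ μ₀ hs2⟩,
    fun y _ _ => ConfigSpace.tendsto_iff.1 (tendsto_centered hw hm) y⟩
  · refine tendsto_pi_nhds.2 fun i => ?_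
    refine Fin.addCases (m := N + 1) (n := p + 1) (fun i => ?_) (fun i => ?_) i
    · simp only [Fin.append_left]
      exact hu'.mul (tendsto_weight hμ i)
    · simp only [Fin.append_right]
      exact (tendsto_weight hw i).mul ((tendsto_const_nhds.sub hu').mul
        (tendsto_tailFactor hw hm h0 i))
  · refine tendsto_pi_nhds.2 fun i => ?_
    refine Fin.addCases (m := N + 1) (n := p + 1) (fun i => ?_) (fun i => ?_) i
    · simp only [Fin.append_left]
      exact hδ.mul_const _
    · simp only [Fin.append_right]
      exact tendsto_position hw hm _
  · have h1 : ∀ᶠ t in F, ∀ j, radius (mk (w t) (m t)) * r j <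
        slicePosition (m t) s - baryCenter (w t) (slicePosition (m t)) :=
      eventually_all.2 fun j => (hδ.mul_const _).eventually_lt (tendsto_position hw hm s) (hlt j)
    have h2 : ∀ᶠ t in F, ∀ i < s, slicePosition (m t) i -
        baryCenter (w t) (slicePosition (m t)) < radius (mk (w t) (m t)) :=
      eventually_all.2 fun i => by
        by_cases hi : i < s
        · simpa [hi] using (tendsto_position hw hm i).eventually_lt hδ (hs2 i hi)
        · simp [hi]
    filter_upwards [hδ.eventually_const_lt h0, h1, h2, hS] with t ht h1 h2 h3
    exact ⟨key _ _ _ _ ht, key2 _ _ h3 h1, key3 _ _ _ _ h2⟩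

end Moves

/-! ### Interpolation of slabs for points of the classifying space -/

section Interpolate

variable {n : ℕ} {k : Fin n} {φ : ℝ ≃ₜ Set.Ioo (-1 : ℝ) 1}

open ClassifyingSpace

theorem Sliceable.exists_le {S : ConfigSpace n (k + 1)} {l l' : List (ℝ × ℝ)} (h : Sliceable S l)
    (hw : SlicesWithin (slicePart l) l') : ∃ z ∈ l', z.1 ≤ sliceCenter l - sliceRadius l := by
  obtain ⟨q, v, a, h2, h3⟩ := h
  rw [← sliceCenter_congr h3, ← sliceRadius_congr h3, sliceCenter_sliceList]
  obtain ⟨i, hi, hi'⟩ := exists_le_lower v a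
  obtain ⟨y, hy, hya⟩ := (hw (a i, v i) (h3 ▸ mem_slicePart.2 ⟨mem_sliceList.2 ⟨i, rfl⟩, hi⟩)).1
  exact ⟨y, hy, hya.trans hi'⟩

theorem Sliceable.exists_ge {S : ConfigSpace n (k + 1)} {l l' : List (ℝ × ℝ)} (h : Sliceable S l)
    (hw : SlicesWithin (slicePart l) l') : ∃ z ∈ l', sliceCenter l + sliceRadius l ≤ z.1 := by
  obtain ⟨q, v, a, h2, h3⟩ := h
  rw [← sliceCenter_congr h3, ← sliceRadius_congr h3, sliceCenter_sliceList]
  obtain ⟨i, hi, hi'⟩ := exists_upper_le v a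
  obtain ⟨y, hy, hya⟩ := (hw (a i, v i) (h3 ▸ mem_slicePart.2 ⟨mem_sliceList.2 ⟨i, rfl⟩, hi⟩)).2
  exact ⟨y, hy, hi'.trans hya⟩

theorem Sliceable.sliceRadius_nonneg {S : ConfigSpace n (k + 1)} {l : List (ℝ × ℝ)}
    (h : Sliceable S l) : 0 ≤ sliceRadius l := by
  obtain ⟨q, v, a, h2, h3⟩ := h
  rw [← sliceRadius_congr h3]
  exact sliceRadius_sliceList_nonneg v a

/-- The interpolated slab is a convex combination of two slabs that both lie between the extreme
slices of the point, so cutting the configuration at these slices is not seen. -/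
theorem Sliceable.interpolate_datum {l : List (ℝ × ℝ)} {p : ℕ}
    {w : stdSimplex ℝ (Fin (p + 1))} {m : Fin p → SlabMonoid n k}
    (h : Sliceable (centered w m) l) (hw : SlicesWithin (slicePart l) (datum (mk w m)).2)
    {v : ℝ} (hv : v ∈ Icc (0 : ℝ) 1) :
    interpolate φ (datum (mk w m)).1 (radius (mk w m)) l v =
      interpolate φ (centered w m) (radius (mk w m)) l v := by
  have hr := h.sliceRadius_nonneg
  have hδ := radius_nonneg (mk w m)
  rw [interpolate, interpolate, centered, pull_shift, pull_datum_mk]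
  · exact add_nonneg (mul_nonneg (sub_nonneg.2 hv.2) hδ) (mul_nonneg hv.1 hr)
  · obtain ⟨y, hy, hy'⟩ := h.exists_le hw
    obtain ⟨z, hz, hz'⟩ := exists_le_neg_radius (mk w m)
    rcases le_total y.1 z.1 with hyz | hyz
    · exact ⟨y, hy, by nlinarith [hv.1, hv.2]⟩
    · exact ⟨z, hz, by nlinarith [hv.1, hv.2]⟩
  · obtain ⟨y, hy, hy'⟩ := h.exists_ge hw
    obtain ⟨z, hz, hz'⟩ := exists_radius_le (mk w m)
    rcases le_total y.1 z.1 with hyz | hyz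
    · exact ⟨z, hz, by nlinarith [hv.1, hv.2]⟩
    · exact ⟨y, hy, by nlinarith [hv.1, hv.2]⟩

theorem Sliceable.interpolate_datum_one {l : List (ℝ × ℝ)} {p : ℕ}
    {w : stdSimplex ℝ (Fin (p + 1))} {m : Fin p → SlabMonoid n k}
    (h : Sliceable (centered w m) l) (hw : SlicesWithin (slicePart l) (datum (mk w m)).2) :
    interpolate φ (datum (mk w m)).1 (radius (mk w m)) l 1 =
      scan φ (slicedPoint (datum (mk w m)).1 l) := by
  rw [h.interpolate_datum hw (by simp), interpolate_one, h.slicedPoint_datum hw, h.scan_slicedPoint]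

theorem interpolate_datum_zero (x : ClassifyingSpace (SlabMonoid n k)) (l : List (ℝ × ℝ)) :
    interpolate φ (datum x).1 (radius x) l 0 = scan φ x := interpolate_zero _ _ _

end Interpolate

/-! ### Continuity of the moves on open parts of the classifying space -/

section Continuity

variable {n : ℕ} {k : Fin n} {φ : ℝ ≃ₜ Set.Ioo (-1 : ℝ) 1}

open ClassifyingSpace

theorem scan_eq_pull_centered {p : ℕ} (w : stdSimplex ℝ (Fin (p + 1)))
    (m : Fin p → SlabMonoid n k) : scan φ (mk w m) = pull φ (centered w m) 0 (radius (mk w m)) := by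
  rw [scan_mk, centered, pull_shift, zero_add, radius_mk]

/-- A point at height `radius * φ s` of the centered configuration is stretched to a point at height
`s`. -/
theorem ne_of_notMem_scan {p : ℕ} {w : stdSimplex ℝ (Fin (p + 1))} {m : Fin p → SlabMonoid n k}
    (h0 : 0 < radius (mk w m)) {s : ℝ} (h : ∀ y ∈ (scan φ (mk w m)).1.carrier, y k ≠ s) :
    ∀ x ∈ (centered w m).1.carrier, x k ≠ radius (mk w m) * φ s := by
  intro x hx hxs
  refine h (axisMap k (fun _ => s) x) ?_ (by simp)
  rw [scan_eq_pull_centered, mem_pull, axisMap_axisMap, axisMap_eq_self]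
  · exact ⟨h0.ne', hx⟩
  · rw [hxs]
    ring

theorem isOpen_radius_pos : IsOpen {x : ClassifyingSpace (SlabMonoid n k) | 0 < radius x} :=
  isOpen_lt continuous_const continuous_radius

/-- On each cell the cut configuration is traded for the centered one, both at the base point and
nearby, and `SliceTendsto` applies. -/
theorem continuousOn_tailMove :
    ContinuousOn (fun z : ClassifyingSpace (SlabMonoid n k) × unitInterval =>
      slicedPoint (datum z.1).1 (tailMove z.1 z.2)) ({x | 0 < radius x} ×ˢ univ) := by
  refine continuousOn_of_cells isOpen_radius_pos fun p w m u h0 => ?_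
  have hw : Tendsto (fun z : (stdSimplex ℝ (Fin (p + 1)) × (Fin p → SlabMonoid n k)) ×
      unitInterval => z.1.1) (𝓝 ((w, m), u)) (𝓝 w) := (by fun_prop : Continuous _).tendsto _
  have hm : Tendsto (fun z : (stdSimplex ℝ (Fin (p + 1)) × (Fin p → SlabMonoid n k)) ×
      unitInterval => z.1.2) (𝓝 ((w, m), u)) (𝓝 m) := (by fun_prop : Continuous _).tendsto _
  have h := sliceTendsto_tailMove hw hm h0 (continuous_snd.tendsto ((w, m), u))
  rw [ContinuousAt, h.sliceable.slicedPoint_datum (slicesWithin_tailMove _ _)]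
  refine h.tendsto_slicedPoint.congr' ?_
  filter_upwards [h.eventually_sliceable] with z hz
  exact (hz.slicedPoint_datum (slicesWithin_tailMove _ _)).symm

theorem continuousOn_interpolate_tailMove :
    ContinuousOn (fun z : ClassifyingSpace (SlabMonoid n k) × unitInterval × unitInterval =>
      interpolate φ (datum z.1).1 (radius z.1) (tailMove z.1 z.2.1) z.2.2)
      ({x | 0 < radius x} ×ˢ univ) := by
  refine continuousOn_of_cells isOpen_radius_pos fun p w m u h0 => ?_
  have hw : Tendsto (fun z : (stdSimplex ℝ (Fin (p + 1)) × (Fin p → SlabMonoid n k)) ×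
      unitInterval × unitInterval => z.1.1) (𝓝 ((w, m), u)) (𝓝 w) :=
    (by fun_prop : Continuous _).tendsto _
  have hm : Tendsto (fun z : (stdSimplex ℝ (Fin (p + 1)) × (Fin p → SlabMonoid n k)) ×
      unitInterval × unitInterval => z.1.2) (𝓝 ((w, m), u)) (𝓝 m) :=
    (by fun_prop : Continuous _).tendsto _
  have hu : Tendsto (fun z : (stdSimplex ℝ (Fin (p + 1)) × (Fin p → SlabMonoid n k)) ×
      unitInterval × unitInterval => z.2.1) (𝓝 ((w, m), u)) (𝓝 u.1) :=
    (by fun_prop : Continuous _).tendsto _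
  have hv : Tendsto (fun z : (stdSimplex ℝ (Fin (p + 1)) × (Fin p → SlabMonoid n k)) ×
      unitInterval × unitInterval => (z.2.2 : ℝ)) (𝓝 ((w, m), u)) (𝓝 u.2) :=
    (by fun_prop : Continuous _).tendsto _
  have h := sliceTendsto_tailMove hw hm h0 hu
  have h2 := h.tendsto_interpolate (φ := φ) (tendsto_radius_mk hw hm) hv h0 u.2.2
    fun y => ConfigSpace.tendsto_iff.1 (tendsto_centered hw hm) _
  rw [ContinuousAt, h.sliceable.interpolate_datum (slicesWithin_tailMove _ _) u.2.2]
  refine h2.congr' ?_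
  filter_upwards [h.eventually_sliceable] with z hz
  exact (hz.interpolate_datum (slicesWithin_tailMove _ _) z.2.2.2).symm

variable (φ) in
/-- The points of positive radius whose image meets given hyperplanes only far away. -/
def clearRegion {N : ℕ} (s : Fin N → ℝ) : Set (ClassifyingSpace (SlabMonoid n k)) :=
  {x | 0 < radius x ∧ ∀ j, scan φ x ∈ clearAt k (s j)}

theorem isOpen_clearRegion {N : ℕ} (s : Fin N → ℝ) :
    IsOpen (clearRegion φ s : Set (ClassifyingSpace (SlabMonoid n k))) := by
  have : (clearRegion φ s : Set (ClassifyingSpace (SlabMonoid n k))) =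
      {x | 0 < radius x} ∩ ⋂ j, scan φ ⁻¹' clearAt k (s j) := by
    ext x
    simp [clearRegion]
  rw [this]
  exact isOpen_radius_pos.inter (isOpen_iInter_of_finite fun j =>
    (isOpen_clearAt (s j)).preimage continuous_scan)

theorem tendsto_mk {ι : Type*} {F : Filter ι} {p : ℕ} {w : ι → stdSimplex ℝ (Fin (p + 1))}
    {w₀ : stdSimplex ℝ (Fin (p + 1))} {m : ι → Fin p → SlabMonoid n k}
    {m₀ : Fin p → SlabMonoid n k} (hw : Tendsto w F (𝓝 w₀)) (hm : Tendsto m F (𝓝 m₀)) :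
    Tendsto (fun t => mk (w t) (m t)) F (𝓝 (mk w₀ m₀)) := by
  have h := ((continuous_mk (M := SlabMonoid n k) p).tendsto (w₀, m₀)).comp (hw.prodMk_nhds hm)
  simpa only [Function.comp_def] using h

theorem tendsto_dilate {ι : Type*} {F : Filter ι} {p : ℕ} {m : ι → Fin p → SlabMonoid n k}
    {m₀ : Fin p → SlabMonoid n k} (hm : Tendsto m F (𝓝 m₀)) (s : unitInterval) :
    Tendsto (fun t j => SlabMonoid.dilate s (m t j)) F (𝓝 fun j => SlabMonoid.dilate s (m₀ j)) := by
  refine tendsto_pi_nhds.2 fun j => ?_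
  have h1 : Tendsto (fun t => (m t j, s)) F (𝓝 (m₀ j, s)) :=
    (tendsto_pi_nhds.1 hm j).prodMk_nhds tendsto_const_nhds
  have h2 := (SlabMonoid.continuous_dilate.tendsto (m₀ j, s)).comp h1
  simpa only [Function.comp_def] using h2

variable {N : ℕ} {s : Fin (N + 1) → ℝ}

/-- On `clearRegion` the dilated image misses the heights `s j` altogether, so the dilated centered
configuration misses the new slices. The region is open, so this holds nearby as well. -/
theorem sliceTendsto_innerMove_dilate (hs : Monotone fun j => (φ (s j) : ℝ)) {ι : Type*}
    {F : Filter ι} {p : ℕ} {w : ι → stdSimplex ℝ (Fin (p + 1))} {w₀ : stdSimplex ℝ (Fin (p + 1))}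
    {m : ι → Fin p → SlabMonoid n k} {m₀ : Fin p → SlabMonoid n k} (hw : Tendsto w F (𝓝 w₀))
    (hm : Tendsto m F (𝓝 m₀)) (h0 : mk w₀ m₀ ∈ clearRegion φ s) {u : ι → unitInterval}
    {u₀ : unitInterval} (hu : Tendsto u F (𝓝 u₀)) {μ : ι → stdSimplex ℝ (Fin (N + 1))}
    {μ₀ : stdSimplex ℝ (Fin (N + 1))} (hμ : Tendsto μ F (𝓝 μ₀)) :
    SliceTendsto F (fun t => centered (w t) fun j => SlabMonoid.dilate 1 (m t j))
      (centered w₀ fun j => SlabMonoid.dilate 1 (m₀ j))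
      (fun t => innerMove (barDilate (mk (w t) (m t)) 1) (fun j => φ (s j)) (μ t) (u t))
      (innerMove (barDilate (mk w₀ m₀) 1) (fun j => φ (s j)) μ₀ u₀) := by
  have hmd := tendsto_dilate hm 1
  have key : ∀ (w : stdSimplex ℝ (Fin (p + 1))) (m : Fin p → SlabMonoid n k),
      mk w m ∈ clearRegion φ s → ∀ j,
        ∀ x ∈ (centered w fun j => SlabMonoid.dilate 1 (m j)).1.carrier,
        x k ≠ radius (mk w fun j => SlabMonoid.dilate 1 (m j)) * φ (s j) := by
    intro w m h j
    refine ne_of_notMem_scan ?_ fun y hy => ?_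
    · rw [← barDilate_mk, radius_barDilate]
      exact h.1
    · rw [← barDilate_mk, scan_barDilate] at hy
      exact ne_of_mem_dilate_one (h.2 j) hy
  have hmk := tendsto_mk hw hm
  refine sliceTendsto_innerMove hw hmd ?_ hu hμ hs (fun j => (φ (s j)).2) ?_ (key w₀ m₀ h0)
  · rw [← barDilate_mk, radius_barDilate]
    exact h0.1
  · filter_upwards [hmk.eventually ((isOpen_clearRegion s).mem_nhds h0)] with t ht
    exact key _ _ ht

theorem continuousOn_innerMove (hs : Monotone fun j => (φ (s j) : ℝ)) :
    ContinuousOn (fun z : ClassifyingSpace (SlabMonoid n k) ×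
        stdSimplex ℝ (Fin (N + 1)) × unitInterval =>
      slicedPoint (datum (barDilate z.1 1)).1
        (innerMove (barDilate z.1 1) (fun j => φ (s j)) z.2.1 z.2.2))
      (clearRegion φ s ×ˢ univ) := by
  refine continuousOn_of_cells (isOpen_clearRegion s) fun p w m u h0 => ?_
  have hw : Tendsto (fun z : (stdSimplex ℝ (Fin (p + 1)) × (Fin p → SlabMonoid n k)) ×
      stdSimplex ℝ (Fin (N + 1)) × unitInterval => z.1.1) (𝓝 ((w, m), u)) (𝓝 w) :=
    (by fun_prop : Continuous _).tendsto _
  have hm : Tendsto (fun z : (stdSimplex ℝ (Fin (p + 1)) × (Fin p → SlabMonoid n k)) ×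
      stdSimplex ℝ (Fin (N + 1)) × unitInterval => z.1.2) (𝓝 ((w, m), u)) (𝓝 m) :=
    (by fun_prop : Continuous _).tendsto _
  have hμ : Tendsto (fun z : (stdSimplex ℝ (Fin (p + 1)) × (Fin p → SlabMonoid n k)) ×
      stdSimplex ℝ (Fin (N + 1)) × unitInterval => z.2.1) (𝓝 ((w, m), u)) (𝓝 u.1) :=
    (by fun_prop : Continuous _).tendsto _
  have hu : Tendsto (fun z : (stdSimplex ℝ (Fin (p + 1)) × (Fin p → SlabMonoid n k)) ×
      stdSimplex ℝ (Fin (N + 1)) × unitInterval => z.2.2) (𝓝 ((w, m), u)) (𝓝 u.2) :=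
    (by fun_prop : Continuous _).tendsto _
  have h := sliceTendsto_innerMove_dilate hs hw hm h0 hu hμ
  have hr : ∀ j, (φ (s j) : ℝ) ∈ Ioo (-1 : ℝ) 1 := fun j => (φ (s j)).2
  rw [ContinuousAt]
  simp only [barDilate_mk] at h ⊢
  rw [h.sliceable.slicedPoint_datum (slicesWithin_innerMove _ hr _ _)]
  refine h.tendsto_slicedPoint.congr' ?_
  filter_upwards [h.eventually_sliceable] with z hz
  exact (hz.slicedPoint_datum (slicesWithin_innerMove _ hr _ _)).symm

theorem continuousOn_interpolate_innerMove (hs : Monotone fun j => (φ (s j) : ℝ)) :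
    ContinuousOn (fun z : ClassifyingSpace (SlabMonoid n k) ×
        stdSimplex ℝ (Fin (N + 1)) × unitInterval × unitInterval =>
      interpolate φ (datum (barDilate z.1 1)).1 (radius (barDilate z.1 1))
        (innerMove (barDilate z.1 1) (fun j => φ (s j)) z.2.1 z.2.2.1) z.2.2.2)
      (clearRegion φ s ×ˢ univ) := by
  refine continuousOn_of_cells (isOpen_clearRegion s) fun p w m u h0 => ?_
  have hw : Tendsto (fun z : (stdSimplex ℝ (Fin (p + 1)) × (Fin p → SlabMonoid n k)) ×
      stdSimplex ℝ (Fin (N + 1)) × unitInterval × unitInterval => z.1.1) (𝓝 ((w, m), u)) (𝓝 w) :=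
    (by fun_prop : Continuous _).tendsto _
  have hm : Tendsto (fun z : (stdSimplex ℝ (Fin (p + 1)) × (Fin p → SlabMonoid n k)) ×
      stdSimplex ℝ (Fin (N + 1)) × unitInterval × unitInterval => z.1.2) (𝓝 ((w, m), u)) (𝓝 m) :=
    (by fun_prop : Continuous _).tendsto _
  have hμ : Tendsto (fun z : (stdSimplex ℝ (Fin (p + 1)) × (Fin p → SlabMonoid n k)) ×
      stdSimplex ℝ (Fin (N + 1)) × unitInterval × unitInterval => z.2.1) (𝓝 ((w, m), u))
      (𝓝 u.1) := (by fun_prop : Continuous _).tendsto _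
  have hu : Tendsto (fun z : (stdSimplex ℝ (Fin (p + 1)) × (Fin p → SlabMonoid n k)) ×
      stdSimplex ℝ (Fin (N + 1)) × unitInterval × unitInterval => z.2.2.1) (𝓝 ((w, m), u))
      (𝓝 u.2.1) := (by fun_prop : Continuous _).tendsto _
  have hv : Tendsto (fun z : (stdSimplex ℝ (Fin (p + 1)) × (Fin p → SlabMonoid n k)) ×
      stdSimplex ℝ (Fin (N + 1)) × unitInterval × unitInterval => (z.2.2.2 : ℝ)) (𝓝 ((w, m), u))
      (𝓝 u.2.2) := (by fun_prop : Continuous _).tendsto _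
  have hmd := tendsto_dilate hm 1
  have h := sliceTendsto_innerMove_dilate hs hw hm h0 hu hμ
  have hr : ∀ j, (φ (s j) : ℝ) ∈ Ioo (-1 : ℝ) 1 := fun j => (φ (s j)).2
  have h0' : 0 < radius (mk w fun j => SlabMonoid.dilate 1 (m j)) := by
    rw [← barDilate_mk, radius_barDilate]
    exact h0.1
  rw [ContinuousAt]
  simp only [barDilate_mk] at h ⊢
  have h2 := h.tendsto_interpolate (φ := φ) (tendsto_radius_mk hw hmd) hv h0' u.2.2.2
    fun y => ConfigSpace.tendsto_iff.1 (tendsto_centered hw hmd) _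
  rw [h.sliceable.interpolate_datum (slicesWithin_innerMove _ hr _ _) u.2.2.2]
  refine h2.congr' ?_
  filter_upwards [h.eventually_sliceable] with z hz
  exact (hz.interpolate_datum (slicesWithin_innerMove _ hr _ _) z.2.2.2.2).symm

end Continuity

/-! ### Squeezing configurations into slabs -/

/-- Send `j` to the largest element of `J` below it, or to the minimum of `J` if there is none. It
is used to park slices of weight zero on slices known to miss the configuration. -/
theorem exists_monotone_retraction {N : ℕ} {J : Set (Fin (N + 1))} (hJ : J.Nonempty) :
    ∃ ρ : Fin (N + 1) → Fin (N + 1), Monotone ρ ∧ (∀ j, ρ j ∈ J) ∧ ∀ j ∈ J, ρ j = j := by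
  classical
  have hJ' : J.toFinset.Nonempty := by simpa using hJ
  let c := J.toFinset.min' hJ'
  have hc : c ∈ J := by simpa using J.toFinset.min'_mem hJ'
  have hne : ∀ j, (J.toFinset.filter (· ≤ max j c)).Nonempty := fun j => ⟨c, by simp [hc]⟩
  refine ⟨fun j => (J.toFinset.filter (· ≤ max j c)).max' (hne j), fun i j hij => ?_, fun j => ?_,
    fun j hj => ?_⟩
  · refine Finset.max'_subset _ fun l hl => ?_
    simp only [Finset.mem_filter] at hl ⊢
    exact ⟨hl.1, hl.2.trans (max_le_max hij le_rfl)⟩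
  · have := Finset.max'_mem _ (hne j)
    simp only [Finset.mem_filter] at this
    simpa using this.1
  · have hcj : c ≤ j := J.toFinset.min'_le _ (by simpa using hj)
    refine le_antisymm (Finset.max'_le _ _ _ fun l hl => ?_) (Finset.le_max' _ _ ?_)
    · simpa [max_eq_left hcj] using (Finset.mem_filter.1 hl).2
    · simp [hj]

section Push

variable {n : ℕ} {k : Fin n} (φ : ℝ ≃ₜ Set.Ioo (-1 : ℝ) 1)

open ClassifyingSpace

/-- The configuration squeezed into the slab of radius `e` around the origin. -/
def push (S : ConfigSpace n (k + 1)) (e : ℝ) : ConfigSpace n (k + 1) :=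
  ⟨⟨axisMap k (fun t => e * (φ t : ℝ)) '' S.1.carrier, S.1.finite.image _⟩, by
    rintro _ ⟨x, hx, rfl⟩ i hi
    rw [axisMap_of_ne _ _ (fun h => by subst h; omega)]
    exact S.2 x hx i hi⟩

/-- The inverse of `φ` extended by zero. -/
def unstretch (t : ℝ) : ℝ := if h : t ∈ Ioo (-1 : ℝ) 1 then φ.symm ⟨t, h⟩ else 0

variable {φ}

theorem unstretch_of_mem {t : ℝ} (h : t ∈ Ioo (-1 : ℝ) 1) : (φ (unstretch φ t) : ℝ) = t := by
  rw [unstretch, dif_pos h, φ.apply_symm_apply]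

theorem unstretch_apply (t : ℝ) : unstretch φ (φ t : ℝ) = t := by
  rw [unstretch, dif_pos (φ t).2]
  simp

theorem continuousOn_unstretch : ContinuousOn (unstretch φ) (Ioo (-1) 1) := by
  rw [continuousOn_iff_continuous_domRestrict]
  refine φ.symm.continuous.congr fun t => ?_
  rw [domRestrict_apply, unstretch, dif_pos t.2]

theorem injOn_unstretch : InjOn (unstretch φ) (Ioo (-1) 1) := fun s hs t ht h => by
  rw [← unstretch_of_mem (φ := φ) hs, ← unstretch_of_mem (φ := φ) ht, h]

theorem mem_push {S : ConfigSpace n (k + 1)} {e : ℝ} (he : 0 < e) {y : EuclideanSpace ℝ (Fin n)} :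
    y ∈ (push φ S e).1.carrier ↔
      y k ∈ Ioo (-e) e ∧ axisMap k (fun t => unstretch φ (t / e)) y ∈ S.1.carrier := by
  constructor
  · rintro ⟨x, hx, rfl⟩
    have h1 := (φ (x k)).2.1
    have h2 := (φ (x k)).2.2
    refine ⟨?_, ?_⟩
    · rw [axisMap_self]
      constructor <;> nlinarith
    · rw [axisMap_axisMap, axisMap_eq_self]
      · exact hx
      · rw [mul_div_cancel_left₀ _ he.ne', unstretch_apply]
  · rintro ⟨h1, h2⟩
    refine ⟨_, h2, ?_⟩
    rw [axisMap_axisMap, axisMap_eq_self]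
    rw [unstretch_of_mem, mul_div_cancel₀ _ he.ne']
    exact ⟨by rw [lt_div_iff₀ he]; linarith [h1.1], by rw [div_lt_one he]; exact h1.2⟩

theorem pull_push (S : ConfigSpace n (k + 1)) {e : ℝ} (he : 0 < e) :
    pull φ (push φ S e) 0 e = S := by
  refine ConfigSpace.ext' (Set.ext fun y => ?_)
  have : (fun t => 0 + e * (φ t : ℝ)) = fun t => e * (φ t : ℝ) := by simp
  rw [mem_pull, this]
  constructor
  · rintro ⟨-, x, hx, hxy⟩
    have hinj := stretch_injective φ (c := 0) he.ne'
    rw [this] at hinj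
    rwa [← axisMap_injective hinj hxy]
  · exact fun hy => ⟨he.ne', y, hy, rfl⟩

/-- Stretching the slab and squeezing it back recovers the configuration strictly inside it;
everything else is lost. -/
theorem mem_push_pull {S : ConfigSpace n (k + 1)} {e : ℝ} (he : 0 < e)
    {y : EuclideanSpace ℝ (Fin n)} (hy : y k ∈ Ioo (-e) e) :
    y ∈ (push φ (pull φ S 0 e) e).1.carrier ↔ y ∈ S.1.carrier := by
  rw [mem_push he, mem_pull, axisMap_axisMap, axisMap_eq_self]
  · simp [hy, he.ne']
  · rw [unstretch_of_mem, zero_add, mul_div_cancel₀ _ he.ne']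
    exact ⟨by rw [lt_div_iff₀ he]; linarith [hy.1], by rw [div_lt_one he]; exact hy.2⟩

/-- Only the open slab is covered: points of `S p` that escape to infinite height accumulate at the
heights `-e₀` and `e₀`. Inside it the configuration is a pullback along `unstretch`, continuous and
injective on a neighborhood of `y`. -/
theorem locTendsto_push {ι : Type*} {F : Filter ι} {S : ι → ConfigSpace n (k + 1)}
    {S₀ : ConfigSpace n (k + 1)} {e : ι → ℝ} {e₀ : ℝ} (hS : Tendsto S F (𝓝 S₀))
    (he : Tendsto e F (𝓝 e₀)) (he₀ : 0 < e₀) {y : EuclideanSpace ℝ (Fin n)}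
    (hy : y k ∈ Ioo (-e₀) e₀) :
    LocTendsto F (fun p => (push φ (S p) (e p)).1.carrier) (push φ S₀ e₀).1.carrier y := by
  have hdiv : ∀ t, t ∈ Ioo (-e₀) e₀ → t / e₀ ∈ Ioo (-1 : ℝ) 1 := fun t ht =>
    ⟨by rw [lt_div_iff₀ he₀]; linarith [ht.1], by rw [div_lt_one he₀]; exact ht.2⟩
  have hk : Tendsto (fun q : ι × EuclideanSpace ℝ (Fin n) => q.2 k) (F ×ˢ 𝓝 y) (𝓝 (y k)) := by
    have : Continuous fun z : EuclideanSpace ℝ (Fin n) => z k := by fun_prop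
    exact (this.tendsto y).comp tendsto_snd
  have he' := he.comp (tendsto_fst (f := F) (g := 𝓝 y))
  have hψ : ∀ t, t ∈ Ioo (-e₀) e₀ → Tendsto (fun q : ι × ℝ => unstretch φ (q.2 / e q.1))
      (F ×ˢ 𝓝 t) (𝓝 (unstretch φ (t / e₀))) := by
    intro t ht
    have h1 : Tendsto (fun q : ι × ℝ => q.2 / e q.1) (F ×ˢ 𝓝 t) (𝓝 (t / e₀)) :=
      tendsto_snd.div (he.comp tendsto_fst) he₀.ne'
    exact ((continuousOn_unstretch.continuousAt (isOpen_Ioo.mem_nhds (hdiv t ht))).tendsto).comp h1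
  have h1 : LocTendsto F (fun p => axisMap k (fun t => unstretch φ (t / e p)) ⁻¹' (S p).1.carrier)
      (axisMap k (fun t => unstretch φ (t / e₀)) ⁻¹' S₀.1.carrier) y := by
    refine LocTendsto.preimage_coordMap
      (f := fun p i => if i = k then fun t => unstretch φ (t / e p) else id)
      (f₀ := fun i => if i = k then fun t => unstretch φ (t / e₀) else id)
      (ConfigSpace.tendsto_iff.1 hS _) (fun i => ?_) fun _ i => ?_
    · by_cases hi : i = k
      · subst hi
        simpa using hψ _ hy
      · simpa [hi] using tendsto_snd
    · by_cases hi : i = k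
      · subst hi
        obtain ⟨η, hη, hsub⟩ : ∃ η > 0, Icc (y i - η) (y i + η) ⊆ Ioo (-e₀) e₀ := by
          obtain ⟨η, hη, h⟩ := Metric.isOpen_iff.1 isOpen_Ioo _ hy
          refine ⟨η / 2, by linarith, fun t ht => h ?_⟩
          rw [Metric.mem_ball, Real.dist_eq, abs_lt]
          constructor <;> linarith [ht.1, ht.2]
        refine ⟨η, hη, fun t ht => ?_, ?_⟩
        · simp only [if_true]
          exact (hψ t (hsub ht)).comp (tendsto_id.prodMk tendsto_const_nhds)
        · simp only [if_true]
          have key : ∀ e' : ℝ, 0 < e' → y i - η ∈ Ioo (-e') e' → y i + η ∈ Ioo (-e') e' →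
              ContinuousOn (fun t => unstretch φ (t / e')) (Icc (y i - η) (y i + η)) ∧
              InjOn (fun t => unstretch φ (t / e')) (Icc (y i - η) (y i + η)) := by
            intro e' he' h1 h2
            have hmaps : MapsTo (fun t => t / e') (Icc (y i - η) (y i + η)) (Ioo (-1) 1) := by
              intro t ht
              refine ⟨?_, ?_⟩
              · rw [lt_div_iff₀ he']
                linarith [ht.1, h1.1]
              · rw [div_lt_one he']
                linarith [ht.2, h2.2]
            refine ⟨continuousOn_unstretch.comp (by fun_prop) hmaps, ?_⟩
            exact injOn_unstretch.comp (fun a _ b _ h => (div_left_inj' he'.ne').1 h) hmaps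
          have a1 := hsub (left_mem_Icc.2 (by linarith : y i - η ≤ y i + η))
          have a2 := hsub (right_mem_Icc.2 (by linarith : y i - η ≤ y i + η))
          obtain ⟨b1, b2⟩ := key e₀ he₀ a1 a2
          refine ⟨b1, b2, ?_⟩
          filter_upwards [he.eventually_const_lt he₀, he.eventually_const_lt a1.2,
            he.eventually_const_lt a2.2, he.neg.eventually_lt_const a1.1,
            he.neg.eventually_lt_const a2.1] with p h1 h2 h3 h4 h5
          exact key _ h1 ⟨h4, h2⟩ ⟨h5, h3⟩
      · refine ⟨1, one_pos, fun t _ => ?_, ?_, ?_, ?_⟩ <;>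
          simp [hi, continuousOn_id, injOn_id, tendsto_const_nhds]
  refine h1.congr ?_ ?_
  · filter_upwards [he'.eventually_const_lt he₀, hk.eventually_lt he' hy.2,
      he'.neg.eventually_lt hk hy.1] with q h1 h2 h3
    rw [Function.comp_apply] at h1 h2 h3
    rw [mem_push h1]
    exact ⟨fun h => ⟨⟨h3, h2⟩, h⟩, fun h => h.2⟩
  · rw [mem_push he₀]
    exact ⟨fun h => ⟨hy, h⟩, fun h => h.2⟩

end Push

/-! ### Slicing squeezed configurations by a partition of unity -/

section Inner

variable {n : ℕ} {k : Fin n} {φ : ℝ ≃ₜ Set.Ioo (-1 : ℝ) 1}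

open ClassifyingSpace

theorem SliceTendsto.comp_tendsto {ι ι' : Type*} {F : Filter ι} {F' : Filter ι'}
    {S : ι → ConfigSpace n (k + 1)} {S₀ : ConfigSpace n (k + 1)} {l : ι → List (ℝ × ℝ)}
    {l₀ : List (ℝ × ℝ)} (h : SliceTendsto F S S₀ l l₀) {f : ι' → ι} (hf : Tendsto f F' F) :
    SliceTendsto F' (fun p => S (f p)) S₀ (fun p => l (f p)) l₀ := by
  obtain ⟨q, v, v₀, a, a₀, hv, ha, hp, h, hS⟩ := h
  refine ⟨q, fun p => v (f p), v₀, fun p => a (f p), a₀, hv.comp hf, ha.comp hf,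
    hf.eventually hp, h, fun y h1 h2 => ⟨fun hy => ?_, fun hy => ⟨fun U hU => ?_, ?_⟩⟩⟩
  · exact (hf.prodMap tendsto_id).eventually ((hS y h1 h2).1 hy)
  · exact hf.eventually (((hS y h1 h2).2 hy).1 U hU)
  · obtain ⟨U, hU, h3⟩ := ((hS y h1 h2).2 hy).2
    exact ⟨U, hU, hf.eventually h3⟩

theorem isSlicing_push {N : ℕ} {S : ConfigSpace n (k + 1)} {e : ℝ} (he : 0 < e)
    {s : Fin (N + 1) → ℝ} (hs : Monotone fun j => (φ (s j) : ℝ))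
    (h : ∀ j, ∀ x ∈ S.1.carrier, x k ≠ s j) :
    IsSlicing (push φ S e) fun j => e * (φ (s j) : ℝ) := by
  refine ⟨hs.const_mul he.le, ?_⟩
  rintro j _ ⟨x, hx, rfl⟩ hxj
  rw [axisMap_self] at hxj
  exact h j x hx (φ.injective (Subtype.ext (mul_left_cancel₀ he.ne' hxj)))

/-- The weights of slices only are nonzero near parameters at which the slices avoid the points of
the configuration near the origin. -/
def Subordinate {T : Type*} [TopologicalSpace T] (A : Set T) (f : T → ConfigSpace n (k + 1)) {N : ℕ}
    (s : Fin N → ℝ) (μ : T → stdSimplex ℝ (Fin N)) : Prop :=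
  ∀ t ∈ A, ∀ j, (∃ᶠ t' in 𝓝[A] t, μ t' j ≠ 0) → f t ∈ clearAt k (s j)

variable {T : Type*} [TopologicalSpace T] {A : Set T} {f : T → ConfigSpace n (k + 1)} {N : ℕ}
  {s : Fin (N + 1) → ℝ} {μ : T → stdSimplex ℝ (Fin (N + 1))}

/-- Near `t₀` only the slices in `J`, those with weight nonzero arbitrarily close to `t₀`, matter,
and they are clear nearby by openness. The other slices may hit the configuration, but have weight
zero and are retracted onto `J` without changing the order. -/
theorem Subordinate.exists_retraction (h : Subordinate A f s μ) (hf : ContinuousOn f A) {t₀ : T}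
    (ht₀ : t₀ ∈ A) : ∃ ρ : Fin (N + 1) → Fin (N + 1), Monotone ρ ∧
      (∀ᶠ t in 𝓝[A] t₀, ∀ j, f t ∈ clearAt k (s (ρ j))) ∧
      ∀ᶠ t in 𝓝[A] t₀, ∀ j, μ t j ≠ 0 → ρ j = j := by
  obtain ⟨i, hi⟩ := stdSimplex_exists_ne_zero (μ t₀)
  obtain ⟨ρ, h1, h2, h3⟩ := exists_monotone_retraction (J := {j | ∃ᶠ t' in 𝓝[A] t₀, μ t' j ≠ 0})
    ⟨i, fun hne => hne.self_of_nhdsWithin ht₀ hi⟩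
  refine ⟨ρ, h1, eventually_all.2 fun j => ?_, eventually_all.2 fun j => ?_⟩
  · exact (hf t₀ ht₀).eventually ((isOpen_clearAt _).mem_nhds (h t₀ ht₀ _ (h2 j)))
  · by_cases hj : ∃ᶠ t' in 𝓝[A] t₀, μ t' j ≠ 0
    · exact Eventually.of_forall fun t _ => h3 j hj
    · filter_upwards [not_frequently.1 hj] with t ht h
      exact absurd h ht

/-- The slices of a squeezed configuration. -/
def innerSlices (φ : ℝ ≃ₜ Set.Ioo (-1 : ℝ) 1) (s : Fin (N + 1) → ℝ) (e : ℝ)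
    (μ : Fin (N + 1) → ℝ) : List (ℝ × ℝ) :=
  sliceList μ fun j => e * (φ (s j) : ℝ)

theorem mem_innerSlices {e : ℝ} (he : 0 < e) {μ : Fin (N + 1) → ℝ} {z : ℝ × ℝ}
    (hz : z ∈ slicePart (innerSlices φ s e μ)) : z.1 ∈ Ioo (-e) e := by
  obtain ⟨j, rfl⟩ := mem_sliceList.1 (mem_slicePart.1 hz).1
  have := stretch_mem_Ioo φ (c := 0) he (s j)
  simpa using this

/-- The slices are placed at the retracted heights `s (ρ j)`, where they miss the dilated
configuration. They lie strictly inside the slab of radius `e t₀`, where squeezing is continuous. -/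
theorem sliceTendsto_push (h : Subordinate A f s μ) (hf : ContinuousOn f A)
    (hs : Monotone fun j => (φ (s j) : ℝ)) {e : T → ℝ} (he : ContinuousOn e A)
    (he0 : ∀ t ∈ A, 0 < e t) (hμ : ContinuousOn μ A) {t₀ : T} (ht₀ : t₀ ∈ A) :
    SliceTendsto (𝓝[A] t₀) (fun t => push φ ((f t).dilate 1) (e t))
      (push φ ((f t₀).dilate 1) (e t₀)) (fun t => innerSlices φ s (e t) (μ t))
      (innerSlices φ s (e t₀) (μ t₀)) := by
  obtain ⟨ρ, h1, h2, h3⟩ := h.exists_retraction hf ht₀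
  have key : ∀ᶠ t in 𝓝[A] t₀, (μ t : Fin (N + 1) → ℝ) ∈ stdSimplex ℝ (Fin (N + 1)) ∧
      IsSlicing (push φ ((f t).dilate 1) (e t)) (fun j => e t * (φ (s (ρ j)) : ℝ)) ∧
      slicePart (sliceList (μ t) fun j => e t * (φ (s (ρ j)) : ℝ)) =
        slicePart (innerSlices φ s (e t) (μ t)) := by
    filter_upwards [h2, h3, self_mem_nhdsWithin] with t h2 h3 ht
    refine ⟨(μ t).2, isSlicing_push (s := fun j => s (ρ j)) (he0 t ht) (hs.comp h1) fun j x hx =>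
      ne_of_mem_dilate_one (h2 j) hx, slicePart_sliceList_congr fun j hj => by rw [h3 j hj]⟩
  have hd : ContinuousOn (fun t => (f t).dilate 1) A :=
    ConfigSpace.continuous_dilate.comp_continuousOn (hf.prodMk continuousOn_const)
  refine ⟨N, fun t => μ t, μ t₀, fun t j => e t * (φ (s (ρ j)) : ℝ), _, ?_, ?_, key,
    key.self_of_nhdsWithin ht₀, fun y hy hy' => locTendsto_push (hd t₀ ht₀) (he t₀ ht₀)
      (he0 t₀ ht₀) ?_⟩
  · exact tendsto_subtype_rng.1 (hμ t₀ ht₀)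
  · exact tendsto_pi_nhds.2 fun j => (he t₀ ht₀).mul_const _
  · have b := he0 t₀ ht₀
    have b1 := stretch_mem_Ioo φ (c := 0) b (s (ρ 0))
    have b2 := stretch_mem_Ioo φ (c := 0) b (s (ρ (Fin.last N)))
    exact ⟨by linarith [b1.1], by linarith [b2.2]⟩

theorem Sliceable.mem_Ioo {S : ConfigSpace n (k + 1)} {l : List (ℝ × ℝ)} (h : Sliceable S l)
    {e : ℝ} (he : ∀ z ∈ slicePart l, z.1 ∈ Ioo (-e) e) :
    -e < sliceCenter l - sliceRadius l ∧ sliceCenter l + sliceRadius l < e := by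
  have hw : SlicesWithin (slicePart l) (slicePart l) :=
    fun z hz => ⟨⟨z, hz, le_rfl⟩, ⟨z, hz, le_rfl⟩⟩
  obtain ⟨y, hy, hy'⟩ := h.exists_le hw
  obtain ⟨z, hz, hz'⟩ := h.exists_ge hw
  exact ⟨(he y hy).1.trans_le hy', hz'.trans_lt (he z hz).2⟩

/-- Both endpoints of the interpolation lie in the interval, which is convex. -/
theorem Sliceable.interpolate_mem_Ioo {S : ConfigSpace n (k + 1)} {l : List (ℝ × ℝ)}
    (h : Sliceable S l) {e : ℝ} (he0 : 0 < e) (he : ∀ z ∈ slicePart l, z.1 ∈ Ioo (-e) e) {v : ℝ}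
    (hv : v ∈ Icc (0 : ℝ) 1) (t : ℝ) :
    v * sliceCenter l + ((1 - v) * e + v * sliceRadius l) * (φ t : ℝ) ∈ Ioo (-e) e := by
  obtain ⟨h1, h2⟩ := h.mem_Ioo he
  have h3 := h.sliceRadius_nonneg
  have h4 := (φ t).2.1
  have h5 := (φ t).2.2
  have e1 : sliceCenter l + sliceRadius l * (φ t : ℝ) ∈ Ioo (-e) e := by
    constructor <;> nlinarith
  have e2 : e * (φ t : ℝ) ∈ Ioo (-e) e := by
    constructor <;> nlinarith
  have := convex_Ioo (-e) e e1 e2 hv.1 (sub_nonneg.2 hv.2) (by ring)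
  convert this using 1
  simp only [smul_eq_mul]
  ring

theorem continuousOn_innerSlices (h : Subordinate A f s μ) (hf : ContinuousOn f A)
    (hs : Monotone fun j => (φ (s j) : ℝ)) {e : T → ℝ} (he : ContinuousOn e A)
    (he0 : ∀ t ∈ A, 0 < e t) (hμ : ContinuousOn μ A) :
    ContinuousOn (fun t => slicedPoint (push φ ((f t).dilate 1) (e t))
      (innerSlices φ s (e t) (μ t))) A :=
  fun _ ht₀ => (sliceTendsto_push h hf hs he he0 hμ ht₀).tendsto_slicedPoint

theorem continuousOn_interpolate_innerSlices (h : Subordinate A f s μ) (hf : ContinuousOn f A)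
    (hs : Monotone fun j => (φ (s j) : ℝ)) {e : T → ℝ} (he : ContinuousOn e A)
    (he0 : ∀ t ∈ A, 0 < e t) (hμ : ContinuousOn μ A) :
    ContinuousOn (fun z : T × ℝ => interpolate φ (push φ ((f z.1).dilate 1) (e z.1)) (e z.1)
      (innerSlices φ s (e z.1) (μ z.1)) z.2) (A ×ˢ Icc 0 1) := by
  rintro ⟨t₀, v₀⟩ ⟨ht₀, hv₀⟩
  have h1 : Tendsto (Prod.fst : T × ℝ → T) (𝓝[A ×ˢ Icc 0 1] (t₀, v₀)) (𝓝[A] t₀) := by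
    rw [nhdsWithin_prod_eq]
    exact tendsto_fst
  have h2 : Tendsto (Prod.snd : T × ℝ → ℝ) (𝓝[A ×ˢ Icc 0 1] (t₀, v₀)) (𝓝 v₀) := by
    rw [nhdsWithin_prod_eq]
    exact tendsto_snd.mono_right nhdsWithin_le_nhds
  have h3 := (sliceTendsto_push h hf hs he he0 hμ ht₀).comp_tendsto h1
  have hd : ContinuousOn (fun t => (f t).dilate 1) A :=
    ConfigSpace.continuous_dilate.comp_continuousOn (hf.prodMk continuousOn_const)
  have h4 : Tendsto (fun z : T × ℝ => (f z.1).dilate 1) (𝓝[A ×ˢ Icc 0 1] (t₀, v₀))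
      (𝓝 ((f t₀).dilate 1)) := Tendsto.comp (hd t₀ ht₀) h1
  have h5 : Tendsto (fun z : T × ℝ => e z.1) (𝓝[A ×ˢ Icc 0 1] (t₀, v₀))
      (𝓝 (e t₀)) := Tendsto.comp (he t₀ ht₀) h1
  refine h3.tendsto_interpolate h5 h2 (he0 t₀ ht₀) hv₀ fun y => ?_
  refine locTendsto_push h4 h5 (he0 t₀ ht₀) ?_
  rw [axisMap_self]
  exact h3.sliceable.interpolate_mem_Ioo (he0 t₀ ht₀) (fun z => mem_innerSlices (he0 t₀ ht₀)) hv₀ _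

theorem sliceable_innerSlices (h : Subordinate A f s μ) (hf : ContinuousOn f A)
    (hs : Monotone fun j => (φ (s j) : ℝ)) {e : ℝ} (he0 : 0 < e) {t : T} (ht : t ∈ A) :
    Sliceable (push φ ((f t).dilate 1) e) (innerSlices φ s e (μ t)) := by
  obtain ⟨ρ, h1, h2, h3⟩ := h.exists_retraction hf ht
  exact ⟨N, μ t, _, isSlicing_push (s := fun j => s (ρ j)) he0 (hs.comp h1) fun j x hx =>
      ne_of_mem_dilate_one (h2.self_of_nhdsWithin ht j) hx,
    slicePart_sliceList_congr fun j hj => by rw [h3.self_of_nhdsWithin ht j hj]⟩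

theorem interpolate_innerSlices_zero (S : ConfigSpace n (k + 1)) {e : ℝ} (he : 0 < e)
    (l : List (ℝ × ℝ)) : interpolate φ (push φ S e) e l 0 = S := by
  rw [interpolate_zero, pull_push S he]

variable {x : ClassifyingSpace (SlabMonoid n k)}

/-- Squeezing the scan of `x` by its radius gives back the configuration of `x` inside the slab, and
the interpolated slabs stay inside. This matches the homotopy over the ball with the one over the
sphere. -/
theorem interpolate_push_scan (hx : 0 < radius x) {l : List (ℝ × ℝ)}
    (h : Sliceable (push φ (scan φ x) (radius x)) l)
    (hl : ∀ z ∈ slicePart l, z.1 ∈ Ioo (-radius x) (radius x)) {v : ℝ} (hv : v ∈ Icc (0 : ℝ) 1) :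
    interpolate φ (push φ (scan φ x) (radius x)) (radius x) l v =
      interpolate φ (datum x).1 (radius x) l v := by
  refine ConfigSpace.ext' (Set.ext fun y => ?_)
  rw [interpolate, interpolate, mem_pull, mem_pull]
  refine and_congr_right fun _ => ?_
  rw [scan, mem_push_pull hx]
  rw [axisMap_self]
  exact h.interpolate_mem_Ioo hx hl hv _

/-- The two configurations agree inside the slab, which contains all slices of positive weight.
Slices of weight zero could lie outside, so they are removed first. -/
theorem slicedPoint_push_scan (hx : 0 < radius x) {l : List (ℝ × ℝ)}
    (h : Sliceable (push φ (scan φ x) (radius x)) l)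
    (hl : ∀ z ∈ slicePart l, z.1 ∈ Ioo (-radius x) (radius x)) :
    slicedPoint (push φ (scan φ x) (radius x)) l = slicedPoint (datum x).1 l := by
  obtain ⟨q, v, a, h2, h3⟩ := h
  obtain ⟨q', v', a', h4, h5, -, h6⟩ := exists_reduced v h2
  rw [h3] at h6
  have ha : ∀ i, a' i ∈ Ioo (-radius x) (radius x) := fun i =>
    hl (a' i, v' i) (h6 ▸ mem_sliceList.2 ⟨i, rfl⟩)
  have h7 : slicePart (sliceList v' a') = slicePart l := by
    rw [← h6, slicePart_slicePart]
  have h8 : IsSlicing (datum x).1 a' := ⟨h4.1, fun i y hy hyi =>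
    h4.2 i y ((mem_push_pull hx (by rw [hyi]; exact ha i)).2 hy) hyi⟩
  rw [slicedPoint_eq h8 h8 h7 fun _ _ _ => Iff.rfl]
  refine slicedPoint_eq h8 h4 h7 ?_
  rintro y ⟨z, hz, hzy⟩ ⟨z', hz', hzy'⟩
  exact mem_push_pull hx ⟨(hl z hz).1.trans hzy, hzy'.trans (hl z' hz').2⟩

end Inner

/-! ### Compressing maps of balls -/

section Compression

theorem ContinuousOn.ite_le {T Z : Type*} [TopologicalSpace T] [TopologicalSpace Z] {A : Set T}
    {a b : T → ℝ} {f g : T → Z} (ha : Continuous a) (hb : Continuous b)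
    (hf : ContinuousOn f (A ∩ {t | a t ≤ b t})) (hg : ContinuousOn g (A ∩ {t | b t ≤ a t}))
    (h : ∀ t ∈ A, a t = b t → f t = g t) :
    ContinuousOn (fun t => if a t ≤ b t then f t else g t) A := by
  refine ContinuousOn.if (fun t ht => h t ht.1 (frontier_le_subset_eq ha hb ht.2)) ?_ ?_
  · rwa [(isClosed_le ha hb).closure_eq]
  · refine hg.mono (inter_subset_inter_right _ ?_)
    refine closure_minimal (fun t ht => ?_) (isClosed_le hb ha)
    exact (not_le.1 ht).le

/-- Concatenation of two homotopies. -/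
def concat {T Z : Type*} (K K' : T × ℝ → Z) (z : T × ℝ) : Z :=
  if z.2 ≤ 1 / 2 then K (z.1, 2 * z.2) else K' (z.1, 2 * z.2 - 1)

theorem continuousOn_concat {T Z : Type*} [TopologicalSpace T] [TopologicalSpace Z] {A : Set T}
    {K K' : T × ℝ → Z} (hK : ContinuousOn K (A ×ˢ Icc 0 1)) (hK' : ContinuousOn K' (A ×ˢ Icc 0 1))
    (h : ∀ t ∈ A, K (t, 1) = K' (t, 0)) : ContinuousOn (concat K K') (A ×ˢ Icc 0 1) := by
  refine ContinuousOn.ite_le (a := fun z : T × ℝ => z.2) (b := fun _ => 1 / 2)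
    (f := fun z => K (z.1, 2 * z.2)) (g := fun z => K' (z.1, 2 * z.2 - 1)) (by fun_prop)
    (by fun_prop) ?_ ?_ ?_
  · refine hK.comp (by fun_prop) ?_
    rintro z ⟨⟨h1, h2⟩, h3⟩
    exact ⟨h1, by linarith [h2.1], by simp only [mem_ofPred_eq] at h3; linarith⟩
  · refine hK'.comp (by fun_prop) ?_
    rintro z ⟨⟨h1, h2⟩, h3⟩
    exact ⟨h1, by simp only [mem_ofPred_eq] at h3; linarith, by linarith [h2.2]⟩
  · rintro z ⟨h1, h2⟩ h3
    have e1 : 2 * z.2 = 1 := by linarith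
    rw [e1, sub_self]
    exact h z.1 h1

theorem concat_zero {T Z : Type*} (K K' : T × ℝ → Z) (t : T) : concat K K' (t, 0) = K (t, 0) := by
  simp [concat]

theorem concat_one {T Z : Type*} (K K' : T × ℝ → Z) (t : T) : concat K K' (t, 1) = K' (t, 1) := by
  rw [concat, if_neg (by norm_num)]
  norm_num

theorem concat_of_forall {T Z : Type*} {K K' : T × ℝ → Z} {t : T} {c : Z}
    (h : ∀ v ∈ Icc (0 : ℝ) 1, K (t, v) = c) (h' : ∀ v ∈ Icc (0 : ℝ) 1, K' (t, v) = c) {v : ℝ}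
    (hv : v ∈ Icc (0 : ℝ) 1) : concat K K' (t, v) = c := by
  rw [concat]
  split_ifs with hv'
  · exact h _ ⟨by linarith [hv.1], by simp only at hv'; linarith⟩
  · exact h' _ ⟨by simp only at hv'; linarith, by linarith [hv.2]⟩

variable {E : Type*} [NormedAddCommGroup E] [NormedSpace ℝ E]

/-- Radial projection to the unit sphere. -/
def radial (x : E) : E := ‖x‖⁻¹ • x

theorem radial_mem {x : E} (h : x ≠ 0) : radial x ∈ Metric.sphere (0 : E) 1 := by
  simp [radial, norm_smul, h]

theorem radial_of_mem {x : E} (h : x ∈ Metric.sphere (0 : E) 1) : radial x = x := by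
  rw [mem_sphere_zero_iff_norm] at h
  simp [radial, h]

theorem radial_smul {x : E} {c : ℝ} (h : 0 < c) : radial (c • x) = radial x := by
  rw [radial, radial, norm_smul, smul_smul, Real.norm_of_nonneg h.le, mul_inv]
  congr 1
  field_simp

theorem continuousOn_radial : ContinuousOn (radial : E → E) {x | x ≠ 0} :=
  (continuous_norm.continuousOn.inv₀ fun x hx => by simpa using hx).smul continuousOn_id

/-- The retraction to the unit ball. -/
def clip (x : E) : E := (max 1 ‖x‖)⁻¹ • x

theorem clip_of_norm_le {x : E} (h : ‖x‖ ≤ 1) : clip x = x := by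
  simp [clip, max_eq_left h]

theorem clip_of_le_norm {x : E} (h : 1 ≤ ‖x‖) : clip x = radial x := by
  rw [clip, radial, max_eq_right h]

theorem continuous_clip : Continuous (clip : E → E) :=
  ((continuous_const.max continuous_norm).inv₀ fun x =>
    (lt_of_lt_of_le one_pos (le_max_left 1 ‖x‖)).ne').smul continuous_id

theorem clip_mem (x : E) : clip x ∈ Metric.closedBall (0 : E) 1 := by
  have h : 0 < max 1 ‖x‖ := lt_of_lt_of_le one_pos (le_max_left 1 ‖x‖)
  rw [mem_closedBall_zero_iff, clip, norm_smul, norm_inv, Real.norm_of_nonneg h.le,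
    inv_mul_le_iff₀ h, mul_one]
  exact le_max_right _ _

variable {X Y : Type*} [TopologicalSpace X] [TopologicalSpace Y] {σ : X → Y}

/-- A map of the unit ball lifting to given values on the sphere is homotopic, relative to the
sphere, to a map that lifts with these values on the sphere. -/
def Compressible (σ : X → Y) (f : E → Y) (g : E → X) : Prop :=
  ∃ h : E → X, ContinuousOn h (Metric.closedBall 0 1) ∧ (∀ x ∈ Metric.sphere (0 : E) 1, h x = g x) ∧
    ∃ H : E × ℝ → Y, ContinuousOn H (Metric.closedBall 0 1 ×ˢ Icc 0 1) ∧
      (∀ x ∈ Metric.closedBall (0 : E) 1, H (x, 0) = f x) ∧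
      (∀ x ∈ Metric.closedBall (0 : E) 1, H (x, 1) = σ (h x)) ∧
      ∀ x ∈ Metric.sphere (0 : E) 1, ∀ v ∈ Icc (0 : ℝ) 1, H (x, v) = f x

/-- The ball is divided into an inner ball of radius `(c t)⁻¹`, rescaled to carry `F`, and a collar
that carries `G` along rays; the pieces agree on the common sphere. -/
theorem continuousOn_collar {Z T : Type*} [TopologicalSpace Z] [TopologicalSpace T] {A : Set T}
    {F : T × E → Z} {G : (T × E) × ℝ → Z} (hF : ContinuousOn F (A ×ˢ Metric.closedBall 0 1))
    (hG : ContinuousOn G ((A ×ˢ Metric.sphere 0 1) ×ˢ Icc 0 1)) {c : T → ℝ} (hc : Continuous c)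
    (h : ∀ t ∈ A, ∀ x ∈ Metric.sphere (0 : E) 1, F (t, x) = G ((t, x), 0))
    (hc0 : ∀ t ∈ A, 0 < c t) (hc1 : ∀ t ∈ A, c t ≤ 2) :
    ContinuousOn (fun z : T × E => if c z.1 * ‖z.2‖ ≤ 1 then F (z.1, c z.1 • z.2)
      else G ((z.1, radial z.2), c z.1 * ‖z.2‖ - 1)) (A ×ˢ Metric.closedBall 0 1) := by
  refine ContinuousOn.ite_le (a := fun z : T × E => c z.1 * ‖z.2‖) (b := fun _ => 1)
    (f := fun z : T × E => F (z.1, c z.1 • z.2))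
    (g := fun z : T × E => G ((z.1, radial z.2), c z.1 * ‖z.2‖ - 1)) (by fun_prop)
    (by fun_prop) ?_ ?_ ?_
  · refine hF.comp (by fun_prop) ?_
    rintro z ⟨⟨h1, h2⟩, h3⟩
    refine ⟨h1, ?_⟩
    rw [mem_closedBall_zero_iff, norm_smul, Real.norm_of_nonneg (hc0 _ h1).le]
    exact h3
  · have hne : ∀ z ∈ (A ×ˢ Metric.closedBall (0 : E) 1) ∩ {z : T × E | 1 ≤ c z.1 * ‖z.2‖},
        z.2 ≠ 0 := by
      rintro z ⟨-, h3⟩ h0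
      rw [mem_ofPred_eq, h0, norm_zero, mul_zero] at h3
      exact absurd h3 (by norm_num)
    refine hG.comp ?_ ?_
    · refine ((continuousOn_fst).prodMk (continuousOn_radial.comp continuousOn_snd hne)).prodMk ?_
      exact Continuous.continuousOn (by fun_prop)
    · rintro z ⟨⟨h1, h2⟩, h3⟩
      refine ⟨⟨h1, radial_mem (hne z ⟨⟨h1, h2⟩, h3⟩)⟩, sub_nonneg.2 h3, ?_⟩
      rw [mem_closedBall_zero_iff] at h2
      have := hc1 _ h1
      have := hc0 _ h1
      nlinarith
  · rintro ⟨t, x⟩ ⟨h1, h2⟩ h3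
    simp only at h3 ⊢
    have hx : c t • x ∈ Metric.sphere (0 : E) 1 := by
      rw [mem_sphere_zero_iff_norm, norm_smul, Real.norm_of_nonneg (hc0 t h1).le, h3]
    rw [h3, sub_self, h t h1 _ hx, ← radial_smul (hc0 t h1), radial_of_mem hx]

/-- At time `v` the map `f` is shrunk into the ball of radius `(1 + v)⁻¹`, and the collar runs
through the boundary homotopy up to time `v`. -/
theorem exists_homotopy_extension (hσ : Continuous σ) {f : E → Y}
    (hf : ContinuousOn f (Metric.closedBall 0 1)) {G : E × ℝ → X}
    (hG : ContinuousOn G (Metric.sphere 0 1 ×ˢ Icc 0 1))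
    (hfG : ∀ x ∈ Metric.sphere (0 : E) 1, f x = σ (G (x, 0))) :
    ∃ F : E × ℝ → Y, ContinuousOn F (Metric.closedBall 0 1 ×ˢ Icc 0 1) ∧
      (∀ x ∈ Metric.closedBall (0 : E) 1, F (x, 0) = f x) ∧
      ∀ x ∈ Metric.sphere (0 : E) 1, ∀ v ∈ Icc (0 : ℝ) 1, F (x, v) = σ (G (x, v)) := by
  have hc := continuousOn_collar (T := ℝ) (A := Icc 0 1) (F := fun z => f z.2)
    (G := fun z => σ (G (z.1.2, z.2))) (c := fun v => 1 + v)
    (hf.comp continuousOn_snd fun z hz => hz.2)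
    (hσ.comp_continuousOn (hG.comp (by fun_prop) fun z hz => ⟨hz.1.2, hz.2⟩)) (by fun_prop)
    (fun t _ x hx => hfG x hx) (fun t ht => by linarith [ht.1]) (fun t ht => by linarith [ht.2])
  refine ⟨_, hc.comp continuous_swap.continuousOn fun z hz => ⟨hz.2, hz.1⟩, fun x hx => ?_,
    fun x hx v hv => ?_⟩
  · rw [mem_closedBall_zero_iff] at hx
    simp [hx]
  · have hx' := mem_sphere_zero_iff_norm.1 hx
    simp only [Function.comp_apply, Prod.swap_prod_mk, hx', mul_one, add_sub_cancel_left,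
      radial_of_mem hx]
    split_ifs with h
    · obtain rfl : v = 0 := by linarith [hv.1]
      simpa using hfG x hx
    · rfl

/-- Extending a lift up to homotopy over a collar of the sphere. -/
theorem compressible_of_collar {f : E → Y} {g h₀ : E → X} {F : E × ℝ → Y} {G : E × ℝ → X}
    {Q : (E × ℝ) × ℝ → Y} (hf : ContinuousOn f (Metric.closedBall 0 1))
    (hh₀ : ContinuousOn h₀ (Metric.closedBall 0 1))
    (hF : ContinuousOn F (Metric.closedBall 0 1 ×ˢ Icc 0 1))
    (hG : ContinuousOn G (Metric.sphere 0 1 ×ˢ Icc 0 1))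
    (hQ : ContinuousOn Q ((Metric.sphere 0 1 ×ˢ Icc 0 1) ×ˢ Icc 0 1))
    (hF0 : ∀ x ∈ Metric.closedBall (0 : E) 1, F (x, 0) = f x)
    (hF1 : ∀ x ∈ Metric.closedBall (0 : E) 1, F (x, 1) = σ (h₀ x))
    (hG0 : ∀ x ∈ Metric.sphere (0 : E) 1, G (x, 0) = g x)
    (hG1 : ∀ x ∈ Metric.sphere (0 : E) 1, G (x, 1) = h₀ x)
    (hQ0 : ∀ x ∈ Metric.sphere (0 : E) 1, ∀ v ∈ Icc (0 : ℝ) 1, Q ((x, v), 0) = f x)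
    (hQ1 : ∀ x ∈ Metric.sphere (0 : E) 1, ∀ v ∈ Icc (0 : ℝ) 1, Q ((x, v), 1) = F (x, v))
    (hQf : ∀ x ∈ Metric.sphere (0 : E) 1, ∀ u ∈ Icc (0 : ℝ) 1, Q ((x, 0), u) = f x)
    (hQG : ∀ x ∈ Metric.sphere (0 : E) 1, ∀ u ∈ Icc (0 : ℝ) 1, Q ((x, 1), u) = σ (G (x, u))) :
    Compressible σ f g := by
  have hmem : ∀ x ∈ Metric.closedBall (0 : E) 1, ¬ 2 * ‖x‖ ≤ 1 →
      radial x ∈ Metric.sphere (0 : E) 1 ∧ 1 - (2 * ‖x‖ - 1) ∈ Icc (0 : ℝ) 1 := by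
    intro x hx h
    rw [mem_closedBall_zero_iff] at hx
    refine ⟨radial_mem fun h0 => h (by simp [h0]), by linarith, by linarith⟩
  have hmem2 : ∀ x : E, 2 * ‖x‖ ≤ 1 → (2 : ℝ) • x ∈ Metric.closedBall (0 : E) 1 := by
    intro x h
    rw [mem_closedBall_zero_iff, norm_smul]
    simpa using h
  -- The lift is `h₀` on the inner half of the ball, and `G` backwards on the collar, ending in `g`
  -- on the sphere.
  have hh := continuousOn_collar (T := Unit) (A := univ) (F := fun z => h₀ z.2)
    (G := fun z => G (z.1.2, 1 - z.2)) (c := fun _ => 2)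
    (hh₀.comp continuousOn_snd fun z hz => hz.2)
    (hG.comp (by fun_prop) fun z hz => ⟨hz.1.2, by linarith [hz.2.2], by linarith [hz.2.1]⟩)
    (by fun_prop) (fun t _ x hx => by simpa using (hG1 x hx).symm) (fun t ht => by norm_num)
    (fun t ht => le_rfl)
  -- For fixed `v` this is `F` inside and `Q` on the collar, with its last parameter running from
  -- `1` to `0` outwards, so that the sphere is fixed.
  have hH := continuousOn_collar (T := ℝ) (A := Icc 0 1) (F := fun z => F (z.2, z.1))
    (G := fun z => Q ((z.1.2, z.1.1), 1 - z.2)) (c := fun _ => 2)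
    (hF.comp continuous_swap.continuousOn fun z hz => ⟨hz.2, hz.1⟩)
    (hQ.comp (by fun_prop) fun z hz => ⟨⟨hz.1.2, hz.1.1⟩, by linarith [hz.2.2],
      by linarith [hz.2.1]⟩)
    (by fun_prop) (fun t ht x hx => by simpa using (hQ1 x hx t ht).symm) (fun t ht => by norm_num)
    (fun t ht => le_rfl)
  have hH₁ := hH.comp continuous_swap.continuousOn
    (s := Metric.closedBall 0 1 ×ˢ Icc 0 1) fun z hz => ⟨hz.2, hz.1⟩
  -- At `v = 0` the previous homotopy is `f` on the inner ball and constant along rays on the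
  -- collar. This one deforms `f` to that map relative to the sphere.
  have hH₀ : ContinuousOn (fun z : E × ℝ => f (clip ((1 + z.2) • z.1)))
      (Metric.closedBall 0 1 ×ˢ Icc 0 1) :=
    hf.comp (continuous_clip.comp (by fun_prop)).continuousOn fun z _ => clip_mem _
  have hh' := hh.comp (f := fun x : E => ((), x)) (s := Metric.closedBall 0 1)
    (by fun_prop) fun x hx => ⟨mem_univ _, hx⟩
  refine ⟨_, hh', fun x hx => ?_, _, continuousOn_concat hH₀ hH₁ fun x hx => ?_, fun x hx => ?_,
    fun x hx => ?_, fun x hx v hv => concat_of_forall (fun v hv => ?_) (fun v hv => ?_) hv⟩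
  · have hx' := mem_sphere_zero_iff_norm.1 hx
    simp only [Function.comp_apply, hx', radial_of_mem hx]
    norm_num
    exact hG0 x hx
  · simp only [Function.comp_apply, Prod.swap_prod_mk]
    have e : (1 : ℝ) + 1 = 2 := by norm_num
    rw [e]
    split_ifs with h
    · rw [hF0 _ (hmem2 x h), clip_of_norm_le (by simpa using hmem2 x h)]
    · obtain ⟨h1, h2⟩ := hmem x hx h
      rw [hQf _ h1 _ h2, clip_of_le_norm, radial_smul (by norm_num)]
      rw [norm_smul]
      simpa using (not_le.1 h).le
  · rw [concat_zero]
    simp only [add_zero, one_smul]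
    rw [clip_of_norm_le (by simpa using hx)]
  · rw [concat_one]
    simp only [Function.comp_apply, Prod.swap_prod_mk]
    split_ifs with h
    · rw [hF1 _ (hmem2 x h)]
    · obtain ⟨h1, h2⟩ := hmem x hx h
      rw [hQG _ h1 _ h2]
  · have hx' := mem_sphere_zero_iff_norm.1 hx
    have h1 : (0 : ℝ) < 1 + v := by linarith [hv.1]
    simp only
    rw [clip_of_le_norm, radial_smul h1, radial_of_mem hx]
    rw [norm_smul, hx', Real.norm_of_nonneg h1.le]
    linarith [hv.1]
  · have hx' := mem_sphere_zero_iff_norm.1 hx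
    simp only [Function.comp_apply, Prod.swap_prod_mk, hx', radial_of_mem hx]
    norm_num
    exact hQ0 x hx v hv

/-- Compressibility only depends on the homotopy class of a pair. -/
theorem Compressible.of_homotopy (hσ : Continuous σ) {F : E × ℝ → Y} {G : E × ℝ → X}
    (hF : ContinuousOn F (Metric.closedBall 0 1 ×ˢ Icc 0 1))
    (hG : ContinuousOn G (Metric.sphere 0 1 ×ˢ Icc 0 1))
    (hFG : ∀ x ∈ Metric.sphere (0 : E) 1, ∀ v ∈ Icc (0 : ℝ) 1, F (x, v) = σ (G (x, v)))
    (h : Compressible σ (fun x => F (x, 1)) fun x => G (x, 1)) :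
    Compressible σ (fun x => F (x, 0)) fun x => G (x, 0) := by
  obtain ⟨h₀, hh₀, hhG, H, hH, hH0, hH1, hHS⟩ := h
  have hm : ∀ v ∈ Icc (0 : ℝ) 1, min (2 * v) 1 ∈ Icc (0 : ℝ) 1 := fun v hv =>
    ⟨le_min (by linarith [hv.1]) zero_le_one, min_le_right _ _⟩
  have h0 : (0 : ℝ) ∈ Icc (0 : ℝ) 1 := by simp
  refine compressible_of_collar (h₀ := h₀) (F := concat F H) (G := G)
    -- On the sphere `concat F H` follows `σ ∘ G` during the first half and then rests, whence `min
    -- (2 * v) 1`. The square is filled by running only a fraction of this path.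
    (Q := fun z => σ (G (z.1.1, min (2 * z.1.2) 1 * z.2))) ?_ hh₀
    (continuousOn_concat hF hH fun x hx => (hH0 x hx).symm) hG ?_ (fun x hx => concat_zero _ _ _)
    (fun x hx => ?_) (fun x hx => rfl) (fun x hx => (hhG x hx).symm) (fun x hx v hv => ?_)
    (fun x hx v hv => ?_) (fun x hx u hu => ?_) (fun x hx u hu => ?_)
  · exact hF.comp (by fun_prop) fun x hx => ⟨hx, h0⟩
  · refine hσ.comp_continuousOn (hG.comp (Continuous.continuousOn (by fun_prop)) ?_)
    rintro z ⟨⟨h1, h2⟩, h3⟩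
    exact ⟨h1, mul_nonneg (hm _ h2).1 h3.1, mul_le_one₀ (hm _ h2).2 h3.1 h3.2⟩
  · rw [concat_one, hH1 x hx]
  · simp only [mul_zero]
    rw [hFG x hx 0 h0]
  · simp only [mul_one, concat]
    split_ifs with hv'
    · rw [min_eq_left (by linarith), hFG x hx _ ⟨by linarith [hv.1], by linarith⟩]
    · rw [min_eq_right (by linarith), hHS x hx _ ⟨by linarith, by linarith [hv.2]⟩]
      exact (hFG x hx 1 (by simp)).symm
  · simp only [mul_zero, zero_mul, min_eq_left zero_le_one]
    rw [hFG x hx 0 h0]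
  · simp

end Compression

/-! ### The moves along families, and subordinate slices on a ball -/

section Families

variable {n : ℕ} {k : Fin n} {φ : ℝ ≃ₜ Set.Ioo (-1 : ℝ) 1}

open ClassifyingSpace

section Space

variable {T : Type*} [TopologicalSpace T] {A : Set T}
  {g : T → ClassifyingSpace (SlabMonoid n k)} {N : ℕ}
  {s : Fin (N + 1) → ℝ} {μ : T → stdSimplex ℝ (Fin (N + 1))}

theorem sliceCenter_datum (x : ClassifyingSpace (SlabMonoid n k)) : sliceCenter (datum x).2 = 0 := by
  obtain ⟨p, w, m, rfl⟩ := exists_eq_mk x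
  rw [datum_mk_snd, sliceCenter_congr (slicePart_slicePart _), sliceCenter_sliceList,
    baryCenter_sub, sub_self]

/-- For its own slices the slab of a point is already the one being interpolated from, so the path
is constant. -/
theorem interpolate_datum (x : ClassifyingSpace (SlabMonoid n k)) (v : ℝ) :
    interpolate φ (datum x).1 (radius x) (datum x).2 v = scan φ x := by
  have h : sliceRadius (datum x).2 = radius x := rfl
  rw [interpolate, sliceCenter_datum, h, scan]
  congr 1 <;> ring

theorem interpolate_tailMove_one {x : ClassifyingSpace (SlabMonoid n k)} (h0 : 0 < radius x)
    (u : unitInterval) : interpolate φ (datum x).1 (radius x) (tailMove x u) 1 =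
      scan φ (slicedPoint (datum x).1 (tailMove x u)) := by
  obtain ⟨p, w, m, rfl⟩ := exists_eq_mk x
  -- Constant families along `pure ()`: the convergence statement is used only for the fact that the
  -- list cuts the configuration.
  have h : SliceTendsto (pure ()) (fun _ => centered w m) (centered w m)
      (fun _ => tailMove (mk w m) u) (tailMove (mk w m) u) :=
    sliceTendsto_tailMove (tendsto_pure_nhds (fun _ => w) ()) (tendsto_pure_nhds (fun _ => m) ())
      h0 (tendsto_pure_nhds (fun _ => u) ())
  exact h.sliceable.interpolate_datum_one (slicesWithin_tailMove _ _)

theorem interpolate_innerMove_one (hs : Monotone fun j => (φ (s j) : ℝ))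
    {x : ClassifyingSpace (SlabMonoid n k)} (h0 : x ∈ clearRegion φ s)
    (μ : stdSimplex ℝ (Fin (N + 1))) (u : unitInterval) :
    interpolate φ (datum (barDilate x 1)).1 (radius (barDilate x 1))
        (innerMove (barDilate x 1) (fun j => φ (s j)) μ u) 1 =
      scan φ (slicedPoint (datum (barDilate x 1)).1
        (innerMove (barDilate x 1) (fun j => φ (s j)) μ u)) := by
  obtain ⟨p, w, m, rfl⟩ := exists_eq_mk x
  have h := sliceTendsto_innerMove_dilate hs (tendsto_pure_nhds (fun _ => w) ())
    (tendsto_pure_nhds (fun _ => m) ()) h0 (tendsto_pure_nhds (fun _ => u) ())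
    (tendsto_pure_nhds (fun _ => μ) ())
  rw [barDilate_mk] at h ⊢
  exact h.sliceable.interpolate_datum_one (slicesWithin_innerMove _ (fun j => (φ (s j)).2) _ _)

/-- Near each parameter the heights can be replaced by retracted ones, which are all clear, without
affecting the slices of positive weight. This reduces families with a partition of unity to
`clearRegion`. -/
theorem exists_retraction_of_subordinate (hg : ContinuousOn g A) (h0 : ∀ t ∈ A, 0 < radius (g t))
    (h : Subordinate A (fun t => scan φ (g t)) s μ) {t₀ : T} (ht₀ : t₀ ∈ A) :
    ∃ ρ : Fin (N + 1) → Fin (N + 1), Monotone ρ ∧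
      (∀ᶠ t in 𝓝[A] t₀, g t ∈ clearRegion φ fun j => s (ρ j)) ∧
      ∀ᶠ t in 𝓝[A] t₀, ∀ (x : ClassifyingSpace (SlabMonoid n k)) (u : ℝ),
        slicePart (innerMove x (fun j => φ (s j)) (μ t) u) =
          slicePart (innerMove x (fun j => φ (s (ρ j))) (μ t) u) := by
  obtain ⟨ρ, h1, h2, h3⟩ := h.exists_retraction (continuous_scan.comp_continuousOn hg) ht₀
  refine ⟨ρ, h1, ?_, ?_⟩
  · filter_upwards [h2, self_mem_nhdsWithin] with t ht htA
    exact ⟨h0 t htA, ht⟩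
  · filter_upwards [h3] with t ht x u
    exact slicePart_innerMove_congr x (fun j hj => by rw [ht j hj]) u

theorem interpolate_innerMove_one_of_subordinate (hs : Monotone fun j => (φ (s j) : ℝ))
    (hg : ContinuousOn g A) (h0 : ∀ t ∈ A, 0 < radius (g t))
    (h : Subordinate A (fun t => scan φ (g t)) s μ) {t : T} (ht : t ∈ A) (u : unitInterval) :
    interpolate φ (datum (barDilate (g t) 1)).1 (radius (barDilate (g t) 1))
        (innerMove (barDilate (g t) 1) (fun j => φ (s j)) (μ t) u) 1 =
      scan φ (slicedPoint (datum (barDilate (g t) 1)).1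
        (innerMove (barDilate (g t) 1) (fun j => φ (s j)) (μ t) u)) := by
  obtain ⟨ρ, h1, h2, h3⟩ := exists_retraction_of_subordinate hg h0 h ht
  have h3' := h3.self_of_nhdsWithin ht (barDilate (g t) 1) u
  rw [interpolate_congr _ _ h3', slicedPoint_slicePart_congr _ h3']
  exact interpolate_innerMove_one (hs.comp h1) (h2.self_of_nhdsWithin ht) _ _

theorem continuousOn_innerMove_family (hs : Monotone fun j => (φ (s j) : ℝ))
    (hg : ContinuousOn g A) (h0 : ∀ t ∈ A, 0 < radius (g t))
    (h : Subordinate A (fun t => scan φ (g t)) s μ) (hμ : ContinuousOn μ A) :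
    ContinuousOn (fun z : T × unitInterval => slicedPoint (datum (barDilate (g z.1) 1)).1
      (innerMove (barDilate (g z.1) 1) (fun j => φ (s j)) (μ z.1) z.2)) (A ×ˢ univ) := by
  rintro ⟨t₀, u₀⟩ ⟨ht₀, -⟩
  obtain ⟨ρ, h1, h2, h3⟩ := exists_retraction_of_subordinate hg h0 h ht₀
  have hfst : Tendsto (Prod.fst : T × unitInterval → T) (𝓝[A ×ˢ univ] (t₀, u₀)) (𝓝[A] t₀) := by
    rw [nhdsWithin_prod_eq]
    exact tendsto_fst
  have hc := (continuousOn_innerMove (hs.comp h1)).continuousAt (x := (g t₀, μ t₀, u₀))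
    (((isOpen_clearRegion _).prod isOpen_univ).mem_nhds
      ⟨h2.self_of_nhdsWithin ht₀, mem_univ _⟩)
  have hz : Tendsto (fun z : T × unitInterval => (g z.1, μ z.1, z.2))
      (𝓝[A ×ˢ univ] (t₀, u₀)) (𝓝 (g t₀, μ t₀, u₀)) :=
    (Tendsto.comp (hg t₀ ht₀) hfst).prodMk_nhds ((Tendsto.comp (hμ t₀ ht₀) hfst).prodMk_nhds
      ((continuous_snd.tendsto (t₀, u₀)).mono_left nhdsWithin_le_nhds))
  have hcomp := Tendsto.comp hc hz
  rw [ContinuousWithinAt]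
  have e0 := slicedPoint_slicePart_congr (datum (barDilate (g t₀) 1)).1
    (h3.self_of_nhdsWithin ht₀ (barDilate (g t₀) 1) u₀)
  simp only at e0 ⊢
  rw [e0]
  refine hcomp.congr' ?_
  filter_upwards [hfst.eventually h3] with z hz
  exact (slicedPoint_slicePart_congr _ (hz _ _)).symm

theorem continuousOn_interpolate_innerMove_family (hs : Monotone fun j => (φ (s j) : ℝ))
    (hg : ContinuousOn g A) (h0 : ∀ t ∈ A, 0 < radius (g t))
    (h : Subordinate A (fun t => scan φ (g t)) s μ) (hμ : ContinuousOn μ A) :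
    ContinuousOn (fun z : T × unitInterval × unitInterval =>
      interpolate φ (datum (barDilate (g z.1) 1)).1 (radius (barDilate (g z.1) 1))
      (innerMove (barDilate (g z.1) 1) (fun j => φ (s j)) (μ z.1) z.2.1) z.2.2)
      (A ×ˢ univ) := by
  rintro ⟨t₀, u₀⟩ ⟨ht₀, -⟩
  obtain ⟨ρ, h1, h2, h3⟩ := exists_retraction_of_subordinate hg h0 h ht₀
  have hfst : Tendsto (Prod.fst : T × unitInterval × unitInterval → T)
      (𝓝[A ×ˢ univ] (t₀, u₀)) (𝓝[A] t₀) := by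
    rw [nhdsWithin_prod_eq]
    exact tendsto_fst
  have hc := (continuousOn_interpolate_innerMove (hs.comp h1)).continuousAt
    (x := (g t₀, μ t₀, u₀)) (((isOpen_clearRegion _).prod isOpen_univ).mem_nhds
      ⟨h2.self_of_nhdsWithin ht₀, mem_univ _⟩)
  have hz : Tendsto (fun z : T × unitInterval × unitInterval => (g z.1, μ z.1, z.2))
      (𝓝[A ×ˢ univ] (t₀, u₀)) (𝓝 (g t₀, μ t₀, u₀)) :=
    (Tendsto.comp (hg t₀ ht₀) hfst).prodMk_nhds ((Tendsto.comp (hμ t₀ ht₀) hfst).prodMk_nhds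
      ((continuous_snd.tendsto (t₀, u₀)).mono_left nhdsWithin_le_nhds))
  have hcomp := Tendsto.comp hc hz
  rw [ContinuousWithinAt]
  have e0 := interpolate_congr (φ := φ) (datum (barDilate (g t₀) 1)).1
    (radius (barDilate (g t₀) 1)) (h3.self_of_nhdsWithin ht₀ (barDilate (g t₀) 1) u₀.1) u₀.2
  simp only at e0 ⊢
  rw [e0]
  refine hcomp.congr' ?_
  filter_upwards [hfst.eventually h3] with z hz
  exact (interpolate_congr _ _ (hz _ _) _).symm

end Space

section Ball

variable {E : Type*} [NormedAddCommGroup E]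

/-- Tietze extension applied to the logarithm keeps the extension positive. -/
theorem exists_pos_extension {δ : E → ℝ} (hδ : ContinuousOn δ (Metric.sphere 0 1))
    (h0 : ∀ x ∈ Metric.sphere (0 : E) 1, 0 < δ x) :
    ∃ e : E → ℝ, Continuous e ∧ (∀ x, 0 < e x) ∧ ∀ x ∈ Metric.sphere (0 : E) 1, e x = δ x := by
  have hc : Continuous fun x : Metric.sphere (0 : E) 1 => Real.log (δ x) :=
    (continuousOn_iff_continuous_domRestrict.1 hδ).log fun x => (h0 x x.2).ne'
  obtain ⟨e, he⟩ := ContinuousMap.exists_restrict_eq (Metric.isClosed_sphere (x := (0 : E)) (ε := 1))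
    ⟨_, hc⟩
  refine ⟨fun x => Real.exp (e x), e.continuous.rexp, fun x => Real.exp_pos _, fun x hx => ?_⟩
  have := DFunLike.congr_fun he ⟨x, hx⟩
  simp only [ContinuousMap.restrict_apply, ContinuousMap.coe_mk] at this
  simp only [this]
  exact Real.exp_log (h0 x hx)

/-- The open sets on which a given height is clear cover the ball. A finite subcover provides the
slices and a subordinate partition of unity their weights. -/
theorem exists_subordinate [NormedSpace ℝ E] [ProperSpace E] (φ : ℝ ≃ₜ Set.Ioo (-1 : ℝ) 1) {f : E → ConfigSpace n (k + 1)}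
    (hf : ContinuousOn f (Metric.closedBall 0 1)) :
    ∃ (N : ℕ) (s : Fin (N + 1) → ℝ) (μ : E → stdSimplex ℝ (Fin (N + 1))),
      Monotone (fun j => (φ (s j) : ℝ)) ∧ Continuous μ ∧
        Subordinate (Metric.closedBall 0 1) f s μ := by
  classical
  have hfc : Continuous fun x => f (clip x) := hf.comp_continuous continuous_clip clip_mem
  have hUo : ∀ s, IsOpen ((fun x => f (clip x)) ⁻¹' clearAt k s) := fun s =>
    (isOpen_clearAt s).preimage hfc
  -- A finite configuration misses all but finitely many heights, so each point of the ball is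
  -- covered.
  obtain ⟨t, ht⟩ := (isCompact_closedBall (0 : E) 1).elim_finite_subcover _ hUo fun x _ => by
    obtain ⟨s, hs⟩ := ((f (clip x)).1.finite.image fun y => y k).exists_notMem
    exact mem_iUnion.2 ⟨s, fun y hy hys => (hs ⟨y, hy, hys⟩).elim⟩
  -- The heights are ordered by their images under `φ`, which may reverse the order of the line.
  let t' : Finset ℝ := t.image fun s => (φ s : ℝ)
  have htne : t'.Nonempty := by
    obtain ⟨s, hs, -⟩ := mem_iUnion₂.1 (ht (Metric.mem_closedBall_self zero_le_one))
    exact ⟨_, Finset.mem_image_of_mem _ hs⟩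
  obtain ⟨N, hN⟩ : ∃ N, t'.card = N + 1 := ⟨t'.card - 1, by have := htne.card_pos; omega⟩
  let r := t'.orderEmbOfFin hN
  have hrt : ∀ j, ∃ s ∈ t, (φ s : ℝ) = r j := fun j =>
    Finset.mem_image.1 (t'.orderEmbOfFin_mem hN j)
  choose s hst hsr using hrt
  have hcover : Metric.closedBall (0 : E) 1 ⊆
      ⋃ j, (fun x => f (clip x)) ⁻¹' clearAt k (s j) := by
    intro x hx
    obtain ⟨c, hc, hxc⟩ := mem_iUnion₂.1 (ht hx)
    have : (φ c : ℝ) ∈ range r := by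
      rw [Finset.range_orderEmbOfFin]
      exact Finset.mem_image_of_mem _ hc
    obtain ⟨j, hj⟩ := this
    have : s j = c := φ.injective (Subtype.ext ((hsr j).trans hj))
    exact mem_iUnion.2 ⟨j, by rwa [this]⟩
  obtain ⟨P, hP⟩ := PartitionOfUnity.exists_isSubordinate Metric.isClosed_closedBall _
    (fun j => hUo (s j)) hcover
  have hsum : ∀ x, ∑ j, P j (clip x) = 1 := fun x => by
    rw [← finsum_eq_sum_of_fintype]
    exact P.sum_eq_one (clip_mem x)
  refine ⟨N, s, fun x => ⟨fun j => P j (clip x), fun j => P.nonneg j _, hsum x⟩, ?_, ?_, ?_⟩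
  · intro i j hij
    simp only [hsr]
    exact r.monotone hij
  · exact (continuous_pi fun j => (P j).continuous.comp continuous_clip).subtype_mk _
  · intro x hx j hj
    have h1 : x ∈ closure (Function.support (P j)) := by
      rw [mem_closure_iff_frequently]
      refine (hj.and_eventually self_mem_nhdsWithin).filter_mono nhdsWithin_le_nhds |>.mono ?_
      rintro y ⟨h1, h2⟩
      have h3 : clip y = y := clip_of_norm_le (by simpa using h2)
      rwa [Function.mem_support, ← h3]
    have h2 := hP j h1
    rwa [mem_preimage, clip_of_norm_le (by simpa using hx)] at h2

end Ball

end Families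

/-! ### Lifting maps of balls through the scanning map -/

section Ball

variable {n : ℕ} {k : Fin n} {φ : ℝ ≃ₜ Set.Ioo (-1 : ℝ) 1}
  {E : Type*} [NormedAddCommGroup E] [NormedSpace ℝ E] [ProperSpace E]

open ClassifyingSpace

/-- The projection to the unit interval. -/
def toUnit : ℝ → unitInterval := projIcc 0 1 zero_le_one

theorem continuous_toUnit : Continuous toUnit := continuous_projIcc

theorem coe_toUnit {v : ℝ} (h : v ∈ Icc (0 : ℝ) 1) : (toUnit v : ℝ) = v := by
  rw [toUnit, projIcc_of_mem _ h]

theorem toUnit_zero : toUnit 0 = 0 := projIcc_left _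

theorem toUnit_one : toUnit 1 = 1 := projIcc_right _

section Collar

variable {T : Type*} [TopologicalSpace T] {A : Set T}
  {g : T → ClassifyingSpace (SlabMonoid n k)} {N : ℕ}
  {s : Fin (N + 1) → ℝ} {μ : T → stdSimplex ℝ (Fin (N + 1))}

/-- The slices of a homotopy from a point of the classifying space to a point with given slices. -/
def collarList (φ : ℝ ≃ₜ Set.Ioo (-1 : ℝ) 1) (s : Fin (N + 1) → ℝ)
    (x : ClassifyingSpace (SlabMonoid n k)) (μ : stdSimplex ℝ (Fin (N + 1))) (u : ℝ) :
    List (ℝ × ℝ) :=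
  if u ≤ 1 / 2 then tailMove (barDilate x 1) (toUnit (2 * u))
  else innerMove (barDilate x 1) (fun j => φ (s j)) μ (toUnit (2 * u - 1))

theorem collarList_zero (x : ClassifyingSpace (SlabMonoid n k)) (μ : stdSimplex ℝ (Fin (N + 1))) :
    collarList φ s x μ 0 = (datum (barDilate x 1)).2 := by
  rw [collarList, if_pos (by norm_num), mul_zero, toUnit_zero, Set.Icc.coe_zero, tailMove_zero]

theorem slicePart_collarList_one (x : ClassifyingSpace (SlabMonoid n k))
    (μ : stdSimplex ℝ (Fin (N + 1))) :
    slicePart (collarList φ s x μ 1) = slicePart (innerSlices φ s (radius x) μ) := by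
  have e : (2 : ℝ) * 1 - 1 = 1 := by norm_num
  rw [collarList, if_neg (by norm_num), e, toUnit_one, Set.Icc.coe_one, slicePart_innerMove_one,
    radius_barDilate]
  rfl

theorem continuousOn_dilate_family (hg : ContinuousOn g A) :
    ContinuousOn (fun t => barDilate (g t) 1) A := by
  have h : ContinuousOn (fun t => (g t, (1 : unitInterval))) A := hg.prodMk continuousOn_const
  have h2 := (continuous_barDilate (k := k)).comp_continuousOn h
  simpa only [Function.comp_def] using h2

theorem continuousOn_slicedPoint_collarList (hs : Monotone fun j => (φ (s j) : ℝ))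
    (hg : ContinuousOn g A) (h0 : ∀ t ∈ A, 0 < radius (g t))
    (h : Subordinate A (fun t => scan φ (g t)) s μ) (hμ : ContinuousOn μ A) :
    ContinuousOn (fun z : T × ℝ => slicedPoint (datum (barDilate (g z.1) 1)).1
      (collarList φ s (g z.1) (μ z.1) z.2)) (A ×ˢ Icc 0 1) := by
  have h1 : ContinuousOn (fun z : T × ℝ => (barDilate (g z.1) 1, toUnit z.2)) (A ×ˢ Icc 0 1) :=
    ((continuousOn_dilate_family hg).comp continuousOn_fst fun z hz => hz.1).prodMk
      (continuous_toUnit.comp continuous_snd).continuousOn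
  have h2 : ContinuousOn (fun z : T × ℝ => slicedPoint (datum (barDilate (g z.1) 1)).1
      (tailMove (barDilate (g z.1) 1) (toUnit z.2))) (A ×ˢ Icc 0 1) :=
    continuousOn_tailMove.comp h1 fun z hz =>
      ⟨by rw [mem_ofPred_eq, radius_barDilate]; exact h0 _ hz.1, mem_univ _⟩
  have h3 : ContinuousOn (fun z : T × ℝ => (z.1, toUnit z.2)) (A ×ˢ Icc 0 1) :=
    (continuous_fst.prodMk (continuous_toUnit.comp continuous_snd)).continuousOn
  have h4 : ContinuousOn (fun z : T × ℝ => slicedPoint (datum (barDilate (g z.1) 1)).1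
      (innerMove (barDilate (g z.1) 1) (fun j => φ (s j)) (μ z.1) (toUnit z.2))) (A ×ˢ Icc 0 1) :=
    (continuousOn_innerMove_family hs hg h0 h hμ).comp h3 fun z hz => ⟨hz.1, mem_univ _⟩
  refine (continuousOn_concat h2 h4 fun x hx => ?_).congr fun z hz => ?_
  · simp only [toUnit_one, toUnit_zero, Set.Icc.coe_one, Set.Icc.coe_zero]
    exact slicedPoint_slicePart_congr _ (slicePart_innerMove_zero _ _ _).symm
  · simp only [collarList, concat]
    split_ifs <;> rfl

theorem continuousOn_interpolate_collarList (hs : Monotone fun j => (φ (s j) : ℝ))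
    (hg : ContinuousOn g A) (h0 : ∀ t ∈ A, 0 < radius (g t))
    (h : Subordinate A (fun t => scan φ (g t)) s μ) (hμ : ContinuousOn μ A) :
    ContinuousOn (fun z : (T × ℝ) × ℝ => interpolate φ (datum (barDilate (g z.1.1) 1)).1
      (radius (barDilate (g z.1.1) 1)) (collarList φ s (g z.1.1) (μ z.1.1) z.2) (toUnit z.1.2))
      ((A ×ˢ Icc 0 1) ×ˢ Icc 0 1) := by
  have h1 : ContinuousOn (fun z : (T × ℝ) × ℝ =>
      (barDilate (g z.1.1) 1, toUnit z.2, toUnit z.1.2)) ((A ×ˢ Icc 0 1) ×ˢ Icc 0 1) :=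
    ((continuousOn_dilate_family hg).comp (continuous_fst.comp continuous_fst).continuousOn
      fun z hz => hz.1.1).prodMk ((continuous_toUnit.comp continuous_snd).prodMk
        (continuous_toUnit.comp (continuous_snd.comp continuous_fst))).continuousOn
  have h2 : ContinuousOn (fun z : (T × ℝ) × ℝ => interpolate φ (datum (barDilate (g z.1.1) 1)).1
      (radius (barDilate (g z.1.1) 1)) (tailMove (barDilate (g z.1.1) 1) (toUnit z.2))
      (toUnit z.1.2)) ((A ×ˢ Icc 0 1) ×ˢ Icc 0 1) := by
    have h2' := (continuousOn_interpolate_tailMove (φ := φ)).comp h1 fun z hz =>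
      ⟨by rw [mem_ofPred_eq, radius_barDilate]; exact h0 _ hz.1.1, mem_univ _⟩
    simpa only [Function.comp_def] using h2'
  have h3 : ContinuousOn (fun z : (T × ℝ) × ℝ => (z.1.1, toUnit z.2, toUnit z.1.2))
      ((A ×ˢ Icc 0 1) ×ˢ Icc 0 1) :=
    ((continuous_fst.comp continuous_fst).prodMk ((continuous_toUnit.comp continuous_snd).prodMk
      (continuous_toUnit.comp (continuous_snd.comp continuous_fst)))).continuousOn
  have h4 : ContinuousOn (fun z : (T × ℝ) × ℝ => interpolate φ (datum (barDilate (g z.1.1) 1)).1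
      (radius (barDilate (g z.1.1) 1)) (innerMove (barDilate (g z.1.1) 1) (fun j => φ (s j))
      (μ z.1.1) (toUnit z.2)) (toUnit z.1.2)) ((A ×ˢ Icc 0 1) ×ˢ Icc 0 1) := by
    have h4' := (continuousOn_interpolate_innerMove_family hs hg h0 h hμ).comp h3
      fun z hz => ⟨hz.1.1, mem_univ _⟩
    simpa only [Function.comp_def] using h4'
  refine (continuousOn_concat h2 h4 fun x hx => ?_).congr fun z hz => ?_
  · simp only [toUnit_one, toUnit_zero, Set.Icc.coe_one, Set.Icc.coe_zero]
    exact interpolate_congr _ _ (slicePart_innerMove_zero _ _ _).symm _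
  · simp only [collarList, concat]
    split_ifs <;> rfl

theorem interpolate_collarList_one (hs : Monotone fun j => (φ (s j) : ℝ))
    (hg : ContinuousOn g A) (h0 : ∀ t ∈ A, 0 < radius (g t))
    (h : Subordinate A (fun t => scan φ (g t)) s μ) {t : T} (ht : t ∈ A) (u : ℝ) :
    interpolate φ (datum (barDilate (g t) 1)).1 (radius (barDilate (g t) 1))
        (collarList φ s (g t) (μ t) u) 1 =
      scan φ (slicedPoint (datum (barDilate (g t) 1)).1 (collarList φ s (g t) (μ t) u)) := by
  rw [collarList]
  split_ifs
  · exact interpolate_tailMove_one (by rw [radius_barDilate]; exact h0 t ht) _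
  · exact interpolate_innerMove_one_of_subordinate hs hg h0 h ht _

end Collar

/-- The lift over the ball uses subordinate slices in a squeezed slab whose radius extends that of
`g`. The collar moves the slices of `g` first to the tail and then to the subordinate ones. `Q`
stretches the interpolated slab with collar time `u` and interpolation parameter `v`; the
compatibilities on its four sides are the hypotheses of `compressible_of_collar`. -/
theorem compressible_dilate {f : E → ConfigSpace n (k + 1)}
    {g : E → ClassifyingSpace (SlabMonoid n k)} (hf : ContinuousOn f (Metric.closedBall 0 1))
    (hg : ContinuousOn g (Metric.sphere 0 1))
    (h0 : ∀ x ∈ Metric.sphere (0 : E) 1, 0 < radius (g x))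
    (hfg : ∀ x ∈ Metric.sphere (0 : E) 1, f x = scan φ (g x)) :
    Compressible (scan φ) (fun x => (f x).dilate 1) fun x => barDilate (g x) 1 := by
  obtain ⟨N, s, μ, hs, hμ, hsub⟩ := exists_subordinate φ hf
  -- On the sphere the squeezing radius must be the radius of `g x`, so that squeezing the scan
  -- returns the configuration of `g x`.
  obtain ⟨e, he, he0, heδ⟩ := exists_pos_extension (continuous_radius.comp_continuousOn hg) h0
  have hsubS : Subordinate (Metric.sphere 0 1) (fun x => scan φ (g x)) s μ := by
    intro x hx j hj
    simp only
    rw [← hfg x hx]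
    exact hsub x (Metric.sphere_subset_closedBall hx) j
      (hj.filter_mono (nhdsWithin_mono _ Metric.sphere_subset_closedBall))
  have h0' : ∀ x ∈ Metric.sphere (0 : E) 1, 0 < radius (barDilate (g x) 1) := fun x hx => by
    rw [radius_barDilate]
    exact h0 x hx
  have hfg' : ∀ x ∈ Metric.sphere (0 : E) 1, (f x).dilate 1 = scan φ (barDilate (g x) 1) :=
    fun x hx => by rw [scan_barDilate, hfg x hx]
  have hsl : ∀ x ∈ Metric.sphere (0 : E) 1,
      Sliceable (push φ (scan φ (barDilate (g x) 1)) (radius (barDilate (g x) 1)))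
        (innerSlices φ s (radius (barDilate (g x) 1)) (μ x)) := fun x hx => by
    rw [scan_barDilate]
    exact sliceable_innerSlices hsubS (continuous_scan.comp_continuousOn hg) hs (h0' x hx) hx
  have hgS := continuousOn_slicedPoint_collarList hs hg h0 hsubS hμ.continuousOn
  have hQS := continuousOn_interpolate_collarList hs hg h0 hsubS hμ.continuousOn
  have hhS := continuousOn_innerSlices hsub hf hs he.continuousOn (fun x _ => he0 x) hμ.continuousOn
  have hFS := continuousOn_interpolate_innerSlices hsub hf hs he.continuousOn (fun x _ => he0 x)
    hμ.continuousOn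
  have hfd : ContinuousOn (fun x => (f x).dilate 1) (Metric.closedBall 0 1) :=
    ConfigSpace.continuous_dilate.comp_continuousOn (f := fun x => (f x, (1 : unitInterval)))
      (hf.prodMk continuousOn_const)
  refine compressible_of_collar hfd hhS hFS hgS hQS (fun x hx => ?_) (fun x hx => ?_)
    (fun x hx => ?_) (fun x hx => ?_) (fun x hx v hv => ?_) (fun x hx v hv => ?_)
    (fun x hx u hu => ?_) (fun x hx u hu => ?_)
  · exact interpolate_innerSlices_zero _ (he0 x) _
  · simp only
    rw [interpolate_one, (sliceable_innerSlices hsub hf hs (he0 x) hx).scan_slicedPoint]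
  · simp only
    rw [collarList_zero, slicedPoint_datum]
  · simp only
    rw [hfg' x hx, slicedPoint_slicePart_congr _ (slicePart_collarList_one _ _), heδ x hx,
      Function.comp_apply, ← radius_barDilate (g x) 1]
    exact (slicedPoint_push_scan (h0' x hx) (hsl x hx) fun z => mem_innerSlices (h0' x hx)).symm
  · simp only
    rw [collarList_zero, interpolate_datum, hfg' x hx]
  · simp only [coe_toUnit hv]
    rw [hfg' x hx, interpolate_congr _ _ (slicePart_collarList_one _ _), heδ x hx,
      Function.comp_apply, ← radius_barDilate (g x) 1]
    exact (interpolate_push_scan (h0' x hx) (hsl x hx) (fun z => mem_innerSlices (h0' x hx))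
      hv).symm
  · simp only [toUnit_zero, Set.Icc.coe_zero]
    rw [interpolate_datum_zero, hfg' x hx]
  · simp only [toUnit_one, Set.Icc.coe_one]
    exact interpolate_collarList_one hs hg h0 hsubS hx u

/-- The scanning map has the lifting property up to homotopy with respect to balls. -/
theorem compressible_scan {f : E → ConfigSpace n (k + 1)}
    {g : E → ClassifyingSpace (SlabMonoid n k)} (hf : ContinuousOn f (Metric.closedBall 0 1))
    (hg : ContinuousOn g (Metric.sphere 0 1))
    (hfg : ∀ x ∈ Metric.sphere (0 : E) 1, f x = scan φ (g x)) : Compressible (scan φ) f g := by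
  have hz : ContinuousOn (fun z : E × ℝ => (g z.1, toUnit z.2)) (Metric.sphere 0 1 ×ˢ Icc 0 1) :=
    (hg.comp continuousOn_fst fun z hz => hz.1).prodMk
      (continuous_toUnit.comp continuous_snd).continuousOn
  have hG : ContinuousOn (fun z : E × ℝ => barDouble (g z.1) (toUnit z.2))
      (Metric.sphere 0 1 ×ˢ Icc 0 1) := by
    have h := (continuous_barDouble (k := k)).comp_continuousOn hz
    simpa only [Function.comp_def] using h
  -- The doubling homotopy exists only on the classifying space; over the ball it is supplied by
  -- homotopy extension.
  obtain ⟨F, hF, hF0, hFG⟩ := exists_homotopy_extension continuous_scan hf hG fun x hx => by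
    simp only [toUnit_zero]
    rw [barDouble_zero, hfg x hx]
  have h0 : (0 : ℝ) ∈ Icc (0 : ℝ) 1 := by simp
  have h1 : (1 : ℝ) ∈ Icc (0 : ℝ) 1 := by simp
  have hF1 : ContinuousOn (fun x => F (x, 1)) (Metric.closedBall 0 1) :=
    hF.comp (by fun_prop) fun x hx => ⟨hx, h1⟩
  have hG1 : ContinuousOn (fun x => barDouble (g x) 1) (Metric.sphere 0 1) := by
    have := hG.comp (f := fun x : E => (x, (1 : ℝ))) (s := Metric.sphere 0 1) (by fun_prop)
      fun x hx => ⟨hx, h1⟩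
    simpa only [Function.comp_def, toUnit_one] using this
  have hFG1 : ∀ x ∈ Metric.sphere (0 : E) 1, F (x, 1) = scan φ (barDouble (g x) 1) := fun x hx => by
    rw [hFG x hx 1 h1, toUnit_one]
  have step2 := compressible_dilate hF1 hG1 (fun x _ => radius_barDouble_pos (g x)) hFG1
  have hz2 : ContinuousOn (fun z : E × ℝ => (F (z.1, 1), toUnit z.2))
      (Metric.closedBall 0 1 ×ˢ Icc 0 1) :=
    (hF1.comp continuousOn_fst fun z hz => hz.1).prodMk
      (continuous_toUnit.comp continuous_snd).continuousOn
  have hz3 : ContinuousOn (fun z : E × ℝ => (barDouble (g z.1) 1, toUnit z.2))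
      (Metric.sphere 0 1 ×ˢ Icc 0 1) :=
    (hG1.comp continuousOn_fst fun z hz => hz.1).prodMk
      (continuous_toUnit.comp continuous_snd).continuousOn
  have hF2 : ContinuousOn (fun z : E × ℝ => (F (z.1, 1)).dilate (toUnit z.2))
      (Metric.closedBall 0 1 ×ˢ Icc 0 1) := by
    have h := ConfigSpace.continuous_dilate.comp_continuousOn hz2
    simpa only [Function.comp_def] using h
  have hG2 : ContinuousOn (fun z : E × ℝ => barDilate (barDouble (g z.1) 1) (toUnit z.2))
      (Metric.sphere 0 1 ×ˢ Icc 0 1) := by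
    have h := (continuous_barDilate (k := k)).comp_continuousOn hz3
    simpa only [Function.comp_def] using h
  -- Dilation is defined on both spaces, so here the homotopy of pairs is explicit.
  have step1 : Compressible (scan φ) (fun x => F (x, 1)) fun x => barDouble (g x) 1 := by
    have := Compressible.of_homotopy (σ := scan φ) continuous_scan hF2 hG2 (fun x hx v hv => by
        simp only
        rw [scan_barDilate, hFG1 x hx]) (by simpa only [toUnit_one] using step2)
    simpa only [toUnit_zero, ConfigSpace.dilate_zero, barDilate_zero] using this
  have step0 := Compressible.of_homotopy continuous_scan hF hG hFG
    (by simpa only [toUnit_one] using step1)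
  simp only [toUnit_zero, barDouble_zero] at step0
  obtain ⟨h, hh, hhg, H, hH, hH0, hH1, hHS⟩ := step0
  refine ⟨h, hh, hhg, H, hH, fun x hx => (hH0 x hx).trans (hF0 x hx), hH1, fun x hx v hv => ?_⟩
  exact (hHS x hx v hv).trans (hF0 x (Metric.sphere_subset_closedBall hx))

end Ball

/-! ### Cubes as unit balls of the supremum norm -/

section Cubes

variable {q : ℕ}

/-- The cube `[0,1]^q` as the unit ball of the supremum norm. -/
def ballOfCube (y : Fin q → unitInterval) : Fin q → ℝ := fun i => 2 * (y i : ℝ) - 1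

/-- The unit ball of the supremum norm as the cube `[0,1]^q`. -/
def cubeOfBall (x : Fin q → ℝ) : Fin q → unitInterval := fun i => toUnit ((x i + 1) / 2)

theorem continuous_ballOfCube : Continuous (ballOfCube (q := q)) := by
  unfold ballOfCube
  fun_prop

theorem continuous_cubeOfBall : Continuous (cubeOfBall (q := q)) :=
  continuous_pi fun i => continuous_toUnit.comp (by fun_prop)

theorem cubeOfBall_ballOfCube (y : Fin q → unitInterval) : cubeOfBall (ballOfCube y) = y := by
  funext i
  have h : (ballOfCube y i + 1) / 2 = y i := by
    rw [ballOfCube]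
    ring
  rw [cubeOfBall, h, toUnit, projIcc_val]

theorem abs_ballOfCube_le (y : Fin q → unitInterval) (i : Fin q) : |ballOfCube y i| ≤ 1 := by
  rw [ballOfCube, abs_le]
  constructor <;> linarith [(y i).2.1, (y i).2.2]

theorem ballOfCube_mem (y : Fin q → unitInterval) : ballOfCube y ∈ Metric.closedBall (0 : Fin q → ℝ) 1 := by
  rw [mem_closedBall_zero_iff, pi_norm_le_iff_of_nonneg zero_le_one]
  exact abs_ballOfCube_le y

theorem ballOfCube_mem_sphere {y : Fin q → unitInterval} (hy : y ∈ Cube.boundary (Fin q)) :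
    ballOfCube y ∈ Metric.sphere (0 : Fin q → ℝ) 1 := by
  obtain ⟨i, hi⟩ := hy
  rw [mem_sphere_zero_iff_norm]
  refine le_antisymm (mem_closedBall_zero_iff.1 (ballOfCube_mem y)) ?_
  refine le_trans (le_of_eq ?_) (norm_le_pi_norm (ballOfCube y) i)
  rcases hi with hi | hi <;> simp [ballOfCube, hi] <;> norm_num

theorem cubeOfBall_mem_boundary {x : Fin q → ℝ} (hx : x ∈ Metric.sphere (0 : Fin q → ℝ) 1) :
    cubeOfBall x ∈ Cube.boundary (Fin q) := by
  rw [mem_sphere_zero_iff_norm] at hx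
  by_contra h
  have h' : ‖x‖ < 1 := by
    refine (pi_norm_lt_iff zero_lt_one).2 fun i => ?_
    have hle : |x i| ≤ 1 := by
      have := norm_le_pi_norm x i
      rwa [hx, Real.norm_eq_abs] at this
    rw [Real.norm_eq_abs]
    refine lt_of_le_of_ne hle fun hi => h ⟨i, ?_⟩
    rcases (abs_eq zero_le_one).1 hi with hi | hi
    · right
      rw [cubeOfBall, hi, show ((1 : ℝ) + 1) / 2 = 1 by norm_num, toUnit_one]
    · left
      rw [cubeOfBall, hi, show ((-1 : ℝ) + 1) / 2 = 0 by norm_num, toUnit_zero]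
  exact h'.ne hx

theorem Cube.mem_boundary_succ {y : Fin (q + 1) → unitInterval} (hy : y ∈ Cube.boundary (Fin (q + 1))) :
    y 0 = 0 ∨ y 0 = 1 ∨ Fin.tail y ∈ Cube.boundary (Fin q) := by
  obtain ⟨i, hi⟩ := hy
  refine Fin.cases (fun h => ?_) (fun j h => Or.inr (Or.inr ⟨j, h⟩)) i hi
  exact h.imp_right Or.inl

theorem Cube.cons_mem_boundary {t : unitInterval} {y : Fin q → unitInterval}
    (h : t = 0 ∨ t = 1 ∨ y ∈ Cube.boundary (Fin q)) :
    (Fin.cons t y : Fin (q + 1) → unitInterval) ∈ Cube.boundary (Fin (q + 1)) := by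
  rcases h with h | h | ⟨j, h⟩
  · exact ⟨0, Or.inl h⟩
  · exact ⟨0, Or.inr h⟩
  · exact ⟨j.succ, h⟩

end Cubes

/-! ### From compression of balls to weak equivalences -/

section WeakEquivalenceCriterion

variable {X Y : Type*} [TopologicalSpace X] [TopologicalSpace Y]

/-- Every map of pairs from a ball and its boundary sphere to the mapping cylinder of `σ` can be
compressed into the domain of `σ`. -/
def BallCompressible (σ : X → Y) : Prop :=
  ∀ (q : ℕ) (f : (Fin q → ℝ) → Y) (g : (Fin q → ℝ) → X),
    ContinuousOn f (Metric.closedBall 0 1) → ContinuousOn g (Metric.sphere 0 1) →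
    (∀ x ∈ Metric.sphere (0 : Fin q → ℝ) 1, f x = σ (g x)) → Compressible σ f g

namespace BallCompressible

variable {σ : C(X, Y)} {q : ℕ}

theorem exists_lift (hσ : BallCompressible σ) (f : C(Fin q → unitInterval, Y)) {g : (Fin q → unitInterval) → X}
    (hg : ContinuousOn g (Cube.boundary (Fin q)))
    (hfg : ∀ y ∈ Cube.boundary (Fin q), f y = σ (g y)) :
    ∃ h : C(Fin q → unitInterval, X), (∀ y ∈ Cube.boundary (Fin q), h y = g y) ∧
      f.HomotopicRel (σ.comp h) (Cube.boundary (Fin q)) := by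
  obtain ⟨h, hh, hhg, H, hH, hH0, hH1, hHS⟩ := hσ q (f ∘ cubeOfBall) (g ∘ cubeOfBall)
    (f.continuous.comp continuous_cubeOfBall).continuousOn
    (hg.comp continuous_cubeOfBall.continuousOn fun x hx => cubeOfBall_mem_boundary hx)
    fun x hx => hfg _ (cubeOfBall_mem_boundary hx)
  refine ⟨⟨h ∘ ballOfCube, hh.comp_continuous continuous_ballOfCube ballOfCube_mem⟩,
    fun y hy => ?_, ⟨⟨⟨⟨fun z => H (ballOfCube z.2, z.1), ?_⟩, fun y => ?_, fun y => ?_⟩,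
      fun t y hy => ?_⟩⟩⟩
  · change h (ballOfCube y) = g y
    rw [hhg _ (ballOfCube_mem_sphere hy), Function.comp_apply, cubeOfBall_ballOfCube]
  · exact hH.comp_continuous ((continuous_ballOfCube.comp continuous_snd).prodMk
      (continuous_subtype_val.comp continuous_fst)) fun z => ⟨ballOfCube_mem _, z.1.2⟩
  · change H (ballOfCube y, ((0 : unitInterval) : ℝ)) = f y
    rw [Set.Icc.coe_zero, hH0 _ (ballOfCube_mem y), Function.comp_apply, cubeOfBall_ballOfCube]
  · change H (ballOfCube y, ((1 : unitInterval) : ℝ)) = σ (h (ballOfCube y))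
    rw [Set.Icc.coe_one, hH1 _ (ballOfCube_mem y)]
  · change H (ballOfCube y, (t : ℝ)) = f y
    rw [hHS _ (ballOfCube_mem_sphere hy) _ t.2, Function.comp_apply, cubeOfBall_ballOfCube]

/-- Injectivity is the lifting property one dimension higher: the homotopy downstairs is a map of
the `(q + 1)`-cube, lifted on its boundary by `a` and `b` on the two ends and by their common values
on the sides. -/
theorem homotopicRel_of_comp (hσ : BallCompressible σ) {a b : C(Fin q → unitInterval, X)}
    (hab : ∀ y ∈ Cube.boundary (Fin q), a y = b y)
    (h : (σ.comp a).HomotopicRel (σ.comp b) (Cube.boundary (Fin q))) :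
    a.HomotopicRel b (Cube.boundary (Fin q)) := by
  obtain ⟨F⟩ := h
  have htail : Continuous fun y : Fin (q + 1) → unitInterval => Fin.tail y :=
    continuous_pi fun i => continuous_apply i.succ
  have hcons : Continuous fun z : unitInterval × (Fin q → unitInterval) =>
      (Fin.cons z.1 z.2 : Fin (q + 1) → unitInterval) :=
    continuous_pi fun i => Fin.cases continuous_fst
      (fun j => (continuous_apply j).comp continuous_snd) i
  have hz : Continuous fun y : Fin (q + 1) → unitInterval => (y 0 : ℝ) := by fun_prop
  -- The boundary values switch from `a` to `b` at time `1 / 2`. A boundary point at that time lies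
  -- on a side of the cube, where `a` and `b` agree.
  have hg : ContinuousOn (fun y : Fin (q + 1) → unitInterval =>
      if (y 0 : ℝ) ≤ 1 / 2 then a (Fin.tail y) else b (Fin.tail y))
      (Cube.boundary (Fin (q + 1))) := by
    refine ContinuousOn.ite_le hz continuous_const (a.continuous.comp htail).continuousOn
      (b.continuous.comp htail).continuousOn fun y hy hy' => ?_
    rcases Cube.mem_boundary_succ hy with h | h | h
    · rw [h] at hy'
      norm_num at hy'
    · rw [h] at hy'
      norm_num at hy'
    · exact hab _ h
  obtain ⟨G, hG, -⟩ := hσ.exists_lift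
    ⟨fun y : Fin (q + 1) → unitInterval => F (y 0, Fin.tail y),
      F.continuous.comp ((continuous_apply 0).prodMk htail)⟩ hg fun y hy => by
    change F (y 0, Fin.tail y) = _
    rcases Cube.mem_boundary_succ hy with h | h | h
    · rw [h, if_pos (by simp), F.apply_zero]
      rfl
    · rw [h, if_neg (by norm_num), F.apply_one]
      rfl
    · rw [F.eq_fst _ h, ← hab _ h, ite_self]
      rfl
  refine ⟨⟨⟨⟨fun z => G (Fin.cons z.1 z.2), G.continuous.comp hcons⟩, fun y => ?_,
    fun y => ?_⟩, fun t y hy => ?_⟩⟩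
  · refine (hG _ (Cube.cons_mem_boundary (Or.inl rfl))).trans ?_
    simp
  · refine (hG _ (Cube.cons_mem_boundary (Or.inr (Or.inl rfl)))).trans ?_
    simp only [Fin.cons_zero, Fin.tail_cons, Set.Icc.coe_one]
    rw [if_neg (by norm_num)]
  · refine (hG _ (Cube.cons_mem_boundary (Or.inr (Or.inr hy)))).trans ?_
    simp only [Fin.cons_zero, Fin.tail_cons]
    rw [← hab y hy, ite_self]

/-- The cube of dimension zero is a point with empty boundary: lifting over it gives surjectivity,
and the relative statement for it turns paths downstairs into paths upstairs. -/
theorem bijective_zerothHomotopyMap [hX : Nonempty X] (hσ : BallCompressible σ) :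
    Function.Bijective (zerothHomotopyMap σ) := by
  constructor
  · intro x x'
    induction x using Quotient.inductionOn with | h x => ?_
    induction x' using Quotient.inductionOn with | h x' => ?_
    intro h
    obtain ⟨γ⟩ : Joined (σ x) (σ x') := Quotient.exact h
    obtain ⟨H⟩ := hσ.homotopicRel_of_comp (q := 0) (a := .const _ x) (b := .const _ x')
      (fun y hy => hy.elim fun i _ => i.elim0)
      ⟨⟨⟨⟨fun z => γ z.1, γ.continuous.comp continuous_fst⟩, fun _ => γ.source,
        fun _ => γ.target⟩, fun _ y hy => hy.elim fun i _ => i.elim0⟩⟩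
    exact Quotient.sound ⟨H.toHomotopy.evalAt finZeroElim⟩
  · intro y
    induction y using Quotient.inductionOn with | h y => ?_
    obtain ⟨h, -, ⟨H⟩⟩ := hσ.exists_lift (q := 0) (.const _ y) (g := fun _ => hX.some)
      continuousOn_const (fun y hy => hy.elim fun i _ => i.elim0)
    exact ⟨Quotient.mk _ (h finZeroElim),
      Quotient.sound ⟨(H.toHomotopy.evalAt finZeroElim).symm⟩⟩

/-- Loops are maps of cubes that are constant on the boundary. Injectivity is
`homotopicRel_of_comp`, and surjectivity lifts with constant boundary value `x`. -/
theorem bijective_homotopyGroupMap (hσ : BallCompressible σ) (q : ℕ) (x : X) :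
    Function.Bijective (homotopyGroupMap (Fin (q + 1)) σ x) := by
  constructor
  · intro a b
    induction a using Quotient.inductionOn with | h a => ?_
    induction b using Quotient.inductionOn with | h b => ?_
    intro h
    refine Quotient.sound (hσ.homotopicRel_of_comp (fun y hy => ?_) (Quotient.exact h))
    exact (a.2 y hy).trans (b.2 y hy).symm
  · intro c
    induction c using Quotient.inductionOn with | h c => ?_
    obtain ⟨h, hh, hH⟩ := hσ.exists_lift c.1 (g := fun _ => x) continuousOn_const c.2
    exact ⟨Quotient.mk _ ⟨h, hh⟩, Quotient.sound hH.symm⟩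

theorem isWeakHomotopyEquiv [Nonempty X] (hσ : BallCompressible σ) : IsWeakHomotopyEquiv σ :=
  ⟨hσ.bijective_zerothHomotopyMap, hσ.bijective_homotopyGroupMap⟩

end BallCompressible

end WeakEquivalenceCriterion

end

theorem proposition1p3 (n : ℕ) (k : Fin n) (φ : ℝ ≃ₜ Set.Ioo (-1 : ℝ) 1) :
    ∃ σ : C(ClassifyingSpace (SlabMonoid n k), ConfigSpace n ((k : ℕ) + 1)),
      (∀ (p : ℕ) (w : stdSimplex ℝ (Fin (p + 1))) (m : Fin p → SlabMonoid n k),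
        (σ (ClassifyingSpace.mk w m)).1.carrier = stretchedConfig φ w m) ∧
      IsWeakHomotopyEquiv σ := by
  have : Nonempty (ClassifyingSpace (SlabMonoid n k)) :=
    ⟨ClassifyingSpace.mk (p := 0) (stdSimplex.vertex 0) finZeroElim⟩
  exact ⟨⟨scan φ, continuous_scan⟩, fun p w m => scan_mk_carrier w m,
    BallCompressible.isWeakHomotopyEquiv fun _ _ _ hf hg hfg => compressible_scan hf hg hfg⟩
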